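/- Fix a constant $0<\delta<1$. Consider MPCs for graphs with $n$ vertices and (at most) $m$ edges that have $M=M(n,m)$ machines with $S=S(n)$ words of local memory each, where a word has $O(\log n)$ bits, $S=O(n^\delta)$, $S\ge n^{\varepsilon}$ for some constant $\varepsilon>0$ and all large $n$, and the global space satisfies $S\cdot M\ge n+m$ (a vertex or an edge of the input counts as one word). The computation is synchronous: in each round every machine performs an arbitrary local computation using fresh private coins and then sends at most $S$ words, each to a single machine; a run in which some machine receives more than $S$ words in a round counts as failed. The algorithm may be an arbitrary family indexed by the input size. The input vertices and edges are distributed arbitrarily among the machines, with at most $S$ of them on each machine. Let $D=D(n)\le \log_2^{3/2} n$ and let $T=T(n)\ge 1$. Suppose that for all sufficiently large $n$ and all $m$ there is an MPC algorithm with $T(n)$ rounds which, for every $n$-vertex graph $G$ with at most $m$ edges and every distribution of the input, with probability at least $1-\frac1{n^3}$ correctly determines all connected components of $G$ of diameter at most $D$; that is, the machine given vertex $v$ outputs a label $cc(v)$ (one word), and for all $u,v$ lying in components of diameter at most $D$, $cc(u)=cc(v)$ if and only if $u$ and $v$ are connected (the labels in larger components are ignored). Then: 1. If $T=o(\log D)$,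 then there is $T'=o(\log n)$ such that for all sufficiently large $n$ there is an MPC algorithm with $T'(n)$ rounds, with the same local space $S(n)$ and the same number $M(n,n)$ of machines (only the constant in the $O(\log n)$ word length may change), that with probability at least $1-\frac1n$ distinguishes whether the input graph is an $n$-vertex cycle or consists of two disjoint $\frac n2$-vertex cycles (for odd $n$: cycles on $\lfloor n/2\rfloor$ and $\lceil n/2\rceil$ vertices). 2. Either $T=\Omega(\log D)$, or there are an infinite set $I$ of values of $n$ and a function $T'$ with $T'(n)=o(\log n)$ as $n\to\infty$ in $I$ such that for every $n\in I$ there is such an algorithm with $T'(n)$ rounds for the one-versus-two-cycles problem. -/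

import Mathlib

open Filter Asymptotics

namespace MPC

/-- The local memory of one machine: `S` words, a word being a number below `W`. -/
abbrev Memory (S W : ℕ) : Type := Fin S → Fin W

/-- What one machine sends in one round: at most `S` words (one per slot), each of them
addressed to a single machine. -/
abbrev Outbox (S M W : ℕ) : Type := Fin S → Option (Fin M × Fin W)

/-- What one machine receives in one round: words, each with its sender and the sender's slot. -/
abbrev Inbox (S M W : ℕ) : Type := Set (Fin M × Fin S × Fin W)

/-- The words that reach machine `i` when every machine `j` sends `out j`. -/
def deliver {S M W : ℕ} (out : Fin M → Outbox S M W) (i : Fin M) : Inbox S M W :=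
  {p | out p.1 p.2.1 = some (i, p.2.2)}

/-- An arbitrary distribution of the vertices and the edges of a graph on `n` vertices among `M`
machines, no machine getting more than `S` of these records. -/
structure Placement {n : ℕ} (G : SimpleGraph (Fin n)) (S M : ℕ) where
  vertexAt : Fin n → Fin M
  edgeAt : Sym2 (Fin n) → Fin M
  fits : ∀ i, {v | vertexAt v = i}.ncard + {e | e ∈ G.edgeSet ∧ edgeAt e = i}.ncard ≤ S

/-- A randomized algorithm with `T` rounds on `M` machines with `S` words of local memory, for
graphs on the vertex set `Fin n`. Local computation is unrestricted. In every round each machine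
tosses `coins` fresh private fair coins. -/
structure Algorithm (n S M W T : ℕ) (Out : Type) where
  /-- number of coins of each machine in each round -/
  coins : ℕ
  /-- initial memory of a machine, from the vertices and the edges that it is given -/
  load : Fin M → Set (Fin n) → Set (Sym2 (Fin n)) → Memory S W
  /-- local computation in a round: from the coins, the memory and the words received at the end
  of the previous round to the new memory and the words sent -/
  step : Fin T → Fin M → (Fin coins → Bool) → Memory S W → Inbox S M W →
    Memory S W × Outbox S M W
  /-- output of a machine after the last round -/
  output : Fin M → Memory S W → Inbox S M W → Out

namespace Algorithm

variable {n S M W T : ℕ} {Out : Type}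

/-- All coin tosses of an execution. -/
abbrev Tosses (A : Algorithm n S M W T Out) : Type := Fin T → Fin M → Fin A.coins → Bool

/-- Memory and inbox of every machine after `t` rounds (the execution stops after `T` rounds). -/
def run (A : Algorithm n S M W T Out) {G : SimpleGraph (Fin n)} (P : Placement G S M)
    (ω : A.Tosses) : ℕ → Fin M → Memory S W × Inbox S M W
  | 0 => fun i =>
      (A.load i {v | P.vertexAt v = i} {e | e ∈ G.edgeSet ∧ P.edgeAt e = i}, ∅)
  | t + 1 =>
      if h : t < T then
        let res : Fin M → Memory S W × Outbox S M W := fun i =>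
          A.step ⟨t, h⟩ i (ω ⟨t, h⟩ i) (A.run P ω t i).1 (A.run P ω t i).2
        fun i => ((res i).1, deliver (fun j => (res j).2) i)
      else A.run P ω t

/-- No machine ever receives more than `S` words in a round. -/
def WithinSpace (A : Algorithm n S M W T Out) {G : SimpleGraph (Fin n)} (P : Placement G S M)
    (ω : A.Tosses) : Prop :=
  ∀ t ≤ T, ∀ i, (A.run P ω t i).2.ncard ≤ S

/-- The output of machine `i`. -/
def result (A : Algorithm n S M W T Out) {G : SimpleGraph (Fin n)} (P : Placement G S M)
    (ω : A.Tosses) (i : Fin M) : Out :=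
  A.output i (A.run P ω T i).1 (A.run P ω T i).2

/-- Probability of an event over the independent fair coin tosses of an execution. -/
noncomputable def prob (A : Algorithm n S M W T Out) (E : Set A.Tosses) : ℝ :=
  (E.ncard : ℝ) / (Nat.card A.Tosses : ℝ)

end Algorithm

/-- The connected component of `u` has diameter at most `D`. -/
def ComponentDiamLE {n : ℕ} (G : SimpleGraph (Fin n)) (D : ℕ) (u : Fin n) : Prop :=
  ∀ x y, G.Reachable u x → G.Reachable u y → G.dist x y ≤ D

/-- The labelling `cc` is correct on the components of diameter at most `D`; the labels in larger
components are ignored. -/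
def CorrectComponents {n : ℕ} {L : Type} (G : SimpleGraph (Fin n)) (D : ℕ) (cc : Fin n → L) :
    Prop :=
  ∀ u v, ComponentDiamLE G D u → ComponentDiamLE G D v → (G.Reachable u v ↔ cc u = cc v)

/-- On `M` machines with `S` words (numbers below `n ^ w`) each there is a `T`-round algorithm
that, for every graph with `n` vertices and at most `m` edges and every placement of its input,
with probability at least `1 - 1 / n ^ 3` determines all components of diameter at most `D`. The
label `cc v` is output by the machine that was given the vertex `v`. -/
def SolvesComponents (n m S M w D T : ℕ) : Prop :=
  ∃ A : Algorithm n S M (n ^ w) T (Fin n → Fin (n ^ w)),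
    ∀ G : SimpleGraph (Fin n), G.edgeSet.ncard ≤ m → ∀ P : Placement G S M,
      1 - 1 / (n : ℝ) ^ 3 ≤ A.prob {ω | A.WithinSpace P ω ∧
        CorrectComponents G D (fun v => A.result P ω (P.vertexAt v) v)}

/-- `G` is an `n`-vertex cycle. -/
def IsOneCycle {n : ℕ} (G : SimpleGraph (Fin n)) : Prop :=
  Nonempty (G ≃g SimpleGraph.cycleGraph n)

/-- `G` consists of two disjoint cycles on `n / 2` vertices each (for odd `n`, of two disjoint
cycles whose numbers of vertices are `n / 2` rounded down and up). -/
def IsTwoCycles {n : ℕ} (G : SimpleGraph (Fin n)) : Prop :=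
  Nonempty (G ≃g SimpleGraph.cycleGraph (n / 2) ⊕g SimpleGraph.cycleGraph (n - n / 2))

/-- On `M` machines with `S` words (numbers below `n ^ w`) each there is a `T`-round algorithm
that with probability at least `1 - 1 / n` distinguishes an `n`-vertex cycle (answer `true`) from
two `n / 2`-vertex cycles (answer `false`), the answer being given by a fixed machine `i₀`. -/
def SolvesOneVsTwoCycles (n S M w T : ℕ) : Prop :=
  ∃ (A : Algorithm n S M (n ^ w) T Bool) (i₀ : Fin M),
    ∀ G : SimpleGraph (Fin n), ∀ P : Placement G S M,
      (IsOneCycle G →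
        1 - 1 / (n : ℝ) ≤ A.prob {ω | A.WithinSpace P ω ∧ A.result P ω i₀ = true}) ∧
      (IsTwoCycles G →
        1 - 1 / (n : ℝ) ≤ A.prob {ω | A.WithinSpace P ω ∧ A.result P ω i₀ = false})

end MPC

/-! The cycles themselves have large diameter, so the given algorithm is not run on them. It is used
to compute powers of a function `f` on names of `B` bits. For every argument `e` and every bit
position `β`, follow `e, f e, ..., f^[k] e` through `k + 1` layers, in two copies, and join the two
copies of the end point exactly when bit `β` of its name is set. This is a forest of height at most
`k + 1`, so its components have diameter at most `2 * (k + 1) ≤ D`, and the two starting nodes are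
connected if and only if bit `β` of `f^[k] e` is set (`query_reachable_iff`). One call thus replaces
`f` by `f^[k]`, and `J` calls give `f^[k ^ J]`. With `k = D / 4`, about `log n / log D` calls reach
`n ≤ k ^ J`; this costs `o(log n)` rounds when `T = o(log D)`.

Such a forest has polylogarithmically many nodes for each argument of `f`, so the cycles must first
be shrunk by a polylogarithmic factor. The vertices are cut into blocks of `L = 2 ^ ℓ` on one
machine and every block marks a random member. A window of `L ^ 2` consecutive cycle vertices
contains no mark with probability at most `exp (-(L - 1))` (`expect_ind_avoid_le`), so `2 * ℓ =
O(log log n)` stages of pointer doubling lead from each mark to the next one in both directions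
(`triple_doublingRounds`). Now `f` moves from block to block along the marks and stops at block `0`.
The query nodes of a block are named by the block's own vertices, so its machine produces their
edges and reads the answers locally (`triple_powerRounds`).

On one cycle every block ends at block `0` (`absorb_contract_reaches`); on two cycles the blocks
marked on the other cycle never do (`absorb_contract_mem`). One bit is then collected along a tree
of machines of degree `S`, whose depth is bounded because `S ≥ n ^ ε`. Error bounds are tracked by
`Triple`, a Hoare logic in which failure probabilities add up.

The reduction works for each large `n` separately. If `log D = O(T)` fails, there is a sequence of
`n` along which `T = o(log D)`, and the reduction is applied there. -/

namespace MPC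

/-! ### Expected reward of a sequence of synchronous rounds -/

/-- Memories and inboxes of all machines, with arbitrary memory words `Q` and messages `R`. -/
abbrev Conf (S M : ℕ) (Q R : Type) : Type := Fin M → (Fin S → Q) × Set (Fin M × Fin S × R)

/-- One synchronous round: the local computation of every machine with coins from `Ω`. -/
abbrev Round (S M : ℕ) (Q R Ω : Type) : Type :=
  Fin M → Ω → (Fin S → Q) → Set (Fin M × Fin S × R) →
    (Fin S → Q) × (Fin S → Option (Fin M × R))

section Model

variable {S M : ℕ} {Q R Ω : Type}

/-- The configuration after a round. -/
def advance (r : Round S M Q R Ω) (ω : Fin M → Ω) (c : Conf S M Q R) : Conf S M Q R :=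
  fun i => ((r i (ω i) (c i).1 (c i).2).1,
    {p | (r p.1 (ω p.1) (c p.1).1 (c p.1).2).2 p.2.1 = some (i, p.2.2)})

/-- No machine holds more than `S` received words. -/
def Fits (c : Conf S M Q R) : Prop := ∀ i, (c i).2.ncard ≤ S

open scoped Classical in
/-- Expected value of `g` at the end of a sequence of rounds, a run that violates the space bound
counting as `0`. -/
noncomputable def reward [Fintype Ω] (g : Conf S M Q R → ℝ) :
    List (Round S M Q R Ω) → Conf S M Q R → ℝ
  | [], c => if Fits c then g c else 0
  | r :: p, c => if Fits c then
      (Finset.univ : Finset (Fin M → Ω)).expect (fun ω => reward g p (advance r ω c)) else 0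

variable [Fintype Ω]

lemma reward_not_fits {g : Conf S M Q R → ℝ} (p : List (Round S M Q R Ω)) {c : Conf S M Q R}
    (h : ¬ Fits c) : reward g p c = 0 := by
  cases p <;> simp [reward, h]

/-- Every round tosses fresh coins, so the later rounds depend on the past only through the
configuration: the Markov property, which makes sequential composition possible. -/
lemma reward_append (g : Conf S M Q R → ℝ) (p q : List (Round S M Q R Ω)) (c : Conf S M Q R) :
    reward g (p ++ q) c = reward (reward g q) p c := by
  induction p generalizing c with
  | nil =>
    by_cases h : Fits c
    · simp [reward, h]
    · simp [reward, h, reward_not_fits q h]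
  | cons r p ih =>
    simp only [List.cons_append, reward]
    congr 1
    exact Finset.expect_congr rfl fun ω _ => ih _

lemma reward_mono {g g' : Conf S M Q R → ℝ} (h : ∀ c, Fits c → g c ≤ g' c)
    (p : List (Round S M Q R Ω))
    (c : Conf S M Q R) : reward g p c ≤ reward g' p c := by
  induction p generalizing c with
  | nil =>
    simp only [reward]
    split_ifs with hc
    · exact h c hc
    · exact le_rfl
  | cons r p ih =>
    simp only [reward]
    split_ifs
    · exact Finset.expect_le_expect fun ω _ => ih _
    · exact le_rfl

lemma reward_nonneg {g : Conf S M Q R → ℝ} (h : ∀ c, 0 ≤ g c) (p : List (Round S M Q R Ω))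
    (c : Conf S M Q R) : 0 ≤ reward g p c := by
  induction p generalizing c with
  | nil => simp only [reward]; split_ifs <;> simp [h]
  | cons r p ih =>
    simp only [reward]
    split_ifs
    · exact Finset.expect_nonneg fun ω _ => ih _
    · exact le_rfl

lemma reward_mul_const (a : ℝ) (g : Conf S M Q R → ℝ) (p : List (Round S M Q R Ω))
    (c : Conf S M Q R) : reward (fun c => g c * a) p c = reward g p c * a := by
  induction p generalizing c with
  | nil => simp only [reward]; split_ifs <;> simp
  | cons r p ih =>
    simp only [reward]
    split_ifs
    · rw [Finset.expect_mul]
      exact Finset.expect_congr rfl fun ω _ => ih _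
    · simp

open scoped Classical in
/-- The indicator function of a predicate. -/
noncomputable def ind {α : Type*} (P : α → Prop) : α → ℝ := fun c => if P c then 1 else 0

lemma ind_nonneg {α : Type*} (P : α → Prop) (c : α) : 0 ≤ ind P c := by
  unfold ind; split_ifs <;> norm_num

lemma ind_of {α : Type*} {P : α → Prop} {c : α} (h : P c) : ind P c = 1 := by simp [ind, h]

lemma ind_not {α : Type*} {P : α → Prop} {c : α} (h : ¬ P c) : ind P c = 0 := by simp [ind, h]

/-- From every configuration with `Pre`, with probability at least `1 - e` the rounds `p` keep
within the space bound and end with `Post`. -/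
def Triple (p : List (Round S M Q R Ω)) (Pre Post : Conf S M Q R → Prop) (e : ℝ) : Prop :=
  ∀ c, Pre c → 1 - e ≤ reward (ind Post) p c

lemma Triple.weaken {p : List (Round S M Q R Ω)} {Pre Pre' Post Post' : Conf S M Q R → Prop}
    {e e' : ℝ} (h : Triple p Pre Post e) (h1 : ∀ c, Pre' c → Pre c) (h2 : ∀ c, Post c → Post' c)
    (h3 : e ≤ e') : Triple p Pre' Post' e' := by
  intro c hc
  refine (sub_le_sub_left h3 1).trans ((h c (h1 c hc)).trans (reward_mono (fun c _ => ?_) p c))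
  by_cases hp : Post c
  · rw [ind_of hp, ind_of (h2 c hp)]
  · rw [ind_not hp]; exact ind_nonneg _ _

/-- With probability at least `1 - e₁` the midpoint satisfies `Mid`, and from there the second part
succeeds with probability at least `1 - e₂`; finally `(1 - e₁) * (1 - e₂) ≥ 1 - (e₁ + e₂)`. -/
lemma Triple.append {p q : List (Round S M Q R Ω)} {Pre Mid Post : Conf S M Q R → Prop}
    {e₁ e₂ : ℝ} (h₁ : Triple p Pre Mid e₁) (h₂ : Triple q Mid Post e₂) (he₁ : 0 ≤ e₁)
    (he₂ : 0 ≤ e₂) : Triple (p ++ q) Pre Post (e₁ + e₂) := by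
  intro c hc
  rw [reward_append]
  -- In this case the claimed lower bound is not positive. Otherwise `1 - e₂` is a positive factor
  -- and inequalities may be multiplied by it.
  by_cases h : 1 ≤ e₂
  · exact le_trans (by linarith)
      (reward_nonneg (fun c => reward_nonneg (ind_nonneg _) q c) p c)
  · have hmono : reward (fun c => ind Mid c * (1 - e₂)) p c ≤ reward (reward (ind Post) q) p c := by
      refine reward_mono (fun c _ => ?_) p c
      by_cases hm : Mid c
      · rw [ind_of hm, one_mul]; exact h₂ c hm
      · rw [ind_not hm, zero_mul]; exact reward_nonneg (ind_nonneg _) q c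
    rw [reward_mul_const] at hmono
    have := mul_le_mul_of_nonneg_right (h₁ c hc) (by linarith : (0 : ℝ) ≤ 1 - e₂)
    nlinarith [mul_nonneg he₁ he₂]

lemma Triple.nil {Pre : Conf S M Q R → Prop} (h : ∀ c, Pre c → Fits c) :
    Triple ([] : List (Round S M Q R Ω)) Pre Pre 0 := by
  intro c hc
  simp [reward, h c hc, ind_of hc]

/-- A round whose outcome satisfies `Post` for all coins. -/
lemma Triple.single [Nonempty Ω] {r : Round S M Q R Ω} {Pre Post : Conf S M Q R → Prop}
    (h0 : ∀ c, Pre c → Fits c) (h : ∀ c, Pre c → ∀ ω, Fits (advance r ω c) ∧ Post (advance r ω c)) :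
    Triple [r] Pre Post 0 := by
  intro c hc
  have : ∀ ω, reward (ind Post) ([] : List (Round S M Q R Ω)) (advance r ω c) = 1 := fun ω => by
    simp [reward, (h c hc ω).1, ind_of (h c hc ω).2]
  simp only [reward, h0 c hc, if_true, sub_zero] at this ⊢
  rw [Finset.expect_congr rfl fun ω _ => this ω, Fintype.expect_const]

/-- A round whose outcome satisfies `Post` for a fraction of at least `1 - e` of all coins. -/
lemma Triple.random {r : Round S M Q R Ω} {Pre Post : Conf S M Q R → Prop} {e : ℝ}
    (good : (Fin M → Ω) → Prop)
    (hgood : 1 - e ≤ (Finset.univ : Finset (Fin M → Ω)).expect (ind good))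
    (h0 : ∀ c, Pre c → Fits c)
    (h : ∀ c, Pre c → ∀ ω, good ω → Fits (advance r ω c) ∧ Post (advance r ω c)) :
    Triple [r] Pre Post e := by
  intro c hc
  refine hgood.trans ?_
  have h1 : reward (ind Post) [r] c = Finset.univ.expect
      (fun ω => reward (ind Post) ([] : List (Round S M Q R Ω)) (advance r ω c)) := by
    simp only [reward, h0 c hc, if_true]
  rw [h1]
  refine Finset.expect_le_expect fun ω _ => ?_
  by_cases hg : good ω
  · rw [ind_of hg]
    simp [reward, (h c hc ω hg).1, ind_of (h c hc ω hg).2]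
  · rw [ind_not hg]; exact reward_nonneg (ind_nonneg _) [] _

/-- Transfer of the expected reward along a simulation. -/
lemma reward_simulation {Q' R' Ω' : Type} [Fintype Ω'] (π : Ω' → Ω)
    (hπ : ∀ f : (Fin M → Ω) → ℝ,
      (Finset.univ : Finset (Fin M → Ω')).expect (fun ω => f (π ∘ ω)) = Finset.univ.expect f)
    (emb : Conf S M Q R → Conf S M Q' R') (hfits : ∀ c, Fits (emb c) ↔ Fits c)
    (sim : Round S M Q R Ω → Round S M Q' R' Ω')
    (hsim : ∀ r ω c, advance (sim r) ω (emb c) = emb (advance r (π ∘ ω) c))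
    (g : Conf S M Q' R' → ℝ) (p : List (Round S M Q R Ω)) (c : Conf S M Q R) :
    reward g (p.map sim) (emb c) = reward (fun c => g (emb c)) p c := by
  induction p generalizing c with
  | nil => by_cases h : Fits c <;> simp [reward, h, hfits c]
  | cons r p ih =>
    simp only [List.map_cons, reward]
    by_cases h : Fits c
    · rw [if_pos h, if_pos ((hfits c).2 h), ← hπ]
      exact Finset.expect_congr rfl fun ω _ => by rw [hsim, ih]
    · rw [if_neg h, if_neg (fun h' => h ((hfits c).1 h'))]

/-! ### Runs of an algorithm as expected rewards -/

/-- The configuration after `t` rounds. -/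
def exec {T : ℕ} (p : Fin T → Round S M Q R Ω) (ω : Fin T → Fin M → Ω) (c : Conf S M Q R) :
    ℕ → Conf S M Q R
  | 0 => c
  | t + 1 => if h : t < T then advance (p ⟨t, h⟩) (ω ⟨t, h⟩) (exec p ω c t) else exec p ω c t

omit [Fintype Ω] in
lemma exec_succ {T : ℕ} (p : Fin (T + 1) → Round S M Q R Ω) (ω : Fin (T + 1) → Fin M → Ω)
    (c : Conf S M Q R) (t : ℕ) :
    exec p ω c (t + 1) =
      exec (fun i => p i.succ) (fun i => ω i.succ) (advance (p 0) (ω 0) c) t := by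
  induction t with
  | zero => simp [exec]
  | succ t ih =>
    rw [exec, ih, exec]
    by_cases h : t < T
    · rw [dif_pos h, dif_pos (by omega)]; rfl
    · rw [dif_neg h, dif_neg (by omega)]

/-- Links the expectation over all tosses of a run with the recursion round by round: the coins of
the first round are split off and averaged last. -/
lemma expect_exec {T : ℕ} (p : Fin T → Round S M Q R Ω) (g : Conf S M Q R → ℝ)
    (c : Conf S M Q R) :
    (Finset.univ : Finset (Fin T → Fin M → Ω)).expect
      (fun ω => ind (fun ω => ∀ t ≤ T, Fits (exec p ω c t)) ω * g (exec p ω c T)) =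
      reward g (List.ofFn p) c := by
  induction T generalizing c with
  | zero =>
    by_cases h : Fits c <;> simp [reward, exec, ind, h]
  | succ T ih =>
    rw [List.ofFn_succ, reward]
    by_cases h : Fits c
    · rw [if_pos h]
      simp_rw [← ih]
      rw [Fintype.expect_equiv (Fin.consEquiv (fun _ : Fin (T + 1) => Fin M → Ω)).symm _
        (fun x => ind (fun x : (Fin M → Ω) × (Fin T → Fin M → Ω) => ∀ t ≤ T,
          Fits (exec (fun i => p i.succ) x.2 (advance (p 0) x.1 c) t)) x *
            g (exec (fun i => p i.succ) x.2 (advance (p 0) x.1 c) T))]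
      · rw [← Finset.univ_product_univ, Finset.expect_product]
        rfl
      · intro ω
        rw [exec_succ]
        congr 1
        have : (∀ t ≤ T + 1, Fits (exec p ω c t)) ↔ ∀ t ≤ T,
            Fits (exec (fun i => p i.succ) (fun i => ω i.succ) (advance (p 0) (ω 0) c) t) := by
          constructor
          · intro h' t ht
            rw [← exec_succ]
            exact h' _ (by omega)
          · intro h' t ht
            cases t with
            | zero => exact h
            | succ t => rw [exec_succ]; exact h' _ (by omega)
        by_cases hh : ∀ t ≤ T + 1, Fits (exec p ω c t)
        · rw [ind_of hh]; exact (ind_of (this.1 hh)).symm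
        · rw [ind_not hh]; exact (ind_not (fun h' => hh (this.2 h'))).symm
    · rw [if_neg h]
      refine Finset.expect_eq_zero fun ω _ => ?_
      rw [ind_not (fun h' => h (h' 0 (Nat.zero_le _))), zero_mul]

end Model

namespace Algorithm

variable {n S M W T : ℕ} {Out : Type}

/-- The initial configuration. -/
def start (A : Algorithm n S M W T Out) {G : SimpleGraph (Fin n)} (P : Placement G S M) :
    Conf S M (Fin W) (Fin W) :=
  fun i => (A.load i {v | P.vertexAt v = i} {e | e ∈ G.edgeSet ∧ P.edgeAt e = i}, ∅)

lemma run_eq_exec (A : Algorithm n S M W T Out) {G : SimpleGraph (Fin n)} (P : Placement G S M)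
    (ω : A.Tosses) (t : ℕ) :
    A.run P ω t = exec (fun t => (A.step t : Round S M (Fin W) (Fin W) _)) ω (A.start P) t := by
  induction t with
  | zero => rfl
  | succ t ih =>
    rw [run, exec]
    split_ifs
    · rw [ih]; rfl
    · exact ih

lemma prob_eq_reward (A : Algorithm n S M W T Out) {G : SimpleGraph (Fin n)}
    (P : Placement G S M) (post : Conf S M (Fin W) (Fin W) → Prop) :
    A.prob {ω | A.WithinSpace P ω ∧ post (A.run P ω T)} =
      reward (ind post)
        (List.ofFn fun t => (A.step t : Round S M (Fin W) (Fin W) _)) (A.start P) := by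
  classical
  rw [← expect_exec, prob, Fintype.expect_eq_sum_div_card, Nat.card_eq_fintype_card,
    Set.ncard_eq_toFinset_card', Set.toFinset_card]
  congr 1
  rw [Fintype.card_subtype, Finset.card_filter, Nat.cast_sum]
  refine Finset.sum_congr rfl fun ω _ => ?_
  have h1 : A.WithinSpace P ω ↔ ∀ t ≤ T, Fits (exec (fun t =>
      (A.step t : Round S M (Fin W) (Fin W) _)) ω (A.start P) t) := by
    simp only [← run_eq_exec]; rfl
  rw [← run_eq_exec]
  by_cases h2 : A.WithinSpace P ω
  · rw [ind_of (h1.1 h2)]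
    by_cases h3 : post (A.run P ω T)
    · simp [h2, h3, ind_of h3]
    · simp [h3, ind_not h3]
  · rw [ind_not (fun h => h2 (h1.2 h))]
    simp [h2]

end Algorithm

end MPC

namespace MPC

lemma reward_cons_of_const {S M : ℕ} {Q R Ω : Type} [Fintype Ω] [Nonempty Ω]
    {g : Conf S M Q R → ℝ} {r : Round S M Q R Ω} {c c' : Conf S M Q R}
    (p : List (Round S M Q R Ω)) (h0 : Fits c) (h : ∀ ω, advance r ω c = c') :
    reward g (r :: p) c = reward g p c' := by
  rw [reward, if_pos h0, Finset.expect_congr rfl fun ω _ => by rw [h ω], Fintype.expect_const]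

/-! ### Encoding memories and messages by words -/

section Encode

variable {S M W : ℕ} {Q R Ω : Type}

/-- Encode all memory words and messages of a configuration. -/
def encodeConf (encQ : Q → Fin W) (encR : R → Fin W) (c : Conf S M Q R) :
    Conf S M (Fin W) (Fin W) :=
  fun i => (encQ ∘ (c i).1, (fun p => (p.1, p.2.1, encR p.2.2)) '' (c i).2)

/-- A round on encoded configurations. -/
def encodeRound {Ω' : Type} (encQ : Q → Fin W) (decQ : Fin W → Q) (encR : R → Fin W) (π : Ω' → Ω)
    (r : Round S M Q R Ω) : Round S M (Fin W) (Fin W) Ω' :=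
  fun i ω mem I =>
    (encQ ∘ (r i (π ω) (decQ ∘ mem) {p | (p.1, p.2.1, encR p.2.2) ∈ I}).1,
      fun s => ((r i (π ω) (decQ ∘ mem) {p | (p.1, p.2.1, encR p.2.2) ∈ I}).2 s).map
        fun q => (q.1, encR q.2))

lemma advance_encodeRound {Ω' : Type} {encQ : Q → Fin W} {decQ : Fin W → Q} {encR : R → Fin W}
    (hQ : ∀ q, decQ (encQ q) = q) (hR : Function.Injective encR) (π : Ω' → Ω)
    (r : Round S M Q R Ω) (ω : Fin M → Ω') (c : Conf S M Q R) :
    advance (encodeRound encQ decQ encR π r) ω (encodeConf encQ encR c) =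
      encodeConf encQ encR (advance r (π ∘ ω) c) := by
  have h1 : ∀ i, {p : Fin M × Fin S × R | (p.1, p.2.1, encR p.2.2) ∈
      (encodeConf encQ encR c i).2} = (c i).2 := by
    intro i
    ext ⟨j, s, x⟩
    simp only [encodeConf, Set.mem_ofPred_eq, Set.mem_image, Prod.mk.injEq, Prod.exists]
    constructor
    · rintro ⟨j', s', x', h, rfl, rfl, hx⟩
      rwa [← hR hx]
    · intro h; exact ⟨j, s, x, h, rfl, rfl, rfl⟩
  have h2 : ∀ i, decQ ∘ (encodeConf encQ encR c i).1 = (c i).1 := by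
    intro i; ext s; simp [encodeConf, hQ]
  funext i
  simp only [advance, encodeRound, h1, h2]
  refine Prod.ext rfl ?_
  ext ⟨j, s, x⟩
  simp only [Set.mem_ofPred_eq, encodeConf, Set.mem_image, Prod.exists, Prod.mk.injEq,
    Option.map_eq_some_iff]
  constructor
  · rintro ⟨i', x', h, rfl, rfl⟩
    exact ⟨j, s, x', h, rfl, rfl, rfl⟩
  · rintro ⟨j', s', x', h, rfl, rfl, rfl⟩
    exact ⟨i, x', h, rfl, rfl⟩

lemma fits_encodeConf {encQ : Q → Fin W} {encR : R → Fin W} (hR : Function.Injective encR)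
    (c : Conf S M Q R) : Fits (encodeConf encQ encR c) ↔ Fits c := by
  refine forall_congr' fun i => ?_
  rw [encodeConf, Set.ncard_image_of_injective]
  rintro ⟨j, s, x⟩ ⟨j', s', x'⟩ h
  simp only [Prod.mk.injEq] at h
  obtain ⟨rfl, rfl, h⟩ := h
  rw [hR h]

/-- A sequence of rounds on arbitrary memory words, messages and coins is an algorithm, if words
and coins can be encoded. -/
lemma exists_algorithm {n T a : ℕ} {Out : Type} [Fintype Ω] [Nonempty Q]
    (encQ : Q → Fin W) (hQ : Function.Injective encQ) (encR : R → Fin W)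
    (hR : Function.Injective encR) (e : (Fin a → Bool) ≃ Ω)
    (load : Fin M → Set (Fin n) → Set (Sym2 (Fin n)) → Fin S → Q)
    (p : List (Round S M Q R Ω)) (hp : p.length = T) (out : Fin M → (Fin S → Q) → Out) :
    ∃ A : Algorithm n S M W T Out, ∀ (G : SimpleGraph (Fin n)) (P : Placement G S M) (i : Fin M)
      (good : Out → Prop),
      A.prob {ω | A.WithinSpace P ω ∧ good (A.result P ω i)} =
        reward (ind fun c => good (out i (c i).1)) p
          (fun i => (load i {v | P.vertexAt v = i} {e | e ∈ G.edgeSet ∧ P.edgeAt e = i}, ∅)) := by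
  subst hp
  -- In a run only encoded values are ever decoded, so the values of `Function.invFun` outside the
  -- range of `encQ` are irrelevant.
  have hdec : ∀ q, Function.invFun encQ (encQ q) = q := Function.leftInverse_invFun hQ
  refine ⟨⟨a, fun i Vs Es => encQ ∘ load i Vs Es,
    fun t => encodeRound encQ (Function.invFun encQ) encR e (p.get t),
    fun i mem _ => out i (Function.invFun encQ ∘ mem)⟩, ?_⟩
  intro G P i good
  set A : Algorithm n S M W p.length Out := ⟨a, fun i Vs Es => encQ ∘ load i Vs Es,
    fun t => encodeRound encQ (Function.invFun encQ) encR e (p.get t),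
    fun i mem _ => out i (Function.invFun encQ ∘ mem)⟩
  have h := A.prob_eq_reward P (fun c => good (out i (Function.invFun encQ ∘ (c i).1)))
  refine h.trans ?_
  have h0 : A.start P = encodeConf encQ encR
      (fun i => (load i {v | P.vertexAt v = i} {e | e ∈ G.edgeSet ∧ P.edgeAt e = i}, ∅)) := by
    funext j
    simp [encodeConf, Algorithm.start, A]
  have h1 : (List.ofFn fun t => (A.step t : Round S M (Fin W) (Fin W) _)) =
      p.map (encodeRound encQ (Function.invFun encQ) encR e) := by
    conv_rhs => rw [← List.ofFn_get p, List.map_ofFn]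
    rfl
  rw [h0, h1, reward_simulation (π := e) _ (encodeConf encQ encR) (fits_encodeConf hR) _
    (advance_encodeRound hdec hR e)]
  · congr 1
    funext c
    have : Function.invFun encQ ∘ (encodeConf encQ encR c i).1 = (c i).1 := by
      funext s; simp [encodeConf, hdec]
    rw [ind, ind, this]
  · intro f
    exact Fintype.expect_equiv (Equiv.arrowCongr (Equiv.refl _) e) _ _ (fun ω => rfl)

end Encode

/-! ### Calling an algorithm for labelling components -/

section Oracle

variable {n S M W T : ℕ} {X Y Ω : Type}

/-- The part of the memories outside of the words reserved for a called algorithm is `σ` and the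
inboxes are empty. -/
def Holds (σ : Fin M → Fin S → X) (c : Conf S M (X × Fin W) (Y ⊕ Fin W)) : Prop :=
  ∀ i, (∀ s, ((c i).1 s).1 = σ i s) ∧ (c i).2 = ∅

lemma Holds.fits {σ : Fin M → Fin S → X} {c : Conf S M (X × Fin W) (Y ⊕ Fin W)} (h : Holds σ c) :
    Fits c := fun i => by simp [(h i).2]

/-- A round of purely local computation. -/
def localRound (f : Fin M → Ω → (Fin S → X) → Fin S → X) :
    Round S M (X × Fin W) (Y ⊕ Fin W) Ω :=
  fun i ω mem _ => (fun s => (f i ω (fun s => (mem s).1) s, (mem s).2), fun _ => none)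

lemma Holds.localRound {σ : Fin M → Fin S → X} {c : Conf S M (X × Fin W) (Y ⊕ Fin W)}
    (h : Holds σ c) (f : Fin M → Ω → (Fin S → X) → Fin S → X) (ω : Fin M → Ω) :
    Holds (fun i => f i (ω i) (σ i)) (advance (localRound f) ω c) := by
  intro i
  have : (fun s => ((c i).1 s).1) = σ i := funext (h i).1
  constructor
  · intro s; simp [advance, MPC.localRound, this]
  · simp [advance, MPC.localRound]

lemma triple_localRound [Fintype Ω] [Nonempty Ω] (f : Fin M → (Fin S → X) → Fin S → X)
    (σ : Fin M → Fin S → X) :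
    Triple [(localRound fun i _ => f i : Round S M (X × Fin W) (Y ⊕ Fin W) Ω)] (Holds σ)
      (Holds fun i => f i (σ i)) 0 :=
  Triple.single (fun _ h => h.fits) fun _ h ω =>
    ⟨(h.localRound (fun i _ => f i) ω).fits, h.localRound (fun i _ => f i) ω⟩

/-- The configuration of a called algorithm, placed next to the memory of the caller. -/
def besideConf (σ : Fin M → Fin S → X) (c : Conf S M (Fin W) (Fin W)) :
    Conf S M (X × Fin W) (Y ⊕ Fin W) :=
  fun i => (fun s => (σ i s, (c i).1 s), (fun p => (p.1, p.2.1, Sum.inr p.2.2)) '' (c i).2)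

/-- A round of a called algorithm. -/
def besideRound {Ω₁ Ω₂ : Type} (r : Round S M (Fin W) (Fin W) Ω₁) :
    Round S M (X × Fin W) (Y ⊕ Fin W) (Ω₁ × Ω₂) :=
  fun i ω mem I =>
    (fun s => ((mem s).1,
      (r i ω.1 (fun s => (mem s).2) {p | (p.1, p.2.1, Sum.inr p.2.2) ∈ I}).1 s),
      fun s => ((r i ω.1 (fun s => (mem s).2) {p | (p.1, p.2.1, Sum.inr p.2.2) ∈ I}).2 s).map
        fun q => (q.1, Sum.inr q.2))

lemma inbox_besideConf (σ : Fin M → Fin S → X) (c : Conf S M (Fin W) (Fin W)) (i : Fin M) :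
    {p : Fin M × Fin S × Fin W | (p.1, p.2.1, (Sum.inr p.2.2 : Y ⊕ Fin W)) ∈
      (besideConf σ c i : _ × Set (Fin M × Fin S × (Y ⊕ Fin W))).2} = (c i).2 := by
  ext ⟨j, s, x⟩
  simp [besideConf]

lemma advance_besideRound {Ω₁ Ω₂ : Type} (σ : Fin M → Fin S → X)
    (r : Round S M (Fin W) (Fin W) Ω₁) (ω : Fin M → Ω₁ × Ω₂) (c : Conf S M (Fin W) (Fin W)) :
    advance (besideRound r) ω (besideConf σ c : Conf S M (X × Fin W) (Y ⊕ Fin W)) =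
      besideConf σ (advance r (Prod.fst ∘ ω) c) := by
  funext i
  simp only [advance, besideRound, inbox_besideConf]
  refine Prod.ext rfl ?_
  ext ⟨j, s, x⟩
  simp only [Set.mem_ofPred_eq, besideConf, Set.mem_image, Prod.exists, Prod.mk.injEq,
    Option.map_eq_some_iff]
  constructor
  · rintro ⟨i', x', h, rfl, rfl⟩
    exact ⟨j, s, x', h, rfl, rfl, rfl⟩
  · rintro ⟨j', s', x', h, rfl, rfl, rfl⟩
    exact ⟨i, x', h, rfl, rfl⟩

lemma fits_besideConf (σ : Fin M → Fin S → X) (c : Conf S M (Fin W) (Fin W)) :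
    Fits (besideConf σ c : Conf S M (X × Fin W) (Y ⊕ Fin W)) ↔ Fits c := by
  refine forall_congr' fun i => ?_
  rw [besideConf, Set.ncard_image_of_injective]
  rintro ⟨j, s, x⟩ ⟨j', s', x'⟩ h
  simpa using h

/-- Call the algorithm `A` on the graph whose edges at machine `i` are `Es i` and use the labels
that it outputs to change the memory. -/
def callRounds {Ω₂ : Type} (A : Algorithm n S M W T (Fin n → Fin W)) (Vs : Fin M → Set (Fin n))
    (Es : Fin M → (Fin S → X) → Set (Sym2 (Fin n)))
    (upd : Fin M → (Fin S → X) → (Fin n → Fin W) → Fin S → X) :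
    List (Round S M (X × Fin W) (Y ⊕ Fin W) ((Fin A.coins → Bool) × Ω₂)) :=
  (fun i _ mem _ => (fun s => ((mem s).1, A.load i (Vs i) (Es i fun s => (mem s).1) s),
      fun _ => none)) ::
    ((List.ofFn fun t => (A.step t : Round S M (Fin W) (Fin W) _)).map besideRound ++
      [fun i _ mem I => (fun s => (upd i (fun s => (mem s).1)
        (A.output i (fun s => (mem s).2) {p | (p.1, p.2.1, Sum.inr p.2.2) ∈ I}) s, (mem s).2),
        fun _ => none)])

lemma length_callRounds {Ω₂ : Type} (A : Algorithm n S M W T (Fin n → Fin W))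
    (Vs : Fin M → Set (Fin n)) (Es : Fin M → (Fin S → X) → Set (Sym2 (Fin n)))
    (upd : Fin M → (Fin S → X) → (Fin n → Fin W) → Fin S → X) :
    (callRounds A Vs Es upd :
      List (Round S M (X × Fin W) (Y ⊕ Fin W) ((Fin A.coins → Bool) × Ω₂))).length = T + 2 := by
  simp [callRounds]

/-- Between a round that loads the input of `A` and a round that reads its output, the rounds of `A`
are simulated in the second components of the memory words, with the first components of the coins.
Each machine knows only its own output `L i`; correctness concerns the labels read at the machines
of the vertices. -/
lemma triple_callRounds {Ω₂ : Type} [Fintype Ω₂] [Nonempty Ω₂]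
    (A : Algorithm n S M W T (Fin n → Fin W)) (Vs : Fin M → Set (Fin n))
    (Es : Fin M → (Fin S → X) → Set (Sym2 (Fin n)))
    (upd : Fin M → (Fin S → X) → (Fin n → Fin W) → Fin S → X)
    (σ : Fin M → Fin S → X) (G : SimpleGraph (Fin n)) (P : Placement G S M) (D : ℕ) (e : ℝ)
    (hprob : 1 - e ≤ A.prob {ω | A.WithinSpace P ω ∧
        CorrectComponents G D (fun v => A.result P ω (P.vertexAt v) v)})
    (hV : ∀ i, Vs i = {v | P.vertexAt v = i})
    (hE : ∀ i, Es i (σ i) = {e | e ∈ G.edgeSet ∧ P.edgeAt e = i}) :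
    Triple (callRounds A Vs Es upd :
        List (Round S M (X × Fin W) (Y ⊕ Fin W) ((Fin A.coins → Bool) × Ω₂))) (Holds σ)
      (fun c => ∃ L : Fin M → Fin n → Fin W,
        CorrectComponents G D (fun v => L (P.vertexAt v) v) ∧
          Holds (fun i => upd i (σ i) (L i)) c) e := by
  intro c hc
  have hmem : ∀ i, (fun s => ((c i).1 s).1) = σ i := fun i => funext (hc i).1
  rw [callRounds, reward_cons_of_const (c' := besideConf σ (A.start P)) _ hc.fits, reward_append,
    reward_simulation (π := Prod.fst) _ (besideConf σ) (fits_besideConf σ) _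
      (advance_besideRound σ)]
  · let good : Conf S M (Fin W) (Fin W) → Prop := fun c => CorrectComponents G D
      fun v => A.output (P.vertexAt v) (c (P.vertexAt v)).1 (c (P.vertexAt v)).2 v
    refine hprob.trans (le_of_eq_of_le (A.prob_eq_reward P good) ?_)
    refine reward_mono (fun c' hc' => ?_) _ _
    by_cases hg : good c'
    · rw [ind_of hg]
      refine le_of_eq ?_
      have hH : Holds (fun i => upd i (σ i) (A.output i (c' i).1 (c' i).2))
          (fun i => (fun s => (upd i (σ i) (A.output i (c' i).1 (c' i).2) s, (c' i).1 s), ∅) :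
            Conf S M (X × Fin W) (Y ⊕ Fin W)) := fun i => ⟨fun s => rfl, rfl⟩
      rw [reward_cons_of_const _ ((fits_besideConf σ c').2 hc') (c' := fun i =>
        (fun s => (upd i (σ i) (A.output i (c' i).1 (c' i).2) s, (c' i).1 s), ∅))]
      · rw [reward, if_pos hH.fits, ind_of ⟨fun i => A.output i (c' i).1 (c' i).2, hg, hH⟩]
      · intro ω
        funext i
        simp only [advance, inbox_besideConf]
        refine Prod.ext rfl ?_
        simp
    · rw [ind_not hg]
      exact reward_nonneg (ind_nonneg _) _ _
  -- The share of the coins that `A` uses is uniformly distributed.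
  · intro f
    classical
    rw [Fintype.expect_equiv (Equiv.arrowProdEquivProdArrow (Fin M) (fun _ => Fin A.coins → Bool)
      (fun _ => Ω₂)) (fun ω => f (Prod.fst ∘ ω)) (fun x => f x.1) (fun ω => rfl),
    ← Finset.univ_product_univ, Finset.expect_product]
    simp
  · intro ω
    funext i
    refine Prod.ext ?_ ?_
    · funext s
      simp [advance, besideConf, (hc i).1 s, hmem, Algorithm.start, hV, hE]
    · simp [advance, besideConf, Algorithm.start]

end Oracle

end MPC

namespace MPC

/-! ### Messages between vertices -/

section Buffer

variable {Y : Type}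

/-- The messages in a buffer. -/
def bufSet (p : Option Y × Option Y) : Set Y := {y | p.1 = some y ∨ p.2 = some y}

open scoped Classical in
/-- A buffer with a given set of at most two messages. -/
noncomputable def bufOf (A : Set Y) : Option Y × Option Y :=
  if h : ∃ p, bufSet p = A then h.choose else (none, none)

@[simp] lemma bufSet_none : bufSet ((none, none) : Option Y × Option Y) = ∅ := by
  ext; simp [bufSet]

lemma bufSet_bufOf {A : Set Y} (hA : A.Finite) (h : A.ncard ≤ 2) : bufSet (bufOf A) = A := by
  have : ∃ p, bufSet p = A := by
    have h3 : A.ncard = 0 ∨ A.ncard = 1 ∨ A.ncard = 2 := by omega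
    rcases h3 with h0 | h1 | h2
    · rw [Set.ncard_eq_zero hA] at h0
      exact ⟨(none, none), by simp [h0]⟩
    · obtain ⟨a, rfl⟩ := Set.ncard_eq_one.1 h1
      exact ⟨(some a, none), by ext; simp [bufSet, eq_comm]⟩
    · obtain ⟨a, b, -, rfl⟩ := Set.ncard_eq_two.1 h2
      exact ⟨(some a, some b), by ext; simp [bufSet, eq_comm]⟩
  rw [bufOf, dif_pos this]
  exact this.choose_spec

end Buffer

section Gather

variable {n S M W : ℕ} {Z Y Ω : Type} (addr : Fin n → Fin M × Fin S) (half : Fin n → Bool)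

/-- Every slot sends its message for run `b` to the vertex that it names, if that vertex is in the
half `h` of the vertices. -/
def emitRound (snd : Bool → Fin M → Fin S → Z → Option (Fin n × Y)) (b h : Bool) :
    Round S M ((Z × (Option Y × Option Y)) × Fin W) ((Fin n × Y) ⊕ Fin W) Ω :=
  fun i _ mem _ => (mem, fun s => ((snd b i s (mem s).1.1).filter fun q => half q.1 = h).map
    fun q => ((addr q.1).1, Sum.inl q))

/-- Every vertex adds the messages that it received to its buffer. -/
noncomputable def absorbRound :
    Round S M ((Z × (Option Y × Option Y)) × Fin W) ((Fin n × Y) ⊕ Fin W) Ω :=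
  fun i _ mem I => (fun s => (((mem s).1.1, bufOf (bufSet (mem s).1.2 ∪
    {y | ∃ v j s', (j, s', Sum.inl (v, y)) ∈ I ∧ addr v = (i, s)})), (mem s).2), fun _ => none)

/-- The states of the slots are `σ` and the sets of messages in the buffers are `β`. -/
def HoldsBuf (σ : Fin M → Fin S → Z) (β : Fin M → Fin S → Set Y)
    (c : Conf S M ((Z × (Option Y × Option Y)) × Fin W) ((Fin n × Y) ⊕ Fin W)) : Prop :=
  ∃ buf : Fin M → Fin S → Option Y × Option Y, (∀ i s, bufSet (buf i s) = β i s) ∧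
    Holds (fun i s => (σ i s, buf i s)) c

/-- The states of the slots are `σ` and the buffers are empty. -/
def HoldsState (σ : Fin M → Fin S → Z)
    (c : Conf S M ((Z × (Option Y × Option Y)) × Fin W) ((Fin n × Y) ⊕ Fin W)) : Prop :=
  Holds (fun i s => (σ i s, (none, none))) c

variable {addr half}

/-- A machine may host more than `S / 2` vertices, and two words for each of them would exceed its
space. Only one half of its vertices is therefore served at a time. -/
lemma triple_emit_absorb [Finite Y] [Fintype Ω] [Nonempty Ω]
    (hhalf : ∀ i h, 2 * {v | (addr v).1 = i ∧ half v = h}.ncard ≤ S)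
    (snd : Bool → Fin M → Fin S → Z → Option (Fin n × Y)) (b h : Bool)
    (σ : Fin M → Fin S → Z) (β : Fin M → Fin S → Set Y)
    (hsnd : ∀ v, {p : Fin M × Fin S | ∃ y, snd b p.1 p.2 (σ p.1 p.2) = some (v, y)}.ncard ≤ 2)
    (β' : Fin M → Fin S → Set Y)
    (hβ' : ∀ i s, β' i s = β i s ∪ {y | ∃ v j s', snd b j s' (σ j s') = some (v, y) ∧
      half v = h ∧ addr v = (i, s)})
    (hle : ∀ i s, (β' i s).ncard ≤ 2) :
    Triple ([emitRound addr half snd b h, absorbRound addr] :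
      List (Round S M ((Z × (Option Y × Option Y)) × Fin W) ((Fin n × Y) ⊕ Fin W) Ω))
      (HoldsBuf σ β) (HoldsBuf σ β') 0 := by
  classical
  rintro c ⟨buf, hbuf, hc⟩
  let c₁ : Conf S M ((Z × (Option Y × Option Y)) × Fin W) ((Fin n × Y) ⊕ Fin W) :=
    fun i => ((c i).1, {p | ∃ v y, snd b p.1 p.2.1 (σ p.1 p.2.1) = some (v, y) ∧ half v = h ∧
      (addr v).1 = i ∧ p.2.2 = Sum.inl (v, y)})
  have hσ : ∀ i s, ((c i).1 s).1.1 = σ i s := fun i s => by rw [(hc i).1 s]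
  have hβ : ∀ i s, bufSet ((c i).1 s).1.2 = β i s := fun i s => by rw [(hc i).1 s, hbuf]
  have h1 : ∀ ω : Fin M → Ω, advance (emitRound addr half snd b h) ω c = c₁ := by
    intro ω
    funext i
    refine Prod.ext rfl ?_
    ext ⟨j, s, x⟩
    simp only [advance, emitRound, c₁, hσ, Set.mem_ofPred_eq, Option.map_eq_some_iff,
      Option.filter_eq_some_iff, Prod.exists, Prod.mk.injEq, decide_eq_true_eq]
    constructor
    · rintro ⟨v, y, ⟨h1, h2⟩, h3, rfl⟩
      exact ⟨v, y, h1, h2, h3, rfl⟩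
    · rintro ⟨v, y, h1, h2, h3, rfl⟩
      exact ⟨v, y, ⟨h1, h2⟩, h3, rfl⟩
  have hfit : Fits c₁ := by
    intro i
    refine le_trans ?_ (hhalf i h)
    have hfin : (c₁ i).2.Finite := Set.toFinite _
    rw [Set.ncard_eq_toFinset_card _ hfin, Set.ncard_eq_toFinset_card _ (Set.toFinite _)]
    by_cases hn : Nonempty (Fin n)
    swap
    · have : hfin.toFinset = ∅ := by
        ext p
        simp only [Set.Finite.mem_toFinset, Finset.notMem_empty, iff_false]
        rintro ⟨v, -⟩
        exact hn ⟨v⟩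
      simp [this]
    let f : Fin M × Fin S × ((Fin n × Y) ⊕ Fin W) → Fin n := fun p =>
      p.2.2.elim Prod.fst (fun _ => hn.some)
    refine Finset.card_le_mul_card_image_of_maps_to (f := f) ?_ 2 ?_
    · rintro ⟨j, s, x⟩ hp
      simp only [Set.Finite.mem_toFinset] at hp ⊢
      obtain ⟨v, y, -, h2, h3, h4⟩ := hp
      simp only at h4
      subst h4
      exact ⟨h3, h2⟩
    -- Among the words addressed to `v`, the sender and its slot determine the word, so `hsnd`
    -- bounds their number by two.
    · intro v _
      refine le_trans ?_ (hsnd v)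
      rw [Set.ncard_eq_toFinset_card _ (Set.toFinite _)]
      refine Finset.card_le_card_of_injOn (fun p => (p.1, p.2.1)) ?_ ?_
      · rintro ⟨j, s, x⟩ hp
        simp only [Finset.coe_filter, Set.Finite.mem_toFinset, Set.mem_ofPred_eq] at hp
        obtain ⟨⟨v', y, h1, -, -, h4⟩, h5⟩ := hp
        simp only at h4
        subst h4
        simp only [f, Sum.elim_inl] at h5
        subst h5
        simpa using ⟨y, h1⟩
      · rintro ⟨j, s, x⟩ hp ⟨j', s', x'⟩ hp' heq
        simp only [Finset.coe_filter, Set.Finite.mem_toFinset, Set.mem_ofPred_eq] at hp hp'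
        obtain ⟨⟨v, y, h1, -, -, h4⟩, -⟩ := hp
        obtain ⟨⟨v', y', h1', -, -, h4'⟩, -⟩ := hp'
        simp only [Prod.mk.injEq] at heq h4 h4'
        obtain ⟨rfl, rfl⟩ := heq
        rw [h1] at h1'
        rw [h4, h4', Option.some.inj h1']
  rw [reward_cons_of_const _ hc.fits h1, reward_cons_of_const (c' := fun i =>
    (fun s => ((σ i s, bufOf (β' i s)), ((c i).1 s).2), ∅)) _ hfit]
  · have hH : HoldsBuf σ β' ((fun i =>
      (fun s => ((σ i s, bufOf (β' i s)), ((c i).1 s).2), ∅)) :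
        Conf S M ((Z × (Option Y × Option Y)) × Fin W) ((Fin n × Y) ⊕ Fin W)) :=
      ⟨fun i s => bufOf (β' i s), fun i s => bufSet_bufOf (Set.toFinite _) (hle i s),
        fun i => ⟨fun s => rfl, rfl⟩⟩
    rw [reward, if_pos, ind_of hH]
    · norm_num
    · obtain ⟨_, _, h⟩ := hH; exact h.fits
  · intro ω
    funext i
    refine Prod.ext ?_ ?_
    · funext s
      simp only [advance, absorbRound, c₁, hσ, hβ, hβ']
      congr 4
      ext y
      constructor
      · rintro ⟨v, j, s', ⟨v', y', h1, h2, h3, h4⟩, h5⟩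
        simp only [Sum.inl.injEq, Prod.mk.injEq] at h4
        obtain ⟨rfl, rfl⟩ := h4
        exact ⟨v, j, s', h1, h2, h5⟩
      · rintro ⟨v, j, s', h1, h2, h3⟩
        exact ⟨v, j, s', ⟨v, y, h1, h2, by rw [h3], rfl⟩, h3⟩
    · simp [advance, absorbRound]

variable (addr half)

/-- Every slot sends up to two messages to vertices; every vertex, having received at most two
messages, updates its state. -/
noncomputable def gatherRounds (snd : Bool → Fin M → Fin S → Z → Option (Fin n × Y))
    (proc : Fin M → Fin S → Z → Set Y → Z) :
    List (Round S M ((Z × (Option Y × Option Y)) × Fin W) ((Fin n × Y) ⊕ Fin W) Ω) :=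
  [emitRound addr half snd false false, absorbRound addr] ++
  ([emitRound addr half snd false true, absorbRound addr] ++
  ([emitRound addr half snd true false, absorbRound addr] ++
  ([emitRound addr half snd true true, absorbRound addr] ++
  [localRound fun i _ m s => (proc i s (m s).1 (bufSet (m s).2), (none, none))])))

@[simp] lemma length_gatherRounds (snd : Bool → Fin M → Fin S → Z → Option (Fin n × Y))
    (proc : Fin M → Fin S → Z → Set Y → Z) :
    (gatherRounds addr half snd proc : List (Round S M ((Z × (Option Y × Option Y)) × Fin W)
      ((Fin n × Y) ⊕ Fin W) Ω)).length = 9 := rfl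

variable {addr half}

/-- Two messages per slot and two halves of the receivers give four deliveries. The buffers grow
towards the full set `A i s` of messages; as this set has at most two elements, no buffer overflows
on the way. -/
lemma triple_gatherRounds [Finite Y] [Fintype Ω] [Nonempty Ω] (haddr : Function.Injective addr)
    (hhalf : ∀ i h, 2 * {v | (addr v).1 = i ∧ half v = h}.ncard ≤ S)
    (snd : Bool → Fin M → Fin S → Z → Option (Fin n × Y))
    (proc : Fin M → Fin S → Z → Set Y → Z) (σ : Fin M → Fin S → Z)
    (hsnd : ∀ v, {p : Bool × Fin M × Fin S |
      ∃ y, snd p.1 p.2.1 p.2.2 (σ p.2.1 p.2.2) = some (v, y)}.ncard ≤ 2) :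
    Triple (gatherRounds addr half snd proc :
      List (Round S M ((Z × (Option Y × Option Y)) × Fin W) ((Fin n × Y) ⊕ Fin W) Ω))
      (HoldsState σ) (HoldsState fun i s => proc i s (σ i s)
        {y | ∃ b v j s', snd b j s' (σ j s') = some (v, y) ∧ addr v = (i, s)}) 0 := by
  classical
  let A : Fin M → Fin S → Set Y :=
    fun i s => {y | ∃ b v j s', snd b j s' (σ j s') = some (v, y) ∧ addr v = (i, s)}
  let R : Bool → Bool → Fin M → Fin S → Set Y := fun b h i s =>
    {y | ∃ v j s', snd b j s' (σ j s') = some (v, y) ∧ half v = h ∧ addr v = (i, s)}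
  have hA2 : ∀ i s, (A i s).ncard ≤ 2 := by
    intro i s
    by_cases hv : ∃ v, addr v = (i, s)
    · obtain ⟨v, hv⟩ := hv
      refine le_trans ?_ (hsnd v)
      let g : Bool × Fin M × Fin S → Option Y := fun p =>
        (snd p.1 p.2.1 p.2.2 (σ p.2.1 p.2.2)).map Prod.snd
      have : some '' A i s ⊆ g '' {p : Bool × Fin M × Fin S |
          ∃ y, snd p.1 p.2.1 p.2.2 (σ p.2.1 p.2.2) = some (v, y)} := by
        rintro _ ⟨y, ⟨b, v', j, s', h1, h2⟩, rfl⟩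
        obtain rfl : v' = v := haddr (h2.trans hv.symm)
        exact ⟨(b, j, s'), ⟨y, h1⟩, by simp [g, h1]⟩
      rw [← Set.ncard_image_of_injective (A i s) (Option.some_injective Y)]
      exact (Set.ncard_le_ncard this (Set.toFinite _)).trans (Set.ncard_image_le (Set.toFinite _))
    · have : A i s = ∅ := by
        ext y
        simp only [A, Set.mem_ofPred_eq, Set.mem_empty_iff_false, iff_false]
        rintro ⟨b, v, j, s', -, h⟩
        exact hv ⟨v, h⟩
      simp [this]
  have hsub : ∀ b h i s, R b h i s ⊆ A i s := by
    rintro b h i s y ⟨v, j, s', h1, -, h3⟩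
    exact ⟨b, v, j, s', h1, h3⟩
  have hle : ∀ (B : Set Y) i s, B ⊆ A i s → B.ncard ≤ 2 := fun B i s h =>
    (Set.ncard_le_ncard h (Set.toFinite _)).trans (hA2 i s)
  have hsnd' : ∀ b v, {p : Fin M × Fin S |
      ∃ y, snd b p.1 p.2 (σ p.1 p.2) = some (v, y)}.ncard ≤ 2 := by
    intro b v
    refine le_trans ?_ (hsnd v)
    rw [← Set.ncard_image_of_injective _ (Prod.mk_right_injective b)]
    refine Set.ncard_le_ncard ?_ (Set.toFinite _)
    rintro _ ⟨p, hp, rfl⟩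
    exact hp
  let β₁ : Fin M → Fin S → Set Y := fun i s => R false false i s
  let β₂ : Fin M → Fin S → Set Y := fun i s => β₁ i s ∪ R false true i s
  let β₃ : Fin M → Fin S → Set Y := fun i s => β₂ i s ∪ R true false i s
  let β₄ : Fin M → Fin S → Set Y := fun i s => β₃ i s ∪ R true true i s
  have s1 : ∀ i s, β₁ i s ⊆ A i s := fun i s => hsub _ _ i s
  have s2 : ∀ i s, β₂ i s ⊆ A i s := fun i s => Set.union_subset (s1 i s) (hsub _ _ i s)
  have s3 : ∀ i s, β₃ i s ⊆ A i s := fun i s => Set.union_subset (s2 i s) (hsub _ _ i s)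
  have s4 : ∀ i s, β₄ i s ⊆ A i s := fun i s => Set.union_subset (s3 i s) (hsub _ _ i s)
  have hβ₄ : ∀ i s, β₄ i s = A i s := by
    intro i s
    refine Set.Subset.antisymm (s4 i s) ?_
    rintro y ⟨b, v, j, s', h1, h2⟩
    have hR : y ∈ R b (half v) i s := ⟨v, j, s', h1, rfl, h2⟩
    cases b <;> cases hh : half v <;> rw [hh] at hR
    · exact Or.inl (Or.inl (Or.inl hR))
    · exact Or.inl (Or.inl (Or.inr hR))
    · exact Or.inl (Or.inr hR)
    · exact Or.inr hR
  have t1 := triple_emit_absorb (W := W) (Ω := Ω) hhalf snd false false σ (fun _ _ => ∅)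
    (hsnd' _) β₁ (fun i s => (Set.empty_union _).symm) (fun i s => hle _ i s (s1 i s))
  have t2 := triple_emit_absorb (W := W) (Ω := Ω) hhalf snd false true σ β₁
    (hsnd' _) β₂ (fun i s => rfl) (fun i s => hle _ i s (s2 i s))
  have t3 := triple_emit_absorb (W := W) (Ω := Ω) hhalf snd true false σ β₂
    (hsnd' _) β₃ (fun i s => rfl) (fun i s => hle _ i s (s3 i s))
  have t4 := triple_emit_absorb (W := W) (Ω := Ω) hhalf snd true true σ β₃
    (hsnd' _) β₄ (fun i s => rfl) (fun i s => hle _ i s (s4 i s))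
  have t5 : Triple ([localRound fun i _ m s => (proc i s (m s).1 (bufSet (m s).2), (none, none))] :
      List (Round S M ((Z × (Option Y × Option Y)) × Fin W) ((Fin n × Y) ⊕ Fin W) Ω))
      (HoldsBuf σ β₄) (HoldsState fun i s => proc i s (σ i s) (A i s)) 0 := by
    rintro c ⟨buf, hbuf, hc⟩
    refine (triple_localRound (Ω := Ω) (fun i m s => (proc i s (m s).1 (bufSet (m s).2),
      ((none, none) : Option Y × Option Y))) _).weaken (fun _ h => h) ?_ le_rfl c hc
    intro c' hc'
    simpa only [HoldsState, hbuf, hβ₄] using hc'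
  have := t1.append (t2.append (t3.append (t4.append t5 le_rfl le_rfl) le_rfl (by norm_num))
    le_rfl (by norm_num)) le_rfl (by norm_num)
  refine this.weaken (fun c hc => ⟨fun _ _ => (none, none), fun i s => by simp, hc⟩)
    (fun c hc => hc) (by norm_num)

end Gather

end MPC

namespace MPC

/-! ### Forests given by parent pointers -/

section Forest

variable {V : Type*}

/-- The graph with an edge from every vertex to its parent. -/
def forest (out : V → Option V) : SimpleGraph V := SimpleGraph.fromRel fun x y => out x = some y

/-- The parent, or the vertex itself if it is a root. -/
def parent (out : V → Option V) (x : V) : V := (out x).getD x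

variable {out : V → Option V} {lev : V → ℕ} {R : ℕ}

lemma forest_adj (hlev : ∀ x y, out x = some y → lev x < lev y) {x y : V} :
    (forest out).Adj x y ↔ out x = some y ∨ out y = some x := by
  rw [forest, SimpleGraph.fromRel_adj]
  refine and_iff_right_of_imp ?_
  rintro (h | h) rfl <;> exact lt_irrefl _ (hlev _ _ h)

lemma exists_walk_parent (hlev : ∀ x y, out x = some y → lev x < lev y) (x : V) (t : ℕ) :
    ∃ p : (forest out).Walk x ((parent out)^[t] x), p.length ≤ t := by
  induction t generalizing x with
  | zero => exact ⟨SimpleGraph.Walk.nil, le_rfl⟩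
  | succ t ih =>
    rw [Function.iterate_succ_apply]
    cases h : out x with
    | none =>
      have : parent out x = x := by simp [parent, h]
      rw [this]
      obtain ⟨p, hp⟩ := ih x
      exact ⟨p, by omega⟩
    | some y =>
      have : parent out x = y := by simp [parent, h]
      rw [this]
      obtain ⟨p, hp⟩ := ih y
      exact ⟨SimpleGraph.Walk.cons ((forest_adj hlev).2 (Or.inl h)) p,
        by simpa using hp⟩

/-- Before a root is reached each step raises the level, and levels are at most `R`; hence `R` steps
always end at a root. -/
lemma out_iterate_parent (hlev : ∀ x y, out x = some y → lev x < lev y) (hR : ∀ x, lev x ≤ R)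
    (x : V) : out ((parent out)^[R] x) = none := by
  by_contra hne
  have key : ∀ t ≤ R, out ((parent out)^[t] x) ≠ none := by
    intro t ht h
    apply hne
    obtain ⟨d, rfl⟩ := Nat.exists_eq_add_of_le ht
    have hfix : parent out ((parent out)^[t] x) = (parent out)^[t] x := by simp [parent, h]
    rw [add_comm t d, Function.iterate_add_apply, Function.iterate_fixed hfix, h]
  have grow : ∀ t ≤ R + 1, t ≤ lev ((parent out)^[t] x) := by
    intro t
    induction t with
    | zero => simp
    | succ t ih =>
      intro ht
      obtain ⟨y, hy⟩ := Option.ne_none_iff_exists'.1 (key t (by omega))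
      rw [Function.iterate_succ_apply']
      have h1 : parent out ((parent out)^[t] x) = y := by simp [parent, hy]
      rw [h1]
      have := hlev _ _ hy
      have := ih (by omega)
      omega
  have := grow (R + 1) le_rfl
  have := hR ((parent out)^[R + 1] x)
  omega

lemma iterate_parent_eq_of_adj (hlev : ∀ x y, out x = some y → lev x < lev y)
    (hR : ∀ x, lev x ≤ R) {x y : V} (h : out x = some y) :
    (parent out)^[R] x = (parent out)^[R] y := by
  have h1 : parent out x = y := by simp [parent, h]
  have h2 : parent out ((parent out)^[R] x) = (parent out)^[R] x := by
    simp [parent, out_iterate_parent hlev hR]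
  rw [← h1, ← Function.iterate_succ_apply, Function.iterate_succ_apply', h2]

/-- The `R`-fold parent is the root, and the two ends of an edge have the same root. Components are
thus the fibres of the root map. -/
lemma forest_reachable_iff (hlev : ∀ x y, out x = some y → lev x < lev y) (hR : ∀ x, lev x ≤ R)
    {x y : V} :
    (forest out).Reachable x y ↔ (parent out)^[R] x = (parent out)^[R] y := by
  constructor
  · rintro ⟨p⟩
    induction p with
    | nil => rfl
    | cons h p ih =>
      rw [← ih]
      rcases (forest_adj hlev).1 h with h | h
      · exact iterate_parent_eq_of_adj hlev hR h
      · exact (iterate_parent_eq_of_adj hlev hR h).symm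
  · intro h
    obtain ⟨p, -⟩ := exists_walk_parent hlev x R
    obtain ⟨q, -⟩ := exists_walk_parent hlev y R
    rw [← h] at q
    exact ⟨p.append q.reverse⟩

lemma forest_dist_le (hlev : ∀ x y, out x = some y → lev x < lev y) (hR : ∀ x, lev x ≤ R)
    {x y : V} (h : (forest out).Reachable x y) : (forest out).dist x y ≤ 2 * R := by
  rw [forest_reachable_iff hlev hR] at h
  obtain ⟨p, hp⟩ := exists_walk_parent hlev x R
  obtain ⟨q, hq⟩ := exists_walk_parent hlev y R
  refine (SimpleGraph.dist_le (p.append (q.copy rfl h.symm).reverse)).trans ?_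
  simp only [SimpleGraph.Walk.length_append, SimpleGraph.Walk.length_reverse,
    SimpleGraph.Walk.length_copy]
  omega

lemma forest_componentDiamLE {n : ℕ} {out : Fin n → Option (Fin n)} {lev : Fin n → ℕ} {D : ℕ}
    (hlev : ∀ x y, out x = some y → lev x < lev y) (hR : ∀ x, lev x ≤ R) (hD : 2 * R ≤ D)
    (u : Fin n) : ComponentDiamLE (forest out) D u := fun _ _ hx hy =>
  (forest_dist_le hlev hR (hx.symm.trans hy)).trans hD

lemma mem_forest_edgeSet (hlev : ∀ x y, out x = some y → lev x < lev y) {e : Sym2 V} :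
    e ∈ (forest out).edgeSet ↔ ∃ x y, out x = some y ∧ e = s(x, y) := by
  induction e with
  | h a b =>
    rw [SimpleGraph.mem_edgeSet, forest_adj hlev]
    constructor
    · rintro (h | h)
      · exact ⟨a, b, h, rfl⟩
      · exact ⟨b, a, h, Sym2.eq_swap⟩
    · rintro ⟨x, y, h, he⟩
      rcases Sym2.eq_iff.1 he with ⟨rfl, rfl⟩ | ⟨rfl, rfl⟩
      · exact Or.inl h
      · exact Or.inr h

lemma forest_edgeSet_ncard_le {n : ℕ} {out : Fin n → Option (Fin n)} {lev : Fin n → ℕ}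
    (hlev : ∀ x y, out x = some y → lev x < lev y) : (forest out).edgeSet.ncard ≤ n := by
  have h : (forest out).edgeSet ⊆ (fun x => s(x, parent out x)) '' Set.univ := by
    intro e he
    obtain ⟨x, y, h, rfl⟩ := (mem_forest_edgeSet hlev).1 he
    exact ⟨x, trivial, by simp [parent, h]⟩
  refine (Set.ncard_le_ncard h (Set.toFinite _)).trans
    ((Set.ncard_image_le (Set.toFinite _)).trans ?_)
  simp [Set.ncard_univ]

/-- Every vertex and the edge to its parent can be placed on a given machine. -/
lemma exists_forest_placement {n S M : ℕ} {out : Fin n → Option (Fin n)} {lev : Fin n → ℕ}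
    (hlev : ∀ x y, out x = some y → lev x < lev y) (vm : Fin n → Fin M)
    (hcap : ∀ i, {v | vm v = i}.ncard + {v | vm v = i ∧ out v ≠ none}.ncard ≤ S) :
    ∃ P : Placement (forest out) S M, P.vertexAt = vm ∧
      ∀ i, {e | ∃ x y, vm x = i ∧ out x = some y ∧ e = s(x, y)} =
        {e | e ∈ (forest out).edgeSet ∧ P.edgeAt e = i} := by
  classical
  let at' : Sym2 (Fin n) → Fin M := fun e =>
    if h : ∃ x y, out x = some y ∧ e = s(x, y) then vm h.choose else vm e.out.1
  have hat : ∀ x y, out x = some y → at' s(x, y) = vm x := by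
    intro x y hxy
    have h : ∃ x' y', out x' = some y' ∧ s(x, y) = s(x', y') := ⟨x, y, hxy, rfl⟩
    simp only [at', dif_pos h]
    obtain ⟨y', h1, h2⟩ := h.choose_spec
    -- An edge determines which of its ends is the child: if each end were the parent of the other,
    -- the levels would increase in both directions.
    rcases Sym2.eq_iff.1 h2 with ⟨h3, -⟩ | ⟨h3, h4⟩
    · rw [← h3]
    · rw [← h4, ← h3] at h1
      exact absurd (hlev _ _ h1) (not_lt.2 (hlev _ _ hxy).le)
  have hset : ∀ i, {e | ∃ x y, vm x = i ∧ out x = some y ∧ e = s(x, y)} =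
        {e | e ∈ (forest out).edgeSet ∧ at' e = i} := by
    intro i
    ext e
    simp only [Set.mem_ofPred_eq, mem_forest_edgeSet hlev]
    constructor
    · rintro ⟨x, y, h1, h2, rfl⟩
      exact ⟨⟨x, y, h2, rfl⟩, by rw [hat x y h2, h1]⟩
    · rintro ⟨⟨x, y, h2, rfl⟩, h3⟩
      exact ⟨x, y, by rw [← h3, hat x y h2], h2, rfl⟩
  refine ⟨⟨vm, at', fun i => (Nat.add_le_add_left ?_ _).trans (hcap i)⟩, rfl, hset⟩
  rw [← hset]
  have : {e | ∃ x y, vm x = i ∧ out x = some y ∧ e = s(x, y)} ⊆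
      (fun x => s(x, parent out x)) '' {v | vm v = i ∧ out v ≠ none} := by
    rintro e ⟨x, y, h1, h2, rfl⟩
    exact ⟨x, ⟨h1, by simp [h2]⟩, by simp [parent, h2]⟩
  exact (Set.ncard_le_ncard this (Set.toFinite _)).trans (Set.ncard_image_le (Set.toFinite _))

end Forest

/-! ### Reading off the power of a function from connected components -/

section Power

variable {E : Type*} {k B n : ℕ}

/-- Nodes of the query graph: an argument, a layer, a bit position and one of two copies. -/
abbrev QueryNode (E : Type*) (k B : ℕ) : Type _ := E × Fin (k + 1) × Fin B × Bool

/-- The parent of a node: the value in the next layer; from the last layer of the first copy to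
that of the second copy if the bit is set. -/
def queryNext (f : E → E) (bits : E → Fin B → Bool) (a : QueryNode E k B) :
    Option (QueryNode E k B) :=
  if h : (a.2.1 : ℕ) < k then some (f a.1, ⟨a.2.1 + 1, by omega⟩, a.2.2.1, a.2.2.2)
  else if a.2.2.2 = false ∧ bits a.1 a.2.2.1 = true then some (a.1, a.2.1, a.2.2.1, true) else none

/-- The height of a node. -/
def queryLevel (a : QueryNode E k B) : ℕ := a.2.1 + a.2.2.2.toNat

lemma queryLevel_lt {f : E → E} {bits : E → Fin B → Bool} {a b : QueryNode E k B}
    (h : queryNext f bits a = some b) : queryLevel a < queryLevel b := by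
  obtain ⟨e, i, β, c⟩ := a
  simp only [queryNext] at h
  split_ifs at h with h1 h2
  · obtain rfl := Option.some.inj h
    simp [queryLevel]
  · obtain rfl := Option.some.inj h
    simp [queryLevel, h2.1]

lemma queryLevel_le (a : QueryNode E k B) : queryLevel a ≤ k + 1 := by
  obtain ⟨e, i, β, c⟩ := a
  have := i.2
  have := Bool.toNat_le c
  simp only [queryLevel]
  omega

open scoped Classical in
/-- The parent pointers of the query graph on the vertices `Fin n`. -/
noncomputable def queryOut (nm : QueryNode E k B → Fin n) (f : E → E) (bits : E → Fin B → Bool)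
    (x : Fin n) : Option (Fin n) :=
  if h : ∃ a, nm a = x then (queryNext f bits h.choose).map nm else none

open scoped Classical in
/-- The height of a vertex of the query graph. -/
noncomputable def queryLev (nm : QueryNode E k B → Fin n) (x : Fin n) : ℕ :=
  if h : ∃ a, nm a = x then queryLevel h.choose else 0

variable {nm : QueryNode E k B → Fin n} {f : E → E} {bits : E → Fin B → Bool}

lemma queryOut_nm (hnm : Function.Injective nm) (a : QueryNode E k B) :
    queryOut nm f bits (nm a) = (queryNext f bits a).map nm := by
  have h : ∃ a', nm a' = nm a := ⟨a, rfl⟩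
  rw [queryOut, dif_pos h, hnm h.choose_spec]

lemma queryLev_nm (hnm : Function.Injective nm) (a : QueryNode E k B) :
    queryLev nm (nm a) = queryLevel a := by
  have h : ∃ a', nm a' = nm a := ⟨a, rfl⟩
  rw [queryLev, dif_pos h, hnm h.choose_spec]

lemma exists_of_queryOut {x y : Fin n} (h : queryOut nm f bits x = some y) :
    ∃ a b, nm a = x ∧ nm b = y ∧ queryNext f bits a = some b := by
  rw [queryOut] at h
  split_ifs at h with hx
  obtain ⟨b, hb, rfl⟩ := Option.map_eq_some_iff.1 h
  exact ⟨hx.choose, b, hx.choose_spec, rfl, hb⟩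

lemma queryLev_lt (hnm : Function.Injective nm) (x y : Fin n)
    (h : queryOut nm f bits x = some y) : queryLev nm x < queryLev nm y := by
  obtain ⟨a, b, rfl, rfl, hab⟩ := exists_of_queryOut h
  rw [queryLev_nm hnm, queryLev_nm hnm]
  exact queryLevel_lt hab

lemma queryLev_le (x : Fin n) : queryLev nm x ≤ k + 1 := by
  rw [queryLev]
  split_ifs
  · exact queryLevel_le _
  · omega

lemma parent_queryOut (hnm : Function.Injective nm) (a : QueryNode E k B) :
    parent (queryOut nm f bits) (nm a) = nm ((queryNext f bits a).getD a) := by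
  rw [parent, queryOut_nm hnm]
  cases queryNext f bits a <;> rfl

lemma iterate_parent_queryOut (hnm : Function.Injective nm) (e : E) (β : Fin B) (c : Bool) (t : ℕ)
    (ht : t ≤ k) : (parent (queryOut nm f bits))^[t] (nm (e, 0, β, c)) =
      nm (f^[t] e, ⟨t, by omega⟩, β, c) := by
  induction t with
  | zero => rfl
  | succ t ih =>
    rw [Function.iterate_succ_apply', ih (by omega), parent_queryOut hnm,
      Function.iterate_succ_apply']
    have : t < k := by omega
    simp [queryNext, this]

/-- Both starts run in parallel copies to the node of `f^[k] e` in layer `k`. Its second copy is a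
root, and its first copy is a root unless the bit links it to the second. Paths of other arguments
may merge with these, but only the two roots matter. The height is `k + 1`, the extra step being the
link. -/
lemma query_reachable_iff (hnm : Function.Injective nm) (e : E) (β : Fin B) :
    (forest (queryOut nm f bits)).Reachable (nm (e, 0, β, false)) (nm (e, 0, β, true)) ↔
      bits (f^[k] e) β = true := by
  rw [forest_reachable_iff (queryLev_lt hnm) queryLev_le, Function.iterate_succ_apply',
    Function.iterate_succ_apply', iterate_parent_queryOut hnm _ _ _ _ le_rfl,
    iterate_parent_queryOut hnm _ _ _ _ le_rfl, parent_queryOut hnm, parent_queryOut hnm]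
  by_cases h : bits (f^[k] e) β = true
  · simp [queryNext, h]
  · simp [queryNext, h, hnm.eq_iff]

/-- The value of `f^[k]` is determined by which pairs of nodes are connected. -/
lemma bits_eq_of_correctComponents {L : Type} {D : ℕ} (hnm : Function.Injective nm)
    (hD : 2 * (k + 1) ≤ D) {cc : Fin n → L} [DecidableEq L]
    (h : CorrectComponents (forest (queryOut nm f bits)) D cc) (e : E) (β : Fin B) :
    decide (cc (nm (e, 0, β, false)) = cc (nm (e, 0, β, true))) = bits (f^[k] e) β := by
  have := h (nm (e, 0, β, false)) (nm (e, 0, β, true))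
    (forest_componentDiamLE (queryLev_lt hnm) queryLev_le hD _)
    (forest_componentDiamLE (queryLev_lt hnm) queryLev_le hD _)
  rw [query_reachable_iff hnm] at this
  rw [← Bool.coe_iff_coe, decide_eq_true_eq, this]

end Power

end MPC

namespace MPC

/-! ### Walking along a graph of degree two -/

section Turn

variable {V : Type*} [DecidableEq V] (nbr : V → Bool → V)

/-- Leave the vertex `d.1` through the port `d.2`; the new port is the one that does not lead
back. -/
def turn (d : V × Bool) : V × Bool := (nbr d.1 d.2, !decide (nbr (nbr d.1 d.2) true = d.1))

/-- The two ports of every vertex lead to distinct vertices, and every port has a port back. -/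
structure IsPorts : Prop where
  ne : ∀ v, nbr v false ≠ nbr v true
  back : ∀ v b, ∃ c, nbr (nbr v b) c = v

/-- The same vertex with the other port. -/
def flip (d : V × Bool) : V × Bool := (d.1, !d.2)

variable {nbr}

omit [DecidableEq V] in
lemma flip_flip (d : V × Bool) : flip (flip d) = d := by simp [flip]

omit [DecidableEq V] in
lemma IsPorts.inj (h : IsPorts nbr) {v : V} {b c : Bool} (hbc : nbr v b = nbr v c) : b = c := by
  have := h.ne v
  cases b <;> cases c <;> simp_all

lemma IsPorts.turn_eq (h : IsPorts nbr) {v u : V} {b c : Bool} (h1 : nbr v b = u)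
    (h2 : nbr u c = v) : turn nbr (v, b) = (u, !c) := by
  subst h1
  simp only [turn, Prod.mk.injEq, true_and]
  congr 1
  rw [← Bool.coe_iff_coe, decide_eq_true_eq]
  constructor
  · intro h3; exact (h.inj (h2.trans h3.symm))
  · rintro rfl; exact h2

lemma IsPorts.turn_flip_turn (h : IsPorts nbr) (d : V × Bool) :
    turn nbr (flip (turn nbr d)) = flip d := by
  obtain ⟨v, b⟩ := d
  obtain ⟨c, hc⟩ := h.back v b
  rw [h.turn_eq rfl hc, flip]
  simp only [Bool.not_not]
  rw [h.turn_eq hc rfl]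
  rfl

/-- Walking, turning round and walking equally far leads back. This yields injectivity of the walk,
hence the bound of two on the messages to a vertex, and it lets pointer doubling do without
requests. -/
lemma IsPorts.iterate_turn_flip (h : IsPorts nbr) (m : ℕ) (d : V × Bool) :
    (turn nbr)^[m] (flip ((turn nbr)^[m] d)) = flip d := by
  induction m generalizing d with
  | zero => rfl
  | succ m ih =>
    rw [Function.iterate_succ_apply', Function.iterate_succ_apply, ih, h.turn_flip_turn]

lemma IsPorts.iterate_turn_injective (h : IsPorts nbr) (m : ℕ) :
    Function.Injective (turn nbr)^[m] := by
  intro d d' hdd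
  have h1 := h.iterate_turn_flip m d
  rw [hdd, h.iterate_turn_flip] at h1
  rw [← flip_flip d, ← h1, flip_flip]

variable (nbr) in
/-- The first dart at a marked vertex among the next `N` darts. -/
def firstMark (mark : V → Bool) : ℕ → V × Bool → Option (V × Bool)
  | 0, _ => none
  | N + 1, d => if mark (turn nbr d).1 then some (turn nbr d)
      else firstMark mark N (turn nbr d)

lemma firstMark_add (mark : V → Bool) (a b : ℕ) (d : V × Bool) :
    firstMark nbr mark (a + b) d =
      (firstMark nbr mark a d).or (firstMark nbr mark b ((turn nbr)^[a] d)) := by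
  induction a generalizing d with
  | zero => simp [firstMark]
  | succ a ih =>
    rw [Nat.succ_add, firstMark, firstMark, Function.iterate_succ_apply]
    split_ifs
    · simp
    · exact ih _

lemma firstMark_eq_some {mark : V → Bool} {N : ℕ} {d e : V × Bool}
    (h : firstMark nbr mark N d = some e) : ∃ i, 1 ≤ i ∧ e = (turn nbr)^[i] d ∧ mark e.1 ∧
      ∀ j, 1 ≤ j → j < i → mark ((turn nbr)^[j] d).1 = false := by
  induction N generalizing d with
  | zero => simp [firstMark] at h
  | succ N ih =>
    rw [firstMark] at h
    split_ifs at h with h1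
    · obtain rfl := Option.some.inj h
      exact ⟨1, le_rfl, rfl, h1, fun j hj hj' => by omega⟩
    · obtain ⟨i, hi, h2, h3, h4⟩ := ih h
      refine ⟨i + 1, by omega, h2, h3, fun j hj hj' => ?_⟩
      obtain ⟨j, rfl⟩ := Nat.exists_eq_add_of_le' hj
      cases j with
      | zero => simpa using h1
      | succ j => exact h4 (j + 1) (by omega) (by omega)

lemma firstMark_ne_none {mark : V → Bool} {N : ℕ} {d : V × Bool} {i : ℕ} (hi : 1 ≤ i)
    (hN : i ≤ N) (h : mark ((turn nbr)^[i] d).1) : firstMark nbr mark N d ≠ none := by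
  induction N generalizing d i with
  | zero => omega
  | succ N ih =>
    rw [firstMark]
    split_ifs with h1
    · simp
    · obtain ⟨i, rfl⟩ := Nat.exists_eq_add_of_le' hi
      cases i with
      | zero => exact absurd h h1
      | succ i => exact ih (i := i + 1) (by omega) (by omega) h

end Turn

/-! ### The contracted walk -/

section Contract

variable {V J : Type*} [DecidableEq V] [DecidableEq J] {nbr : V → Bool → V} {mark : V → Bool}
  {rep : J → V} {grp : V → J} {N : ℕ}

variable (nbr mark rep grp N) in
/-- From the element `e.1` through the port `e.2` to the next element. -/
def contract (e : J × Bool) : J × Bool :=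
  ((firstMark nbr mark N (rep e.1, e.2)).map fun d => (grp d.1, d.2)).getD e

/-- Stop a function on darts at the element `j₀`. -/
def absorb (j₀ : J) (f : J × Bool → J × Bool) (e : J × Bool) : J × Bool :=
  if e.1 = j₀ then e else f e

lemma iterate_absorb_of_eq {j₀ : J} (f : J × Bool → J × Bool) {e : J × Bool} (he : e.1 = j₀)
    (r : ℕ) : (absorb j₀ f)^[r] e = e :=
  Function.iterate_fixed (by simp [absorb, he]) r

omit [DecidableEq J] in
-- A contracted step is a nonempty piece of the walk without marks in its interior. The default
-- value in `contract` is excluded by `hgood`.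
lemma exists_contract_eq (hrep : ∀ v, mark v → rep (grp v) = v)
    (hgood : ∀ d, firstMark nbr mark N d ≠ none) (e : J × Bool) :
    ∃ i, 1 ≤ i ∧ (turn nbr)^[i] (rep e.1, e.2) =
        (rep (contract nbr mark rep grp N e).1, (contract nbr mark rep grp N e).2) ∧
      ∀ j, 1 ≤ j → j < i → mark ((turn nbr)^[j] (rep e.1, e.2)).1 = false := by
  obtain ⟨d, hd⟩ := Option.ne_none_iff_exists'.1 (hgood (rep e.1, e.2))
  obtain ⟨i, hi, h1, h2, h3⟩ := firstMark_eq_some hd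
  refine ⟨i, hi, ?_, h3⟩
  rw [← h1, contract, hd]
  simp [hrep d.1 h2]

/-- A contracted step cannot jump over `rep j₀`, which is marked, and it uses up at least one of the
`i` steps of the walk. Further iterations do no harm because `j₀` absorbs, so any exponent `m ≥ i`
works. -/
lemma absorb_contract_reaches (hrep : ∀ v, mark v → rep (grp v) = v)
    (hgood : ∀ d, firstMark nbr mark N d ≠ none) (hgrp : ∀ j, grp (rep j) = j)
    (hmark : ∀ j, mark (rep j)) (j₀ : J) (i : ℕ) (e : J × Bool)
    (hi : ((turn nbr)^[i] (rep e.1, e.2)).1 = rep j₀) {m : ℕ} (hm : i ≤ m) :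
    ((absorb j₀ (contract nbr mark rep grp N))^[m] e).1 = j₀ := by
  induction i using Nat.strong_induction_on generalizing e m with
  | _ i ih =>
    by_cases he : e.1 = j₀
    · rw [iterate_absorb_of_eq _ he, he]
    · obtain ⟨i', h1, h2, h3⟩ := exists_contract_eq hrep hgood e
      have hi0 : i ≠ 0 := by
        rintro rfl
        apply he
        have := congrArg grp hi
        simpa [hgrp] using this
      have hle : i' ≤ i := by
        by_contra hlt
        have := h3 i (by omega) (by omega)
        rw [hi, hmark] at this
        exact absurd this (by simp)
      obtain ⟨m, rfl⟩ := Nat.exists_eq_add_of_le' (show 1 ≤ m by omega)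
      rw [Function.iterate_succ_apply]
      -- The remaining walk has `i - i' < i` steps, and one iteration out of `m + 1` has been spent.
      refine ih (i - i') (by omega) _ ?_ (by omega)
      rw [absorb, if_neg he, ← h2, ← Function.iterate_add_apply]
      rwa [Nat.sub_add_cancel hle]

lemma absorb_contract_mem (hrep : ∀ v, mark v → rep (grp v) = v)
    (hgood : ∀ d, firstMark nbr mark N d ≠ none) {C : Set V}
    (hC : ∀ d : V × Bool, d.1 ∈ C → (turn nbr d).1 ∈ C) (j₀ : J) (e : J × Bool)
    (he : rep e.1 ∈ C) (m : ℕ) :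
    rep ((absorb j₀ (contract nbr mark rep grp N))^[m] e).1 ∈ C := by
  have hC' : ∀ i (d : V × Bool), d.1 ∈ C → ((turn nbr)^[i] d).1 ∈ C := by
    intro i
    induction i with
    | zero => exact fun d hd => hd
    | succ i ih => exact fun d hd => ih _ (hC d hd)
  induction m generalizing e with
  | zero => exact he
  | succ m ih =>
    rw [Function.iterate_succ_apply]
    refine ih _ ?_
    rw [absorb]
    split_ifs
    · exact he
    · obtain ⟨i, -, h, -⟩ := exists_contract_eq hrep hgood e
      have := hC' i (rep e.1, e.2) he
      rwa [h] at this

end Contract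

/-! ### Cycles in a graph -/

section Cycles

variable {V : Type*} {G : SimpleGraph V}

/-- `ι` is a cycle of length `m` that is a connected component of `G`. -/
structure IsCycleComponent (G : SimpleGraph V) (m : ℕ) (ι : ZMod m → V) : Prop where
  inj : Function.Injective ι
  adj : ∀ z x, G.Adj (ι z) x ↔ x = ι (z + 1) ∨ x = ι (z - 1)

lemma two_ne_zero_zmod {m : ℕ} (hm : 3 ≤ m) : (2 : ZMod m) ≠ 0 := by
  intro h
  have : ((2 : ℕ) : ZMod m) = 0 := by exact_mod_cast h
  rw [ZMod.natCast_eq_zero_iff] at this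
  exact absurd (Nat.le_of_dvd (by norm_num) this) (by omega)

lemma IsCycleComponent.ne {m : ℕ} {ι : ZMod m → V} (h : IsCycleComponent G m ι) (hm : 3 ≤ m)
    (z : ZMod m) : ι (z + 1) ≠ ι (z - 1) := by
  intro h'
  have := h.inj h'
  apply two_ne_zero_zmod hm
  linear_combination this

variable [DecidableEq V] {nbr : V → Bool → V}

/-- `nbr` lists the two neighbours of every vertex. -/
structure IsNbr (G : SimpleGraph V) (nbr : V → Bool → V) : Prop where
  ne : ∀ v, nbr v false ≠ nbr v true
  adj : ∀ v x, G.Adj v x ↔ ∃ b, nbr v b = x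

omit [DecidableEq V] in
lemma IsNbr.isPorts (h : IsNbr G nbr) : IsPorts nbr :=
  ⟨h.ne, fun v b => (h.adj _ _).1 ((h.adj v _).2 ⟨b, rfl⟩).symm⟩

/-- A walk that never turns back keeps its direction `s` on a cycle. The induction carries two
consecutive positions, since the next one is the neighbour different from the last but one. -/
lemma IsCycleComponent.iterate_turn {m : ℕ} {ι : ZMod m → V} (h : IsCycleComponent G m ι)
    (hnbr : IsNbr G nbr) (z : ZMod m) (b : Bool) :
    ∃ s : ZMod m, (s = 1 ∨ s = -1) ∧ ∀ i : ℕ, ((turn nbr)^[i] (ι z, b)).1 = ι (z + i * s) := by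
  have hp := hnbr.isPorts
  have step : ∀ d : V × Bool, G.Adj d.1 (turn nbr d).1 := fun d => (hnbr.adj _ _).2 ⟨d.2, rfl⟩
  have nonback : ∀ d : V × Bool, (turn nbr (turn nbr d)).1 ≠ d.1 := by
    rintro ⟨v, b⟩ heq
    obtain ⟨c, hc⟩ := hp.back v b
    rw [hp.turn_eq rfl hc] at heq
    have := hp.inj (heq.trans hc.symm)
    simp at this
  have h0 := (h.adj z _).1 (step (ι z, b))
  obtain ⟨s, hs, h1⟩ : ∃ s : ZMod m, (s = 1 ∨ s = -1) ∧ (turn nbr (ι z, b)).1 = ι (z + s) := by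
    rcases h0 with h0 | h0
    · exact ⟨1, Or.inl rfl, h0⟩
    · exact ⟨-1, Or.inr rfl, by rw [h0, sub_eq_add_neg]⟩
  refine ⟨s, hs, fun i => ?_⟩
  suffices ((turn nbr)^[i] (ι z, b)).1 = ι (z + i * s) ∧
      ((turn nbr)^[i + 1] (ι z, b)).1 = ι (z + (i + 1 : ℕ) * s) from this.1
  induction i with
  | zero => exact ⟨by simp, by simpa using h1⟩
  | succ i ih =>
    refine ⟨ih.2, ?_⟩
    have h2 := step ((turn nbr)^[i + 1] (ι z, b))
    rw [ih.2, h.adj] at h2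
    have h3 := nonback ((turn nbr)^[i] (ι z, b))
    rw [← Function.iterate_succ_apply' (turn nbr), ← Function.iterate_succ_apply' (turn nbr),
      ih.1] at h3
    rw [← Function.iterate_succ_apply' (turn nbr)] at h2
    rcases h2 with h2 | h2 <;> rcases hs with rfl | rfl
    · rw [h2]; congr 1; push_cast; ring
    -- The neighbour against the direction `s` is the vertex just left.
    · refine absurd ?_ h3; rw [h2]; congr 1; push_cast; ring
    · refine absurd ?_ h3; rw [h2]; congr 1; push_cast; ring
    · rw [h2]; congr 1; push_cast; ring

lemma IsCycleComponent.turn_mem {m : ℕ} {ι : ZMod m → V} (h : IsCycleComponent G m ι)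
    (hnbr : IsNbr G nbr) {d : V × Bool} (hd : d.1 ∈ Set.range ι) :
    (turn nbr d).1 ∈ Set.range ι := by
  obtain ⟨v, b⟩ := d
  obtain ⟨z, rfl⟩ := hd
  obtain ⟨s, -, hs⟩ := h.iterate_turn hnbr z b
  exact ⟨_, (hs 1).symm⟩

lemma IsCycleComponent.injOn_iterate_turn {m : ℕ} {ι : ZMod m → V}
    (h : IsCycleComponent G m ι) (hnbr : IsNbr G nbr) {d : V × Bool} (hd : d.1 ∈ Set.range ι) :
    Set.InjOn (fun i => ((turn nbr)^[i] d).1) (Set.Icc 1 m) := by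
  obtain ⟨v, b⟩ := d
  obtain ⟨z, rfl⟩ := hd
  obtain ⟨s, hs, hs'⟩ := h.iterate_turn hnbr z b
  intro i hi j hj hij
  simp only [hs'] at hij
  have h1 := h.inj hij
  have h2 : ((i : ℕ) : ZMod m) = j := by
    rcases hs with rfl | rfl <;> linear_combination (norm := ring_nf) h1
    -- For `s = -1` the equation is `h1` with the opposite sign; one copy of `h1` has been
    -- subtracted already, and `1 - 2 = -1`.
    · linear_combination (-2 : ZMod m) * h1
  rw [ZMod.natCast_eq_natCast_iff'] at h2
  obtain ⟨hi1, hi2⟩ := hi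
  obtain ⟨hj1, hj2⟩ := hj
  -- On the interval from `1` to `m` only `m` itself has residue `0`.
  rcases hi2.lt_or_eq with hi2 | rfl <;> rcases hj2.lt_or_eq with hj2 | rfl
  · rwa [Nat.mod_eq_of_lt hi2, Nat.mod_eq_of_lt hj2] at h2
  · rw [Nat.mod_eq_of_lt hi2, Nat.mod_self] at h2; omega
  · rw [Nat.mod_eq_of_lt hj2, Nat.mod_self] at h2; omega
  · rfl

lemma IsCycleComponent.exists_iterate_turn_eq {m : ℕ} [NeZero m] {ι : ZMod m → V}
    (h : IsCycleComponent G m ι) (hnbr : IsNbr G nbr) {d : V × Bool} (hd : d.1 ∈ Set.range ι)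
    {x : V} (hx : x ∈ Set.range ι) : ∃ i ≤ m, ((turn nbr)^[i] d).1 = x := by
  obtain ⟨v, b⟩ := d
  obtain ⟨z, rfl⟩ := hd
  obtain ⟨z', rfl⟩ := hx
  obtain ⟨s, hs, hs'⟩ := h.iterate_turn hnbr z b
  -- The number of steps is the offset from `z` to `z'` in the direction `s`; it is correct because
  -- `s * s = 1`.
  refine ⟨((z' - z) * s).val, (ZMod.val_lt _).le, ?_⟩
  rw [hs', ZMod.natCast_zmod_val]
  congr 1
  rcases hs with rfl | rfl <;> ring

end Cycles

/-! ### The cycles of the two kinds of input. -/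

section CycleGraph

variable {n : ℕ} {G : SimpleGraph (Fin n)}

lemma isCycleComponent_of_embedding {V : Type*} {G : SimpleGraph V} {m : ℕ} (hm : 3 ≤ m)
    (ι : Fin m → V) (hι : Function.Injective ι)
    (hadj : ∀ z z', G.Adj (ι z) (ι z') ↔ (SimpleGraph.cycleGraph m).Adj z z')
    (hcl : ∀ z x, G.Adj (ι z) x → x ∈ Set.range ι) :
    ∃ ι' : ZMod m → V, Set.range ι' = Set.range ι ∧ IsCycleComponent G m ι' := by
  obtain ⟨m, rfl⟩ := Nat.exists_eq_add_of_le' (show 2 ≤ m by omega)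
  -- `ZMod (m + 2)` is `Fin (m + 2)` by definition, so `ι` itself serves.
  refine ⟨(ι : Fin (m + 2) → V), rfl, hι, fun z x => ?_⟩
  have key : ∀ z z' : Fin (m + 2), G.Adj (ι z) (ι z') ↔ z' = z + 1 ∨ z' = z - 1 := by
    intro z z'
    rw [hadj, SimpleGraph.cycleGraph_adj, or_comm]
    refine or_congr ?_ ?_
    · constructor
      · intro h; rw [← h]; abel
      · intro h; rw [h]; abel
    · constructor
      · intro h; rw [← h]; abel
      · intro h; rw [h]; abel
  constructor
  · intro h
    obtain ⟨z', rfl⟩ := hcl z x h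
    rcases (key z z').1 h with h | h
    · exact Or.inl (congrArg ι h)
    · exact Or.inr (congrArg ι h)
  · rintro (rfl | rfl)
    · exact (key z _).2 (Or.inl rfl)
    · exact (key z _).2 (Or.inr rfl)

lemma IsOneCycle.exists_cycle (h : IsOneCycle G) (hn : 3 ≤ n) :
    ∃ ι : ZMod n → Fin n, IsCycleComponent G n ι ∧ ∀ v, v ∈ Set.range ι := by
  obtain ⟨ψ⟩ := h
  obtain ⟨ι, h1, h2⟩ := isCycleComponent_of_embedding hn ψ.symm ψ.symm.injective
    (fun z z' => ψ.symm.map_adj_iff) (fun z x _ => ψ.symm.surjective x)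
  exact ⟨ι, h2, fun v => by rw [h1]; exact ψ.symm.surjective v⟩

lemma IsTwoCycles.exists_cycles (h : IsTwoCycles G) (hn : 6 ≤ n) :
    ∃ (ι₁ : ZMod (n / 2) → Fin n) (ι₂ : ZMod (n - n / 2) → Fin n),
      IsCycleComponent G (n / 2) ι₁ ∧ IsCycleComponent G (n - n / 2) ι₂ ∧
      (∀ v, v ∈ Set.range ι₁ ∨ v ∈ Set.range ι₂) ∧ Disjoint (Set.range ι₁) (Set.range ι₂) := by
  obtain ⟨ψ⟩ := h
  obtain ⟨ι₁, h1, h2⟩ := isCycleComponent_of_embedding (G := G) (m := n / 2) (by omega)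
    (fun z => ψ.symm (Sum.inl z)) (fun z z' h => Sum.inl_injective (ψ.symm.injective h))
    (fun z z' => by rw [ψ.symm.map_adj_iff]; simp) (by
      intro z x hx
      obtain ⟨y, rfl⟩ := ψ.symm.surjective x
      rw [ψ.symm.map_adj_iff] at hx
      cases y with
      | inl y => exact ⟨y, rfl⟩
      | inr y => simp at hx)
  obtain ⟨ι₂, h3, h4⟩ := isCycleComponent_of_embedding (G := G) (m := n - n / 2) (by omega)
    (fun z => ψ.symm (Sum.inr z)) (fun z z' h => Sum.inr_injective (ψ.symm.injective h))
    (fun z z' => by rw [ψ.symm.map_adj_iff]; simp) (by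
      intro z x hx
      obtain ⟨y, rfl⟩ := ψ.symm.surjective x
      rw [ψ.symm.map_adj_iff] at hx
      cases y with
      | inr y => exact ⟨y, rfl⟩
      | inl y => simp at hx)
  refine ⟨ι₁, ι₂, h2, h4, fun v => ?_, ?_⟩
  · rw [h1, h3]
    obtain ⟨y, rfl⟩ := ψ.symm.surjective v
    cases y with
    | inl y => exact Or.inl ⟨y, rfl⟩
    | inr y => exact Or.inr ⟨y, rfl⟩
  · rw [h1, h3, Set.disjoint_left]
    rintro _ ⟨y, rfl⟩ ⟨y', h⟩
    have := ψ.symm.injective h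
    simp at this

end CycleGraph

end MPC

namespace MPC

/-! ### Random representatives of groups hit every window -/

section Hitting

lemma expect_ind_not {α : Type*} [Fintype α] [Nonempty α] (P : α → Prop) :
    (Finset.univ : Finset α).expect (ind P) = 1 - Finset.univ.expect (ind fun a => ¬ P a) := by
  rw [eq_sub_iff_add_eq, ← Finset.expect_add_distrib]
  rw [Finset.expect_congr rfl (g := fun _ => (1 : ℝ)), Fintype.expect_const]
  intro a _
  by_cases h : P a
  · simp [ind, h]
  · simp [ind, h]

lemma sum_ind {α : Type*} [Fintype α] (P : α → Prop) [DecidablePred P] :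
    ∑ a, ind P a = ((Finset.univ.filter P).card : ℝ) := by
  rw [Finset.card_filter, Nat.cast_sum]
  refine Finset.sum_congr rfl fun a _ => ?_
  by_cases h : P a <;> simp [ind, h]

lemma expect_comp_snd {α β γ : Type*} [Fintype α] [Fintype β] [Fintype γ] [Nonempty β]
    (e : α ≃ β × γ) (f : γ → ℝ) :
    (Finset.univ : Finset α).expect (fun a => f (e a).2) = Finset.univ.expect f := by
  rw [Fintype.expect_equiv e (fun a => f (e a).2) (fun x => f x.2) (fun _ => rfl),
    ← Finset.univ_product_univ, Finset.expect_product]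
  exact Fintype.expect_const (ι := β) (Finset.univ.expect f)

/-- The coordinates of `ω` are independent. Coordinate `p` avoids its forbidden set `F p` with
probability `1 - (F p).card / L`, at most `exp (-((F p).card / L))`, and the exponents add up to the
size of `A`. -/
lemma expect_ind_avoid_le {I : Type*} [Fintype I] [DecidableEq I] {L : ℕ} (hL : 0 < L)
    (A : Finset (I × Fin L)) :
    (Finset.univ : Finset (I → Fin L)).expect (ind fun ω => ∀ a ∈ A, ω a.1 ≠ a.2) ≤
      Real.exp (-(A.card / L : ℝ)) := by
  classical
  let F : I → Finset (Fin L) := fun p => Finset.univ.filter fun r => (p, r) ∈ A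
  have hcard : A.card = ∑ p, (F p).card := by
    rw [Finset.card_eq_sum_card_fiberwise (f := Prod.fst) (t := Finset.univ) (by simp)]
    refine Finset.sum_congr rfl fun p _ => ?_
    refine Finset.card_bij' (fun a _ => a.2) (fun r _ => (p, r)) ?_ ?_ ?_ ?_
    · rintro ⟨p', r⟩ h
      simp only [Finset.mem_filter] at h
      obtain ⟨h, rfl⟩ := h
      simpa [F] using h
    · intro r h
      simpa [F] using h
    · rintro ⟨p', r⟩ h
      simp only [Finset.mem_filter] at h
      simp [h.2]
    · intro r h
      rfl
  have hset : (Finset.univ.filter fun ω : I → Fin L => ∀ a ∈ A, ω a.1 ≠ a.2) =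
      Fintype.piFinset fun p => (F p)ᶜ := by
    ext ω
    simp only [Finset.mem_filter, Finset.mem_univ, true_and, Fintype.mem_piFinset,
      Finset.mem_compl, F]
    constructor
    · intro h p hp; exact h _ hp rfl
    · rintro h ⟨p, r⟩ ha hr
      simp only at hr
      exact h p (hr ▸ ha)
  have hL' : (0 : ℝ) < L := by exact_mod_cast hL
  rw [Fintype.expect_eq_sum_div_card]
  have : ∑ ω : I → Fin L, ind (fun ω : I → Fin L => ∀ a ∈ A, ω a.1 ≠ a.2) ω =
      ∏ p, ((L : ℝ) - (F p).card) := by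
    rw [sum_ind]
    have h1 : (Finset.univ.filter fun ω : I → Fin L => ∀ a ∈ A, ω a.1 ≠ a.2).card =
        ∏ p, (L - (F p).card) := by
      rw [hset, Fintype.card_piFinset]
      refine Finset.prod_congr rfl fun p _ => ?_
      rw [Finset.card_compl, Fintype.card_fin]
    have h2 : ((∏ p, (L - (F p).card) : ℕ) : ℝ) = ∏ p, ((L : ℝ) - (F p).card) := by
      rw [Nat.cast_prod]
      refine Finset.prod_congr rfl fun p _ => ?_
      rw [Nat.cast_sub]
      simpa using Finset.card_le_univ (F p)
    rw [← h2, ← h1]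
  rw [this, Fintype.card_fun, Fintype.card_fin, Nat.cast_pow, ← Finset.card_univ,
    ← Finset.prod_const, ← Finset.prod_div_distrib, hcard, Nat.cast_sum, Finset.sum_div,
    ← Finset.sum_neg_distrib, Real.exp_sum]
  refine Finset.prod_le_prod (fun p _ => ?_) fun p _ => ?_
  · refine div_nonneg ?_ hL'.le
    rw [sub_nonneg]
    exact_mod_cast (by simpa using Finset.card_le_univ (F p))
  · rw [sub_div, div_self hL'.ne']
    exact Real.one_sub_le_exp_neg _

lemma expect_fst_snd {M K L : ℕ} {Ω₁ : Type} [Fintype Ω₁] [Nonempty Ω₁]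
    (f : (Fin M × Fin K → Fin L) → ℝ) :
    (Finset.univ : Finset (Fin M → Ω₁ × (Fin K → Fin L))).expect
      (fun ω => f fun p => (ω p.1).2 p.2) = Finset.univ.expect f := by
  classical
  refine (expect_comp_snd (Equiv.arrowProdEquivProdArrow (Fin M) (fun _ => Ω₁)
      (fun _ => Fin K → Fin L)) (fun x => f fun p => x p.1 p.2)).trans ?_
  exact Fintype.expect_equiv (Equiv.curry (Fin M) (Fin K) (Fin L)).symm _ _ fun ω => rfl

/-- A union bound for missing some window. -/
lemma expect_ind_hit_ge {n M K L : ℕ} {Ω₁ I : Type} [Fintype Ω₁] [Nonempty Ω₁] [Fintype I]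
    (hL : 0 < L) (pos : Fin n → (Fin M × Fin K) × Fin L) (hpos : Function.Injective pos)
    (win : I → Finset (Fin n)) (a : ℝ) (ha : ∀ i, a ≤ (win i).card) :
    1 - Fintype.card I * Real.exp (-(a / L)) ≤
      (Finset.univ : Finset (Fin M → Ω₁ × (Fin K → Fin L))).expect
        (ind fun ω => ∀ i, ∃ v ∈ win i, (ω (pos v).1.1).2 (pos v).1.2 = (pos v).2) := by
  classical
  have : Nonempty (Fin L) := ⟨⟨0, hL⟩⟩
  have h1 := expect_fst_snd (Ω₁ := Ω₁) (ind fun ω : Fin M × Fin K → Fin L =>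
    ∀ i, ∃ v ∈ win i, ω (pos v).1 = (pos v).2)
  refine le_of_le_of_eq ?_ h1.symm
  let hit : (Fin M × Fin K → Fin L) → Prop := fun ω => ∀ i, ∃ v ∈ win i, ω (pos v).1 = (pos v).2
  change _ ≤ Finset.univ.expect (ind hit)
  rw [expect_ind_not, sub_le_sub_iff_left]
  calc _ ≤ (Finset.univ : Finset (Fin M × Fin K → Fin L)).expect (fun ω => ∑ i : I,
        ind (fun ω => ∀ b ∈ (win i).image pos, ω b.1 ≠ b.2) ω) := by
        refine Finset.expect_le_expect fun ω _ => ?_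
        by_cases h : hit ω
        · rw [ind_not (P := fun ω => ¬ hit ω) (not_not.2 h)]
          exact Finset.sum_nonneg fun i _ => ind_nonneg _ _
        · rw [ind_of (P := fun ω => ¬ hit ω) h]
          simp only [hit] at h
          push Not at h
          obtain ⟨i, hi⟩ := h
          refine le_of_eq_of_le ?_ (Finset.single_le_sum (f := fun i => ind (fun ω :
            Fin M × Fin K → Fin L => ∀ b ∈ (win i).image pos, ω b.1 ≠ b.2) ω)
            (fun i _ => ind_nonneg _ _) (Finset.mem_univ i))
          rw [ind_of]
          intro b hb
          obtain ⟨v, hv, rfl⟩ := Finset.mem_image.1 hb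
          exact hi v hv
    _ ≤ ∑ i : I, Real.exp (-(a / L)) := by
        rw [Finset.expect_sum_comm]
        refine Finset.sum_le_sum fun i _ => (expect_ind_avoid_le hL _).trans ?_
        rw [Finset.card_image_of_injective _ hpos]
        have := ha i
        gcongr
    _ = _ := by simp

end Hitting

end MPC

namespace MPC

/-! ### Vertices as processors -/

section Vertices

variable {n S M W T : ℕ} {Z Y Ω : Type} (addr : Fin n → Fin M × Fin S) (half : Fin n → Bool)

open scoped Classical in
/-- The vertex whose state is kept in a slot. -/
noncomputable def own (i : Fin M) (s : Fin S) : Option (Fin n) :=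
  if h : ∃ v, addr v = (i, s) then some h.choose else none

variable {addr} in
lemma own_addr (haddr : Function.Injective addr) (v : Fin n) :
    own addr (addr v).1 (addr v).2 = some v := by
  have h : ∃ u, addr u = ((addr v).1, (addr v).2) := ⟨v, rfl⟩
  rw [own, dif_pos h, haddr h.choose_spec]

variable {addr} in
lemma addr_of_own {i : Fin M} {s : Fin S} {v : Fin n} (h : own addr i s = some v) :
    addr v = (i, s) := by
  rw [own] at h
  split_ifs at h with h'
  rw [← Option.some.inj h]
  exact h'.choose_spec

/-- The states of the vertices are `x`. -/
def HoldsVertex (x : Fin n → Z)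
    (c : Conf S M ((Z × (Option Y × Option Y)) × Fin W) ((Fin n × Y) ⊕ Fin W)) : Prop :=
  ∃ σ : Fin M → Fin S → Z, HoldsState σ c ∧ ∀ v, σ (addr v).1 (addr v).2 = x v

/-- Every vertex sends two messages and processes the messages that it receives. -/
noncomputable def vertexGather (snd : Bool → Fin n → Z → Option (Fin n × Y))
    (proc : Fin n → Z → Set Y → Z) :
    List (Round S M ((Z × (Option Y × Option Y)) × Fin W) ((Fin n × Y) ⊕ Fin W) Ω) :=
  gatherRounds addr half (fun b i s z => (own addr i s).bind fun v => snd b v z)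
    (fun i s z A => (own addr i s).elim z fun v => proc v z A)

/-- What a machine knows of the states of all vertices. -/
def view [Inhabited Z] (i : Fin M) (m : Fin S → Z) (u : Fin n) : Z :=
  if (addr u).1 = i then m (addr u).2 else default

/-- A local computation of the new states of the vertices of every machine. -/
noncomputable def vertexLocal [Inhabited Z] (f : Fin n → Ω → (Fin n → Z) → Z) :
    Round S M ((Z × (Option Y × Option Y)) × Fin W) ((Fin n × Y) ⊕ Fin W) Ω :=
  localRound fun i ω m s => ((own addr i s).elim (m s).1 fun v =>
    f v ω (view addr i fun s => (m s).1), (none, none))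

/-- Call an algorithm and compute new states of the vertices from the labels. -/
noncomputable def vertexCall [Inhabited Z] {Ω₂ : Type} (A : Algorithm n S M W T (Fin n → Fin W))
    (Es : Fin M → (Fin n → Z) → Set (Sym2 (Fin n)))
    (f : Fin n → (Fin n → Fin W) → (Fin n → Z) → Z) :
    List (Round S M ((Z × (Option Y × Option Y)) × Fin W) ((Fin n × Y) ⊕ Fin W)
      ((Fin A.coins → Bool) × Ω₂)) :=
  callRounds A (fun i => {v | (addr v).1 = i}) (fun i m => Es i (view addr i fun s => (m s).1))
    (fun i m l s => ((own addr i s).elim (m s).1 fun v =>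
      f v l (view addr i fun s => (m s).1), (none, none)))

variable {addr half}

lemma HoldsVertex.fits {x : Fin n → Z}
    {c : Conf S M ((Z × (Option Y × Option Y)) × Fin W) ((Fin n × Y) ⊕ Fin W)}
    (h : HoldsVertex addr x c) : Fits c := by
  obtain ⟨σ, h, -⟩ := h
  exact Holds.fits h

lemma triple_vertexGather [Finite Y] [Fintype Ω] [Nonempty Ω] (haddr : Function.Injective addr)
    (hhalf : ∀ i h, 2 * {v | (addr v).1 = i ∧ half v = h}.ncard ≤ S)
    (snd : Bool → Fin n → Z → Option (Fin n × Y)) (proc : Fin n → Z → Set Y → Z) (x : Fin n → Z)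
    (hsnd : ∀ v, {p : Bool × Fin n | ∃ y, snd p.1 p.2 (x p.2) = some (v, y)}.ncard ≤ 2) :
    Triple (vertexGather addr half snd proc :
      List (Round S M ((Z × (Option Y × Option Y)) × Fin W) ((Fin n × Y) ⊕ Fin W) Ω))
      (HoldsVertex addr x) (HoldsVertex addr fun v => proc v (x v)
        {y | ∃ b u, snd b u (x u) = some (v, y)}) 0 := by
  rintro c ⟨σ, hc, hσ⟩
  have hiff : ∀ b i s v y, ((own addr i s).bind fun u => snd b u (σ i s)) = some (v, y) ↔
      ∃ u, addr u = (i, s) ∧ snd b u (x u) = some (v, y) := by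
    intro b i s v y
    rw [Option.bind_eq_some_iff]
    constructor
    · rintro ⟨u, h1, h2⟩
      have := addr_of_own h1
      refine ⟨u, this, ?_⟩
      rw [← hσ, this]; exact h2
    · rintro ⟨u, h1, h2⟩
      have := own_addr haddr u
      rw [← hσ] at h2
      rw [h1] at this h2
      exact ⟨u, this, h2⟩
  refine (triple_gatherRounds haddr hhalf _ _ σ ?_).weaken (fun _ h => h) ?_ le_rfl c hc
  · intro v
    refine le_trans ?_ (hsnd v)
    refine (Set.ncard_le_ncard ?_ (Set.toFinite _)).trans (Set.ncard_image_le
      (f := fun p : Bool × Fin n => (p.1, (addr p.2).1, (addr p.2).2)) (Set.toFinite _))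
    rintro ⟨b, i, s⟩ ⟨y, hy⟩
    obtain ⟨u, h1, h2⟩ := (hiff b i s v y).1 hy
    exact ⟨(b, u), ⟨y, h2⟩, by simp [h1]⟩
  · intro c' hc'
    refine ⟨_, hc', fun v => ?_⟩
    simp only [own_addr haddr, Option.elim_some, hσ, hiff]
    congr 1
    ext y
    constructor
    · rintro ⟨b, v', j, s, ⟨u, h1, h2⟩, h3⟩
      obtain rfl := haddr h3
      exact ⟨b, u, h2⟩
    · rintro ⟨b, u, h⟩
      exact ⟨b, v, _, _, ⟨u, rfl, h⟩, rfl⟩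

lemma view_eq [Inhabited Z] {σ : Fin M → Fin S → Z} {x : Fin n → Z}
    (hσ : ∀ v, σ (addr v).1 (addr v).2 = x v) (i : Fin M) :
    view addr i (σ i) = fun u => if (addr u).1 = i then x u else default := by
  funext u
  rw [view]
  split_ifs with h
  · rw [← hσ, h]
  · rfl

lemma HoldsVertex.vertexLocal [Inhabited Z] (haddr : Function.Injective addr) {x : Fin n → Z}
    {c : Conf S M ((Z × (Option Y × Option Y)) × Fin W) ((Fin n × Y) ⊕ Fin W)}
    (h : HoldsVertex addr x c) (f : Fin n → Ω → (Fin n → Z) → Z) (ω : Fin M → Ω) :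
    HoldsVertex addr (fun v => f v (ω (addr v).1)
      fun u => if (addr u).1 = (addr v).1 then x u else default)
      (advance (vertexLocal addr f) ω c) := by
  obtain ⟨σ, hc, hσ⟩ := h
  refine ⟨fun i s => (own addr i s).elim (σ i s) fun v => f v (ω i) (view addr i (σ i)),
    Holds.localRound hc _ ω, fun v => ?_⟩
  simp only [own_addr haddr, Option.elim_some, view_eq hσ]

lemma triple_vertexLocal [Inhabited Z] [Fintype Ω] [Nonempty Ω] (haddr : Function.Injective addr)
    (f : Fin n → (Fin n → Z) → Z) (x : Fin n → Z) :
    Triple [(vertexLocal addr fun v _ => f v :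
      Round S M ((Z × (Option Y × Option Y)) × Fin W) ((Fin n × Y) ⊕ Fin W) Ω)]
      (HoldsVertex addr x) (HoldsVertex addr fun v =>
        f v fun u => if (addr u).1 = (addr v).1 then x u else default) 0 :=
  Triple.single (fun _ h => h.fits) fun _ h ω =>
    ⟨(h.vertexLocal haddr (fun v _ => f v) ω).fits, h.vertexLocal haddr (fun v _ => f v) ω⟩

lemma triple_vertexCall [Inhabited Z] {Ω₂ : Type} [Fintype Ω₂] [Nonempty Ω₂]
    (haddr : Function.Injective addr) (A : Algorithm n S M W T (Fin n → Fin W))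
    (Es : Fin M → (Fin n → Z) → Set (Sym2 (Fin n)))
    (f : Fin n → (Fin n → Fin W) → (Fin n → Z) → Z)
    (x : Fin n → Z) (G : SimpleGraph (Fin n)) (P : Placement G S M) (D : ℕ) (e : ℝ)
    (hprob : 1 - e ≤ A.prob {ω | A.WithinSpace P ω ∧
        CorrectComponents G D (fun v => A.result P ω (P.vertexAt v) v)})
    (hV : P.vertexAt = fun v => (addr v).1)
    (hE : ∀ i, Es i (fun u => if (addr u).1 = i then x u else default) =
      {e | e ∈ G.edgeSet ∧ P.edgeAt e = i}) :
    Triple (vertexCall addr A Es f : List (Round S M ((Z × (Option Y × Option Y)) × Fin W)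
      ((Fin n × Y) ⊕ Fin W) ((Fin A.coins → Bool) × Ω₂))) (HoldsVertex addr x)
      (fun c => ∃ l : Fin M → Fin n → Fin W,
        CorrectComponents G D (fun v => l (addr v).1 v) ∧
          HoldsVertex addr (fun v => f v (l (addr v).1)
            fun u => if (addr u).1 = (addr v).1 then x u else default) c) e := by
  rintro c ⟨σ, hc, hσ⟩
  refine (triple_callRounds A _ _ _ _ G P D e hprob (fun i => by rw [hV]) ?_).weaken
    (fun _ h => h) ?_ le_rfl c hc
  · intro i
    rw [← hE, ← view_eq hσ]
  · rintro c' ⟨l, hl, hc'⟩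
    rw [hV] at hl
    refine ⟨l, hl, fun i s => (own addr i s).elim (σ i s) fun v => f v (l i) (view addr i (σ i)),
      hc', fun v => ?_⟩
    simp only [own_addr haddr, Option.elim_some, view_eq hσ]

end Vertices

end MPC

namespace MPC

/-! ### Placement of vertices, groups and query nodes -/

/-- A distribution of the vertices among the machines, split into groups of `L` vertices on the
same machine, `K` of them on each machine, together with names for the nodes of query graphs. -/
structure Layout (n S M K L N k B : ℕ) where
  addr : Fin n → Fin M × Fin S
  addr_inj : Function.Injective addr
  half : Fin n → Bool
  -- Two words for each vertex of one half fit into a machine.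
  half_le : ∀ i h, 2 * {v | (addr v).1 = i ∧ half v = h}.ncard ≤ S
  pos : Fin n → Fin K × Fin L
  pos_inj : Function.Injective fun v => (((addr v).1, (pos v).1), (pos v).2)
  grp : Fin n → Option (Fin N)
  home : Fin N → Fin n
  grp_home : ∀ j, grp (home j) = some j
  machine_eq : ∀ {u v j}, grp u = some j → grp v = some j → (addr u).1 = (addr v).1
  pos_eq : ∀ {u v j}, grp u = some j → grp v = some j → (pos u).1 = (pos v).1
  exists_pos : ∀ j r, ∃ v, grp v = some j ∧ (pos v).2 = r
  -- The vertices left over when `n` is not a multiple of `L` belong to no group and are never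
  -- marked.
  tail_le : {v | grp v = none}.ncard ≤ L
  nm : QueryNode (Fin N × Bool) k B → Fin n
  nm_inj : Function.Injective nm
  -- The query nodes of a group are vertices of that group, hence lie on the machine that knows the
  -- function on its darts.
  grp_nm : ∀ a, grp (nm a) = some a.1.1
  -- The query graph puts on a machine its vertices and at most one edge, that to the parent, for
  -- each query node.
  cap : ∀ i, {v | (addr v).1 = i}.ncard + {v | (addr v).1 = i ∧ v ∈ Set.range nm}.ncard ≤ S
  bits : Fin N × Bool → Fin B → Bool
  bits_inj : Function.Injective bits

/-- What is stored with a vertex. -/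
@[ext] structure VState (n N : ℕ) where
  /-- an edge of the input -/
  edge : Option (Fin n × Fin n)
  /-- the neighbours -/
  nbr : Bool → Fin n
  /-- whether the vertex represents its group -/
  mark : Bool
  /-- the darts at some distance -/
  ptr : Bool → Fin n × Bool
  /-- the first marked darts within that distance -/
  hit : Bool → Option (Fin n × Bool)
  /-- a function on the darts of a group -/
  elf : Bool → Fin N × Bool
  /-- whether some group is not connected to the first one -/
  flag : Bool

instance {n N : ℕ} [NeZero n] [NeZero N] : Inhabited (VState n N) :=
  ⟨⟨none, fun _ => 0, false, fun _ => (0, false), fun _ => none, fun _ => (0, false), false⟩⟩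

/-- The contents of messages. -/
abbrev Msg (n : ℕ) : Type := Bool × (Fin n × Bool) × Option (Fin n × Bool)

section Stages

variable {n S M W K L N k B : ℕ} {Ω : Type}

/-- The states of the vertices satisfy `Inv`. -/
def Sat {Z Y : Type} (addr : Fin n → Fin M × Fin S) (Inv : (Fin n → Z) → Prop)
    (c : Conf S M ((Z × (Option Y × Option Y)) × Fin W) ((Fin n × Y) ⊕ Fin W)) : Prop :=
  ∃ x, HoldsVertex addr x c ∧ Inv x

/-! #### Loading the input -/

/-- Slots send messages, so each edge that a machine is given must sit in a slot. Uniqueness of the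
slot ensures that no edge is announced twice. -/
lemma exists_enumeration {S : ℕ} {Es : Set (Sym2 (Fin n))} (h : Es.ncard ≤ S) :
    ∃ g : Fin S → Option (Fin n × Fin n), (∀ s p, g s = some p → s(p.1, p.2) ∈ Es) ∧
      (∀ e ∈ Es, ∃ s p, g s = some p ∧ s(p.1, p.2) = e) ∧
      ∀ s s' p p', g s = some p → g s' = some p' → s(p.1, p.2) = s(p'.1, p'.2) → s = s' := by
  classical
  have hcard : Fintype.card Es ≤ Fintype.card (Fin S) := by
    rw [Fintype.card_fin, ← Set.toFinset_card, ← Set.ncard_eq_toFinset_card']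
    exact h
  obtain ⟨emb⟩ := Function.Embedding.nonempty_of_card_le hcard
  have hout : ∀ e : Sym2 (Fin n), s(e.out.1, e.out.2) = e := fun e => Quot.out_eq e
  have hg : ∀ e : Es, ∃ e' : Es, emb e' = emb e := fun e => ⟨e, rfl⟩
  refine ⟨fun s => if h : ∃ e : Es, emb e = s then some h.choose.1.out else none, ?_, ?_, ?_⟩
  · intro s p hp
    simp only at hp
    split_ifs at hp with h1
    obtain rfl := Option.some.inj hp
    rw [hout]
    exact h1.choose.2
  · intro e he
    refine ⟨emb ⟨e, he⟩, _, dif_pos (hg ⟨e, he⟩), ?_⟩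
    rw [hout, emb.injective (hg ⟨e, he⟩).choose_spec]
  · intro s s' p p' hp hp' heq
    simp only at hp
    split_ifs at hp with h1
    simp only at hp'
    split_ifs at hp' with h2
    obtain rfl := Option.some.inj hp
    obtain rfl := Option.some.inj hp'
    rw [hout, hout] at heq
    rw [← h1.choose_spec, ← h2.choose_spec, Subtype.ext heq]

open scoped Classical in
/-- Distribute the edges that a machine is given among its slots. -/
noncomputable def edgeSlots (S : ℕ) (Es : Set (Sym2 (Fin n))) (s : Fin S) :
    Option (Fin n × Fin n) :=
  if h : Es.ncard ≤ S then (exists_enumeration h).choose s else none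

variable [NeZero n] [NeZero N]

/-- The initial states of the slots. -/
noncomputable def initState (Es : Set (Sym2 (Fin n))) (s : Fin S) : VState n N :=
  { (default : VState n N) with edge := edgeSlots S Es s }

open scoped Classical in
/-- List a set of two vertices. -/
noncomputable def listTwo (A : Set (Fin n)) : Bool → Fin n :=
  if h : ∃ g : Bool → Fin n, g false ≠ g true ∧ A = Set.range g then h.choose else default

/-- Every vertex learns its neighbours. -/
noncomputable def loadRounds (addr : Fin n → Fin M × Fin S) (half : Fin n → Bool) :
    List (Round S M ((VState n N × (Option (Msg n) × Option (Msg n))) × Fin W)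
      ((Fin n × Msg n) ⊕ Fin W) Ω) :=
  gatherRounds addr half
    (fun b _ _ z => z.edge.map fun p => if b then (p.2, (false, (p.1, false), none))
      else (p.1, (false, (p.2, false), none)))
    (fun _ _ z A => { z with nbr := listTwo {u | (false, (u, false), none) ∈ A} })

omit [NeZero N] in
lemma isNbr_listTwo {G : SimpleGraph (Fin n)}
    (hdeg : ∀ v, ∃ p q, p ≠ q ∧ ∀ x, G.Adj v x ↔ x = p ∨ x = q) :
    IsNbr G fun v => listTwo (G.neighborSet v) := by
  have key : ∀ v, ∃ g : Bool → Fin n, g false ≠ g true ∧ G.neighborSet v = Set.range g := by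
    intro v
    obtain ⟨p, q, hpq, h⟩ := hdeg v
    refine ⟨fun b => if b then q else p, by simpa using hpq, ?_⟩
    ext x
    simp [h, eq_comm]
  constructor
  · intro v
    rw [listTwo, dif_pos (key v)]
    exact (key v).choose_spec.1
  · intro v x
    rw [listTwo, dif_pos (key v), ← SimpleGraph.mem_neighborSet]
    conv_lhs => rw [(key v).choose_spec.2]
    exact Iff.rfl

/-- A vertex is told of each incident edge once, by the slot that holds the edge. The other end
determines the edge, its machine, its slot and which of the two messages it is, so degree two means
at most two messages. -/
lemma triple_loadRounds [Fintype Ω] [Nonempty Ω] {addr : Fin n → Fin M × Fin S}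
    (haddr : Function.Injective addr) {half : Fin n → Bool}
    (hhalf : ∀ i h, 2 * {v | (addr v).1 = i ∧ half v = h}.ncard ≤ S)
    {G : SimpleGraph (Fin n)} (hdeg : ∀ v, ∃ p q, p ≠ q ∧ ∀ x, G.Adj v x ↔ x = p ∨ x = q)
    (P : Placement G S M) :
    Triple (loadRounds addr half : List (Round S M ((VState n N × (Option (Msg n) ×
      Option (Msg n))) × Fin W) ((Fin n × Msg n) ⊕ Fin W) Ω))
      (HoldsState fun i => initState {e | e ∈ G.edgeSet ∧ P.edgeAt e = i})
      (Sat addr fun x => ∀ v, (x v).nbr = listTwo (G.neighborSet v)) 0 := by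
  set Es : Fin M → Set (Sym2 (Fin n)) := fun i => {e | e ∈ G.edgeSet ∧ P.edgeAt e = i} with hEs
  have hle : ∀ i, (Es i).ncard ≤ S := fun i => le_trans (Nat.le_add_left _ _) (P.fits i)
  have hedge : ∀ i s, (initState (N := N) (Es i) s).edge =
      (exists_enumeration (hle i)).choose s := fun i s => by
    simp [initState, edgeSlots, hle i]
  set g : Fin M → Fin S → Option (Fin n × Fin n) := fun i s => (exists_enumeration (hle i)).choose s
  have g1 : ∀ i s p, g i s = some p → s(p.1, p.2) ∈ Es i := fun i =>
    (exists_enumeration (hle i)).choose_spec.1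
  have g2 : ∀ i, ∀ e ∈ Es i, ∃ s p, g i s = some p ∧ s(p.1, p.2) = e := fun i =>
    (exists_enumeration (hle i)).choose_spec.2.1
  have g3 : ∀ i s s' p p', g i s = some p → g i s' = some p' →
      s(p.1, p.2) = s(p'.1, p'.2) → s = s' := fun i =>
    (exists_enumeration (hle i)).choose_spec.2.2
  let snd : Bool → Fin M → Fin S → VState n N → Option (Fin n × Msg n) :=
    fun b _ _ z => z.edge.map fun p => if b then (p.2, (false, (p.1, false), none))
      else (p.1, (false, (p.2, false), none))
  have hsnd : ∀ b i s v y, snd b i s (initState (Es i) s) = some (v, y) ↔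
      ∃ u, y = (false, (u, false), none) ∧
        g i s = some (if b then (u, v) else (v, u)) := by
    intro b i s v y
    simp only [snd, hedge]
    change (g i s).map _ = _ ↔ _
    rw [Option.map_eq_some_iff]
    constructor
    · rintro ⟨p, h1, h2⟩
      cases b
      · simp only [Bool.false_eq_true, if_false, Prod.mk.injEq] at h2 ⊢
        exact ⟨p.2, h2.2.symm, by rw [h1, ← h2.1]⟩
      · simp only [if_true, Prod.mk.injEq] at h2 ⊢
        exact ⟨p.1, h2.2.symm, by rw [h1, ← h2.1]⟩
    · rintro ⟨u, rfl, h1⟩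
      refine ⟨_, h1, ?_⟩
      cases b <;> rfl
  refine (triple_gatherRounds haddr hhalf _ _ _ ?_).weaken (fun _ h => h) ?_ le_rfl
  · intro v
    obtain ⟨p, q, hpq, hadj⟩ := hdeg v
    have hcard : ({p, q} : Set (Fin n)).ncard = 2 := Set.ncard_pair hpq
    rw [← hcard]
    have hmem : ∀ {b i s y}, snd b i s (initState (Es i) s) = some (v, y) →
        ∃ u, G.Adj v u ∧ P.edgeAt s(v, u) = i ∧ g i s = some (if b then (u, v) else (v, u)) := by
      intro b i s y h
      obtain ⟨u, -, hu⟩ := (hsnd b i s v y).1 h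
      have h1 := g1 _ _ _ hu
      cases b
      · exact ⟨u, h1.1, h1.2, hu⟩
      · have h2 : s(u, v) = s(v, u) := Sym2.eq_swap
        simp only [if_true, h2] at h1
        exact ⟨u, h1.1, h1.2, hu⟩
    let other : Bool × Fin M × Fin S → Fin n := fun a =>
      ((g a.2.1 a.2.2).map fun p => if a.1 then p.1 else p.2).getD 0
    refine Set.ncard_le_ncard_of_injOn other ?_ ?_ (Set.toFinite _)
    · rintro ⟨b, i, s⟩ ⟨y, hy⟩
      obtain ⟨u, hu, -, hg⟩ := hmem hy
      have : other (b, i, s) = u := by cases b <;> simp [other, hg]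
      rw [this]
      exact (hadj u).1 hu
    · rintro ⟨b, i, s⟩ ⟨y, hy⟩ ⟨b', i', s'⟩ ⟨y', hy'⟩ heq
      obtain ⟨u, hu, hi, hg⟩ := hmem hy
      obtain ⟨u', hu', hi', hg'⟩ := hmem hy'
      have e1 : other (b, i, s) = u := by cases b <;> simp [other, hg]
      have e2 : other (b', i', s') = u' := by cases b' <;> simp [other, hg']
      rw [e1, e2] at heq
      subst heq
      have hii : i = i' := hi.symm.trans hi'
      subst hii
      have hss : s = s' := by
        refine g3 i s s' _ _ hg hg' ?_
        cases b <;> cases b' <;> simp [Sym2.eq_swap]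
      subst hss
      have hbb : b = b' := by
        have h5 := Option.some.inj (hg.symm.trans hg')
        have hne := hu.ne
        cases b <;> cases b'
        · rfl
        · exact absurd (congrArg Prod.fst h5) hne
        · exact absurd (congrArg Prod.snd h5) hne
        · rfl
      rw [hbb]
  · intro c hc
    refine ⟨_, ⟨_, hc, fun v => rfl⟩, fun v => ?_⟩
    simp only
    congr 1
    ext u
    simp only [Set.mem_ofPred_eq, SimpleGraph.mem_neighborSet]
    constructor
    · rintro ⟨b, v', j, s', h1, h2⟩
      obtain rfl := haddr h2
      obtain ⟨u', h3, h4⟩ := (hsnd b j s' v' _).1 h1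
      simp only [Prod.mk.injEq, and_true, true_and] at h3
      subst h3
      have := (g1 _ _ _ h4).1
      cases b
      · exact this
      · exact (SimpleGraph.mem_edgeSet G).1 this |>.symm
    · intro h
      obtain ⟨s, p, h1, h2⟩ := g2 (P.edgeAt s(v, u)) s(v, u) ⟨h, rfl⟩
      rcases Sym2.eq_iff.1 h2 with ⟨h3, h4⟩ | ⟨h3, h4⟩
      · exact ⟨false, v, _, s, (hsnd _ _ _ _ _).2 ⟨u, rfl, by rw [h1, ← h3, ← h4]; rfl⟩, rfl⟩
      · exact ⟨true, v, _, s, (hsnd _ _ _ _ _).2 ⟨u, rfl, by rw [h1, ← h3, ← h4]; rfl⟩, rfl⟩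

end Stages

end MPC

namespace MPC

lemma Triple.iterate {S M : ℕ} {Q R Ω : Type} [Fintype Ω] {p : List (Round S M Q R Ω)}
    {I : ℕ → Conf S M Q R → Prop} {e : ℝ} (he : 0 ≤ e) (h0 : ∀ c, I 0 c → Fits c)
    (h : ∀ t, Triple p (I t) (I (t + 1)) e) (J : ℕ) :
    Triple (List.replicate J p).flatten (I 0) (I J) (J * e) := by
  induction J with
  | zero => simpa using Triple.nil h0
  | succ J ih =>
    rw [List.replicate_succ', List.flatten_append, List.flatten_singleton]
    have := ih.append (h J) (by positivity) he
    refine this.weaken (fun _ h => h) (fun _ h => h) (le_of_eq ?_)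
    push_cast; ring

open scoped Classical in
/-- An element of a set with a given property. -/
noncomputable def find {α : Type*} [Inhabited α] (A : Set α) (P : α → Prop) : α :=
  if h : ∃ y ∈ A, P y then h.choose else default

lemma find_eq {α : Type*} [Inhabited α] {A : Set α} {P : α → Prop} {y : α} (hy : y ∈ A)
    (hP : P y) (huniq : ∀ z ∈ A, P z → z = y) : find A P = y := by
  have h : ∃ y ∈ A, P y := ⟨y, hy, hP⟩
  rw [find, dif_pos h]
  exact huniq _ h.choose_spec.1 h.choose_spec.2

section Stages

variable {n S M W T K L N k B : ℕ} {Ω Ω₁ : Type} [NeZero n] [NeZero N]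
  (Λ : Layout n S M K L N k B)

/-- Rounds of the algorithm for cycles. -/
abbrev CycleRound (n S M W N : ℕ) (Ω : Type) : Type :=
  Round S M ((VState n N × (Option (Msg n) × Option (Msg n))) × Fin W) ((Fin n × Msg n) ⊕ Fin W) Ω

/-! #### Choosing representatives -/

/-- `rep` is the list of the marked vertices, one in every group, and they are dense. -/
structure IsGoodMark (nbr : Fin n → Bool → Fin n) (τ : ℕ) (mark : Fin n → Bool)
    (rep : Fin N → Fin n) : Prop where
  hits : ∀ d, firstMark nbr mark (2 ^ τ) d ≠ none
  grp_rep : ∀ j, Λ.grp (rep j) = some j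
  mark_rep : ∀ j, mark (rep j) = true
  rep_grp : ∀ v, mark v = true → ∃ j, Λ.grp v = some j ∧ rep j = v

/-- Whether a vertex is the random representative of its group. -/
def isChosen (ω : Fin M → Ω₁ × (Fin K → Fin L)) (v : Fin n) : Bool :=
  decide ((Λ.grp v).isSome = true ∧ (ω (Λ.addr v).1).2 (Λ.pos v).1 = (Λ.pos v).2)

/-- Mark a random vertex of every group. -/
noncomputable def markRound : CycleRound n S M W N (Ω₁ × (Fin K → Fin L)) :=
  vertexLocal Λ.addr fun v ω xs => { xs v with
    mark := decide ((Λ.grp v).isSome = true ∧ ω.2 (Λ.pos v).1 = (Λ.pos v).2) }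

omit [NeZero n] [NeZero N] in
-- The coins of a group select one offset in it: some vertex of the group has this offset by
-- `exists_pos`, and only one by `pos_inj`.
lemma exists_rep (ω : Fin M → Ω₁ × (Fin K → Fin L)) :
    ∃ rep : Fin N → Fin n, (∀ j, Λ.grp (rep j) = some j) ∧ (∀ j, isChosen Λ ω (rep j) = true) ∧
      ∀ v, isChosen Λ ω v = true → ∃ j, Λ.grp v = some j ∧ rep j = v := by
  have h : ∀ j, ∃ v, Λ.grp v = some j ∧ isChosen Λ ω v = true := by
    intro j
    obtain ⟨v, h1, h2⟩ :=
      Λ.exists_pos j ((ω (Λ.addr (Λ.home j)).1).2 (Λ.pos (Λ.home j)).1)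
    refine ⟨v, h1, ?_⟩
    rw [isChosen, decide_eq_true_eq, h2, Λ.machine_eq h1 (Λ.grp_home j),
      Λ.pos_eq h1 (Λ.grp_home j)]
    simp [h1]
  choose rep h1 h2 using h
  refine ⟨rep, h1, h2, fun v hv => ?_⟩
  have hv' := hv
  rw [isChosen, decide_eq_true_eq, Option.isSome_iff_exists] at hv'
  obtain ⟨⟨j, hj⟩, hv'⟩ := hv'
  refine ⟨j, hj, Λ.pos_inj ?_⟩
  have h3 := h2 j
  rw [isChosen, decide_eq_true_eq, Λ.machine_eq (h1 j) hj, Λ.pos_eq (h1 j) hj] at h3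
  simp only [Prod.mk.injEq]
  exact ⟨⟨Λ.machine_eq (h1 j) hj, Λ.pos_eq (h1 j) hj⟩, h3.2.symm.trans hv'⟩

/-- The next `2 ^ τ` vertices along a dart are distinct and at most `L` of them have no group, so at
least `2 ^ τ - L` can be marked. The union bound runs over the `n * 2` darts. -/
lemma triple_markRound [Fintype Ω₁] [Nonempty Ω₁] (hL : 0 < L) {nbr : Fin n → Bool → Fin n}
    {τ : ℕ} (hwin : ∀ d, Set.InjOn (fun i => ((turn nbr)^[i] d).1) (Set.Icc 1 (2 ^ τ))) :
    Triple [(markRound Λ : CycleRound n S M W N (Ω₁ × (Fin K → Fin L)))]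
      (Sat Λ.addr fun x => ∀ v, (x v).nbr = nbr v)
      (fun c => ∃ mark rep, IsGoodMark Λ nbr τ mark rep ∧
        Sat Λ.addr (fun x => ∀ v, (x v).nbr = nbr v ∧ (x v).mark = mark v) c)
      ((n * 2 : ℕ) * Real.exp (-(((2 : ℝ) ^ τ - L) / L))) := by
  classical
  have : Nonempty (Fin L) := ⟨⟨0, hL⟩⟩
  let win : Fin n × Bool → Finset (Fin n) := fun d =>
    ((Finset.Icc 1 (2 ^ τ)).image fun i => ((turn nbr)^[i] d).1).filter fun v => Λ.grp v ≠ none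
  have hcard : ∀ d, (2 : ℝ) ^ τ - L ≤ (win d).card := by
    intro d
    have h1 : ((Finset.Icc 1 (2 ^ τ)).image fun i => ((turn nbr)^[i] d).1).card = 2 ^ τ := by
      rw [Finset.card_image_of_injOn (by simpa using hwin d)]
      simp
    have h2 := Finset.card_filter_add_card_filter_not (s :=
      (Finset.Icc 1 (2 ^ τ)).image fun i => ((turn nbr)^[i] d).1) fun v => Λ.grp v ≠ none
    have h3 : (((Finset.Icc 1 (2 ^ τ)).image fun i => ((turn nbr)^[i] d).1).filter
        fun v => ¬ Λ.grp v ≠ none).card ≤ L := by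
      refine le_trans ?_ Λ.tail_le
      rw [Set.ncard_eq_toFinset_card']
      refine Finset.card_le_card fun v hv => ?_
      simpa using (Finset.mem_filter.1 hv).2
    rw [h1] at h2
    have h4 : 2 ^ τ ≤ (win d).card + L := by simp only [win]; omega
    have : ((2 : ℝ) ^ τ) ≤ (win d).card + L := by exact_mod_cast h4
    linarith
  have hprob := expect_ind_hit_ge (Ω₁ := Ω₁) hL
    (fun v => (((Λ.addr v).1, (Λ.pos v).1), (Λ.pos v).2)) Λ.pos_inj win _ hcard
  rw [Fintype.card_prod, Fintype.card_fin, Fintype.card_bool] at hprob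
  refine Triple.random _ hprob (fun c ⟨x, hx, _⟩ => hx.fits) ?_
  rintro c ⟨x, hx, hnbr⟩ ω hω
  have hx' := hx.vertexLocal Λ.addr_inj (fun v (ω : Ω₁ × (Fin K → Fin L)) xs => { xs v with
    mark := decide ((Λ.grp v).isSome = true ∧ ω.2 (Λ.pos v).1 = (Λ.pos v).2) }) ω
  refine ⟨hx'.fits, ?_⟩
  obtain ⟨rep, h1, h2, h3⟩ := exists_rep Λ ω
  refine ⟨isChosen Λ ω, rep, ⟨fun d => ?_, h1, h2, h3⟩, _, hx', fun v => ?_⟩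
  · obtain ⟨v, hv, hv'⟩ := hω d
    simp only [win, Finset.mem_filter, Finset.mem_image, Finset.mem_Icc] at hv
    obtain ⟨⟨i, ⟨hi1, hi2⟩, rfl⟩, hg⟩ := hv
    refine firstMark_ne_none hi1 hi2 ?_
    rw [isChosen, decide_eq_true_eq]
    exact ⟨Option.isSome_iff_ne_none.2 hg, hv'⟩
  · simp [isChosen, hnbr]

/-! #### Darts and pointer doubling -/

variable [Fintype Ω] [Nonempty Ω]

/-- The state after the distance `m`. -/
def DartInv (nbr : Fin n → Bool → Fin n) (mark : Fin n → Bool) (m : ℕ)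
    (x : Fin n → VState n N) : Prop :=
  ∀ v, (x v).mark = mark v ∧ (∀ c, (x v).ptr c = (turn nbr)^[m] (v, c)) ∧
    ∀ c, (x v).hit c = firstMark nbr mark m (v, c)

/-- Every vertex tells its neighbours by which port it reaches them. -/
noncomputable def exchangeRounds : List (CycleRound n S M W N Ω) :=
  vertexGather Λ.addr Λ.half (fun b v z => some (z.nbr b, (z.mark, (v, b), none)))
    (fun _ z A => { z with
      ptr := fun c => ((find A fun y => y.2.1.1 = z.nbr c).2.1.1,
        !(find A fun y => y.2.1.1 = z.nbr c).2.1.2)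
      hit := fun c => if (find A fun y => y.2.1.1 = z.nbr c).1
        then some ((find A fun y => y.2.1.1 = z.nbr c).2.1.1,
          !(find A fun y => y.2.1.1 = z.nbr c).2.1.2) else none })

omit [NeZero n] in
-- Only two darts start at `v`, and `g` is injective. This bounds the messages to a vertex in both
-- stages of the walk.
lemma ncard_darts_le (g : Fin n × Bool → Fin n × Bool) (hg : Function.Injective g) (v : Fin n) :
    {p : Bool × Fin n | (g (p.2, p.1)).1 = v}.ncard ≤ 2 := by
  have h2 : (Set.univ : Set Bool).ncard = 2 := by simp
  rw [← h2]
  refine Set.ncard_le_ncard_of_injOn (fun p => (g (p.2, p.1)).2) (fun _ _ => trivial) ?_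
    (Set.toFinite _)
  rintro ⟨b, u⟩ h ⟨b', u'⟩ h' heq
  have := hg (Prod.ext (h.trans h'.symm) heq)
  simpa [and_comm] using this

omit [NeZero N] in
lemma triple_exchangeRounds {nbr : Fin n → Bool → Fin n} (hp : IsPorts nbr)
    (mark : Fin n → Bool) :
    Triple (exchangeRounds Λ : List (CycleRound n S M W N Ω))
      (Sat Λ.addr fun x => ∀ v, (x v).nbr = nbr v ∧ (x v).mark = mark v)
      (Sat Λ.addr (DartInv nbr mark 1)) 0 := by
  rintro c ⟨x, hx, hinv⟩
  refine (triple_vertexGather Λ.addr_inj Λ.half_le _ _ x ?_).weaken (fun _ h => h) ?_ le_rfl c hx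
  · intro v
    refine le_of_eq_of_le ?_ (ncard_darts_le (turn nbr) (hp.iterate_turn_injective 1) v)
    congr 1
    ext ⟨b, u⟩
    simp [hinv, turn]
  · intro c' hc'
    refine ⟨_, hc', fun v => ?_⟩
    have key : ∀ c, ∃ y : Msg n, find {y | ∃ b u, some ((x u).nbr b, ((x u).mark, (u, b),
        (none : Option (Fin n × Bool)))) = some (v, y)} (fun y => y.2.1.1 = (x v).nbr c) = y ∧
        y.1 = mark (turn nbr (v, c)).1 ∧ (y.2.1.1, !y.2.1.2) = turn nbr (v, c) := by
      intro c
      obtain ⟨b, hb⟩ := hp.back v c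
      refine ⟨(mark (nbr v c), (nbr v c, b), none), ?_, rfl, (hp.turn_eq rfl hb).symm⟩
      refine find_eq ⟨b, nbr v c, ?_⟩ ?_ ?_
      · simp [hinv, hb]
      · simp [hinv]
      · rintro y ⟨b', u, h1⟩ h2
        simp only [hinv, Option.some.injEq, Prod.mk.injEq] at h1 h2
        obtain ⟨h1, rfl⟩ := h1
        simp only at h2
        subst h2
        rw [hp.inj (h1.trans hb.symm)]
    refine ⟨(hinv v).2, fun c => ?_, fun c => ?_⟩
    · obtain ⟨y, h1, h2, h3⟩ := key c
      simp only [h1, h3, Function.iterate_one]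
    · obtain ⟨y, h1, h2, h3⟩ := key c
      simp only [h1, h2, h3, firstMark]

/-- Every vertex sends its pointers along its pointers. -/
noncomputable def doublingRounds : List (CycleRound n S M W N Ω) :=
  vertexGather Λ.addr Λ.half
    (fun b _ z => some ((z.ptr b).1, (!(z.ptr b).2, z.ptr !b, z.hit !b)))
    (fun _ z A => { z with
      ptr := fun c => (find A fun y => y.1 = c).2.1
      hit := fun c => (z.hit c).or (find A fun y => y.1 = c).2.2 })

omit [NeZero N] in
-- If the walk of length `m` from `(v, b)` ends at `(u, c')`, then the walk of length `m` from `(u,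
-- !c')` ends at `(v, !b)`. So `v` is the vertex whose pointer at port `!b` is wanted by `u` at port
-- `!c'`, and `v` can send it unasked.
lemma triple_doublingRounds {nbr : Fin n → Bool → Fin n} (hp : IsPorts nbr)
    (mark : Fin n → Bool) (m : ℕ) :
    Triple (doublingRounds Λ : List (CycleRound n S M W N Ω))
      (Sat Λ.addr (DartInv nbr mark m)) (Sat Λ.addr (DartInv nbr mark (m + m))) 0 := by
  rintro c ⟨x, hx, hinv⟩
  have hptr : ∀ v b, (x v).ptr b = (turn nbr)^[m] (v, b) := fun v => (hinv v).2.1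
  have hhit : ∀ v b, (x v).hit b = firstMark nbr mark m (v, b) := fun v => (hinv v).2.2
  refine (triple_vertexGather Λ.addr_inj Λ.half_le _ _ x ?_).weaken (fun _ h => h) ?_ le_rfl c hx
  · intro v
    refine le_of_eq_of_le ?_ (ncard_darts_le _ (hp.iterate_turn_injective m) v)
    congr 1
    ext ⟨b, u⟩
    simp [hptr]
  · intro c' hc'
    refine ⟨_, hc', fun u => ?_⟩
    have key : ∀ c, find {y : Msg n | ∃ b v, some (((x v).ptr b).1, (!((x v).ptr b).2,
        (x v).ptr !b, (x v).hit !b)) = some (u, y)} (fun y => y.1 = c) =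
        (c, (turn nbr)^[m + m] (u, c), firstMark nbr mark m ((turn nbr)^[m] (u, c))) := by
      intro c
      -- The message that `u` finds for its port `c` can come from only one dart, by reversal of the
      -- walk.
      have huniq : ∀ v b, (turn nbr)^[m] (v, b) = (u, !c) → (turn nbr)^[m] (u, c) = (v, !b) := by
        intro v b h
        have := hp.iterate_turn_flip m (v, b)
        rw [h] at this
        simpa [flip] using this
      refine find_eq ?_ rfl ?_
      · have h1 := hp.iterate_turn_flip m (u, c)
        refine ⟨!((turn nbr)^[m] (u, c)).2, ((turn nbr)^[m] (u, c)).1, ?_⟩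
        simp only [flip] at h1
        simp [hptr, hhit, h1, Function.iterate_add_apply]
      · rintro y ⟨b, v, h1⟩ h2
        simp only [hptr, hhit, Option.some.injEq, Prod.mk.injEq] at h1
        obtain ⟨h1, rfl⟩ := h1
        simp only at h2
        subst h2
        have h3 := huniq v b (Prod.ext h1 (by simp))
        rw [Function.iterate_add_apply, h3]
    refine ⟨(hinv u).1, fun c => ?_, fun c => ?_⟩
    · simp only [key]
    · simp only [key]
      rw [hhit, firstMark_add]

omit [NeZero N] in
lemma triple_doubling_iterate {nbr : Fin n → Bool → Fin n} (hp : IsPorts nbr)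
    (mark : Fin n → Bool) (τ : ℕ) :
    Triple (List.replicate τ (doublingRounds Λ : List (CycleRound n S M W N Ω))).flatten
      (Sat Λ.addr (DartInv nbr mark 1)) (Sat Λ.addr (DartInv nbr mark (2 ^ τ))) 0 := by
  have := Triple.iterate (p := (doublingRounds Λ : List (CycleRound n S M W N Ω)))
    (I := fun t => Sat Λ.addr (DartInv nbr mark (2 ^ t))) le_rfl
    (fun c ⟨x, hx, _⟩ => hx.fits) (fun t => by
      have := triple_doublingRounds (W := W) (Ω := Ω) Λ hp mark (2 ^ t)
      rwa [← two_mul, ← pow_succ'] at this) τ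
  simpa using this

/-! #### Contraction -/

/-- The groups know a function on their darts. -/
def ElementInv (f : Fin N × Bool → Fin N × Bool) (x : Fin n → VState n N) : Prop :=
  ∀ j b, (x (Λ.home j)).elf b = f (j, b)

/-- Every group computes the next group, stopping at the first group. -/
noncomputable def contractRound : CycleRound n S M W N Ω :=
  vertexLocal Λ.addr fun v _ xs => { xs v with
    elf := fun b => (Λ.grp v).elim (0, b) fun j => if j = 0 then (j, b) else
      (((xs (find {u | Λ.grp u = some j} fun u => (xs u).mark = true)).hit b).map
        fun d => ((Λ.grp d.1).getD 0, d.2)).getD (j, b) }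

/-- The representative of a group is on the machine of its home vertex, so its first hits are
visible there and the default of unseen states plays no role. -/
lemma triple_contractRound {nbr : Fin n → Bool → Fin n} {mark : Fin n → Bool}
    {rep : Fin N → Fin n} {τ : ℕ} (hmark : IsGoodMark Λ nbr τ mark rep) :
    Triple [(contractRound Λ : CycleRound n S M W N Ω)]
      (Sat Λ.addr (DartInv nbr mark (2 ^ τ))) (Sat Λ.addr (ElementInv Λ
        (absorb 0 (contract nbr mark rep (fun v => (Λ.grp v).getD 0) (2 ^ τ))))) 0 := by
  rintro c ⟨x, hx, hinv⟩
  refine (triple_vertexLocal Λ.addr_inj _ x).weaken (fun _ h => h) ?_ le_rfl c hx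
  intro c' hc'
  refine ⟨_, hc', fun j b => ?_⟩
  simp only [Λ.grp_home, Option.elim_some]
  have hsame : ∀ u, Λ.grp u = some j → (Λ.addr u).1 = (Λ.addr (Λ.home j)).1 := fun u hu =>
    Λ.machine_eq hu (Λ.grp_home j)
  have hfind : find {u | Λ.grp u = some j} (fun u => (if (Λ.addr u).1 = (Λ.addr (Λ.home j)).1
      then x u else default).mark = true) = rep j := by
    refine find_eq (hmark.grp_rep j) ?_ ?_
    · rw [if_pos (hsame _ (hmark.grp_rep j)), (hinv _).1, hmark.mark_rep]
    · intro u hu hu'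
      rw [if_pos (hsame _ hu), (hinv _).1] at hu'
      obtain ⟨j', h1, h2⟩ := hmark.rep_grp u hu'
      have : j = j' := by
        have h3 : Λ.grp u = some j := hu
        rw [h1] at h3
        exact (Option.some.inj h3).symm
      rw [this, h2]
  rw [hfind, if_pos (hsame _ (hmark.grp_rep j)), (hinv _).2.2]
  simp only [absorb, contract]

/-! #### Powers of a function by labelling components -/

/-- The edges of the query graph at a machine. -/
def queryEdges (i : Fin M) (xs : Fin n → VState n N) : Set (Sym2 (Fin n)) :=
  {e | ∃ x y, (Λ.addr x).1 = i ∧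
    queryOut Λ.nm (fun e => (xs (Λ.home e.1)).elf e.2) Λ.bits x = some y ∧ e = s(x, y)}

/-- Replace the function of the groups by its `k`-th power. -/
noncomputable def powerRounds {Ω₂ : Type} (A : Algorithm n S M W T (Fin n → Fin W)) :
    List (CycleRound n S M W N ((Fin A.coins → Bool) × Ω₂)) :=
  vertexCall Λ.addr A (queryEdges Λ) fun v l xs => { xs v with
    elf := fun b => (Λ.grp v).elim (0, b) fun j => Function.invFun Λ.bits fun β =>
      decide (l (Λ.nm ((j, b), 0, β, false)) = l (Λ.nm ((j, b), 0, β, true))) }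

/-- The edge from a query node to its parent is determined by `f` at the group of that node, which
is stored on the same machine; the parent may be elsewhere and is merely named. The two starting
nodes of each query share a machine as well, so their labels are compared locally and the bits
decoded into the name of `f^[k] (j, b)`. -/
lemma triple_powerRounds {Ω₂ : Type} [Fintype Ω₂] [Nonempty Ω₂]
    (A : Algorithm n S M W T (Fin n → Fin W)) {D : ℕ} (hD : 2 * (k + 1) ≤ D) {e : ℝ}
    (hA : ∀ G : SimpleGraph (Fin n), G.edgeSet.ncard ≤ n → ∀ P : Placement G S M,
      1 - e ≤ A.prob {ω | A.WithinSpace P ω ∧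
        CorrectComponents G D (fun v => A.result P ω (P.vertexAt v) v)})
    (f : Fin N × Bool → Fin N × Bool) :
    Triple (powerRounds Λ A : List (CycleRound n S M W N ((Fin A.coins → Bool) × Ω₂)))
      (Sat Λ.addr (ElementInv Λ f)) (Sat Λ.addr (ElementInv Λ f^[k])) e := by
  rintro c ⟨x, hx, hinv⟩
  have hlev := queryLev_lt (f := f) (bits := Λ.bits) Λ.nm_inj
  obtain ⟨P, hP1, hP2⟩ := exists_forest_placement hlev (fun v => (Λ.addr v).1) (S := S) (by
    intro i
    refine le_trans (Nat.add_le_add_left (Set.ncard_le_ncard ?_ (Set.toFinite _)) _) (Λ.cap i)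
    rintro v ⟨hv, hne⟩
    obtain ⟨y, hy⟩ := Option.ne_none_iff_exists'.1 hne
    obtain ⟨a, -, ha, -⟩ := exists_of_queryOut hy
    exact ⟨hv, a, ha⟩)
  refine (triple_vertexCall Λ.addr_inj A _ _ x _ P D e
    (hA _ (forest_edgeSet_ncard_le hlev) P) hP1 ?_).weaken (fun _ h => h) ?_ le_rfl c hx
  · intro i
    rw [← hP2]
    ext e
    -- States on other machines are replaced by the default in what machine `i` sees, but the parent
    -- of a node on `i` does not depend on them.
    have hout : ∀ v y, (Λ.addr v).1 = i → (queryOut Λ.nm (fun e => (if (Λ.addr (Λ.home e.1)).1 = i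
        then x (Λ.home e.1) else default).elf e.2) Λ.bits v = some y ↔
        queryOut Λ.nm f Λ.bits v = some y) := by
      intro v y hv
      by_cases h : ∃ a, Λ.nm a = v
      · obtain ⟨a, rfl⟩ := h
        rw [queryOut_nm Λ.nm_inj, queryOut_nm Λ.nm_inj]
        have : (Λ.addr (Λ.home a.1.1)).1 = i := by
          rw [← hv]; exact Λ.machine_eq (Λ.grp_home _) (Λ.grp_nm a)
        simp [queryNext, this, hinv a.1.1 a.1.2]
      · simp [queryOut, h]
    constructor
    · rintro ⟨v, y, h1, h2, h3⟩
      exact ⟨v, y, h1, (hout v y h1).1 h2, h3⟩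
    · rintro ⟨v, y, h1, h2, h3⟩
      exact ⟨v, y, h1, (hout v y h1).2 h2, h3⟩
  · rintro c' ⟨l, hl, hc'⟩
    refine ⟨_, hc', fun j b => ?_⟩
    simp only [Λ.grp_home, Option.elim_some]
    have : (fun β => decide (l (Λ.addr (Λ.home j)).1 (Λ.nm ((j, b), 0, β, false)) =
        l (Λ.addr (Λ.home j)).1 (Λ.nm ((j, b), 0, β, true)))) = Λ.bits (f^[k] (j, b)) := by
      funext β
      rw [← bits_eq_of_correctComponents Λ.nm_inj hD hl,
        Λ.machine_eq (Λ.grp_home j) (Λ.grp_nm ((j, b), 0, β, false)),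
        Λ.machine_eq (Λ.grp_nm ((j, b), 0, β, false)) (Λ.grp_nm ((j, b), 0, β, true))]
    rw [this, Function.leftInverse_invFun Λ.bits_inj]

lemma triple_power_iterate {Ω₂ : Type} [Fintype Ω₂] [Nonempty Ω₂]
    (A : Algorithm n S M W T (Fin n → Fin W)) {D : ℕ} (hD : 2 * (k + 1) ≤ D) {e : ℝ}
    (he : 0 ≤ e) (hA : ∀ G : SimpleGraph (Fin n), G.edgeSet.ncard ≤ n → ∀ P : Placement G S M,
      1 - e ≤ A.prob {ω | A.WithinSpace P ω ∧
        CorrectComponents G D (fun v => A.result P ω (P.vertexAt v) v)})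
    (f : Fin N × Bool → Fin N × Bool) (J : ℕ) :
    Triple (List.replicate J
        (powerRounds Λ A : List (CycleRound n S M W N ((Fin A.coins → Bool) × Ω₂)))).flatten
      (Sat Λ.addr (ElementInv Λ f)) (Sat Λ.addr (ElementInv Λ f^[k ^ J])) (J * e) := by
  have := Triple.iterate (p := (powerRounds Λ A :
      List (CycleRound n S M W N ((Fin A.coins → Bool) × Ω₂))))
    (I := fun t => Sat Λ.addr (ElementInv Λ f^[k ^ t])) he
    (fun c ⟨x, hx, _⟩ => hx.fits) (fun t => by
      have := triple_powerRounds (Ω₂ := Ω₂) Λ A hD hA f^[k ^ t]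
      rwa [← Function.iterate_mul, ← pow_succ] at this) J
  simpa using this

end Stages

end MPC

namespace MPC

section Answer

variable {n S M W T K L N k B : ℕ} {Ω : Type} [NeZero n] [NeZero N] [NeZero S]

/-! #### Collecting one bit along a tree of machines -/

/-- The next machine on the way to the first one. -/
def up (S : ℕ) (i : Fin M) : Fin M := ⟨i / S, (Nat.div_le_self _ _).trans_lt i.2⟩

omit [NeZero S] in
lemma val_iterate_up (i : Fin M) (r : ℕ) : ((up S)^[r] i : ℕ) = i / S ^ r := by
  induction r with
  | zero => simp
  | succ r ih =>
    rw [Function.iterate_succ_apply']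
    change ((up S)^[r] i : ℕ) / S = _
    rw [ih, pow_succ, Nat.div_div_eq_div_mul]

/-- Whether a machine knows, or is being told, that the bit is set. -/
def Told (c : Conf S M ((VState n N × (Option (Msg n) × Option (Msg n))) × Fin W)
    ((Fin n × Msg n) ⊕ Fin W)) (i : Fin M) : Prop :=
  ((c i).1 0).1.1.flag = true ∨ (c i).2.Nonempty

/-- The bits `bad` have travelled `r` steps. -/
def Collected (bad : Fin M → Prop) (r : ℕ)
    (c : Conf S M ((VState n N × (Option (Msg n) × Option (Msg n))) × Fin W)
      ((Fin n × Msg n) ⊕ Fin W)) : Prop :=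
  Fits c ∧ (∀ i, Told c i → ∃ j, bad j) ∧ ∀ j, bad j → Told c ((up S)^[r] j)

open scoped Classical in
/-- Every machine that knows that the bit is set tells the next machine. -/
noncomputable def collectRound : CycleRound n S M W N Ω := fun i _ mem I =>
  (fun s => (({ (mem s).1.1 with flag := decide ((mem 0).1.1.flag = true ∨ I.Nonempty) },
    (mem s).1.2), (mem s).2),
    fun s => if s = 0 ∧ ((mem 0).1.1.flag = true ∨ I.Nonempty)
      then some (up S i, Sum.inl (0, (false, (0, false), none))) else none)

omit [NeZero N] in
lemma advance_collectRound (ω : Fin M → Ω)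
    (c : Conf S M ((VState n N × (Option (Msg n) × Option (Msg n))) × Fin W)
      ((Fin n × Msg n) ⊕ Fin W)) (i : Fin M) :
    (((advance collectRound ω c i).1 0).1.1.flag = true ↔ Told c i) ∧
      (advance collectRound ω c i).2 = (fun j => (j, 0, Sum.inl (0, (false, (0, false), none)))) ''
        {j | up S j = i ∧ Told c j} := by
  constructor
  · simp [advance, collectRound, Told]
  · ext ⟨j, s, x⟩
    simp only [advance, collectRound, Set.mem_ofPred_eq, Set.mem_image, Prod.mk.injEq]
    constructor
    · intro h
      split_ifs at h with h1
      simp only [Option.some.injEq, Prod.mk.injEq] at h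
      exact ⟨j, ⟨h.1, h1.2⟩, rfl, h1.1.symm, h.2⟩
    · rintro ⟨j', ⟨h1, h2⟩, rfl, rfl, rfl⟩
      rw [if_pos ⟨rfl, h2⟩, h1]

omit [NeZero N] in
-- The senders to machine `i` have quotient `i` modulo `S`-division, so their remainders are
-- distinct; each sends one word, from slot `0`.
lemma fits_collectRound (ω : Fin M → Ω)
    (c : Conf S M ((VState n N × (Option (Msg n) × Option (Msg n))) × Fin W)
      ((Fin n × Msg n) ⊕ Fin W)) : Fits (advance collectRound ω c) := by
  intro i
  rw [(advance_collectRound ω c i).2]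
  refine (Set.ncard_image_le (Set.toFinite _)).trans ?_
  have hS : 0 < S := Nat.pos_of_neZero S
  have h : (Set.univ : Set (Fin S)).ncard = S := by simp
  refine le_of_le_of_eq (Set.ncard_le_ncard_of_injOn
    (fun j => (⟨j % S, Nat.mod_lt _ hS⟩ : Fin S)) (fun _ _ => Set.mem_univ _) ?_ (Set.toFinite _)) h
  rintro j ⟨hj, -⟩ j' ⟨hj', -⟩ heq
  have h1 : (j : ℕ) / S = j' / S := by
    have := congrArg Fin.val (hj.trans hj'.symm)
    simpa [up] using this
  have h2 : (j : ℕ) % S = j' % S := by simpa using heq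
  apply Fin.ext
  rw [← Nat.div_add_mod j S, ← Nat.div_add_mod j' S, h1, h2]

variable [Fintype Ω] [Nonempty Ω]

omit [NeZero N] in
-- The invariant counts bits still under way in inboxes. The second clause says that one more round
-- writes them into memory, where the output is read; this is why `collectRounds` has a round beyond
-- the `d` steps of the tree.
lemma triple_collectRound (bad : Fin M → Prop) (r : ℕ) :
    Triple [(collectRound : CycleRound n S M W N Ω)] (Collected bad r)
      (fun c => Collected bad (r + 1) c ∧ ∀ i₀, (∀ j, bad j → (up S)^[r] j = i₀) →
        (((c i₀).1 0).1.1.flag = true ↔ ∃ j, bad j)) 0 := by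
  refine Triple.single (fun c h => h.1) ?_
  rintro c ⟨-, h2, h3⟩ ω
  refine ⟨fits_collectRound ω c, ⟨fits_collectRound ω c, fun i hi => ?_, fun j hj => ?_⟩, ?_⟩
  · rcases hi with hi | hi
    · exact h2 i ((advance_collectRound ω c i).1.1 hi)
    · rw [(advance_collectRound ω c i).2] at hi
      obtain ⟨_, j, ⟨-, hj⟩, -⟩ := hi
      exact h2 j hj
  · right
    rw [(advance_collectRound ω c _).2, Function.iterate_succ_apply']
    exact ⟨_, _, ⟨rfl, h3 j hj⟩, rfl⟩
  · intro i₀ hi₀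
    rw [(advance_collectRound ω c i₀).1]
    refine ⟨h2 i₀, ?_⟩
    rintro ⟨j, hj⟩
    rw [← hi₀ j hj]
    exact h3 j hj

/-- The first machine learns whether the bit is set somewhere. -/
noncomputable def collectRounds (d : ℕ) : List (CycleRound n S M W N Ω) :=
  (List.replicate d [collectRound]).flatten ++ [collectRound]

omit [NeZero N] in
lemma triple_collectRounds (bad : Fin M → Prop) (d : ℕ) (i₀ : Fin M)
    (hi₀ : ∀ j, bad j → (up S)^[d] j = i₀) :
    Triple (collectRounds d : List (CycleRound n S M W N Ω)) (Collected bad 0)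
      (fun c => ((c i₀).1 0).1.1.flag = true ↔ ∃ j, bad j) 0 := by
  have h1 := Triple.iterate (p := [(collectRound : CycleRound n S M W N Ω)])
    (I := Collected bad) le_rfl (fun c h => h.1)
    (fun t => (triple_collectRound bad t).weaken (fun _ h => h) (fun _ h => h.1) le_rfl) d
  have h2 := (triple_collectRound (n := n) (W := W) (N := N) (Ω := Ω) (S := S) bad d).weaken
    (fun _ h => h) (fun c h => h.2 i₀ hi₀) le_rfl
  refine (h1.append h2 (by simp) le_rfl).weaken (fun _ h => h) (fun _ h => h) (by simp)

variable (Λ : Layout n S M K L N k B)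

open scoped Classical in
/-- Every machine checks whether some of its groups did not reach the first group. -/
noncomputable def flagRound : CycleRound n S M W N Ω :=
  localRound fun i _ m s => ({ (m s).1 with flag := decide (∃ j, (Λ.addr (Λ.home j)).1 = i ∧
    ((m (Λ.addr (Λ.home j)).2).1.elf false).1 ≠ 0) }, (none, none))

omit [NeZero n] in
lemma triple_flagRound (F : Fin N × Bool → Fin N × Bool) :
    Triple [(flagRound Λ : CycleRound n S M W N Ω)] (Sat Λ.addr (ElementInv Λ F))
      (Collected (fun i => ∃ j, (Λ.addr (Λ.home j)).1 = i ∧ (F (j, false)).1 ≠ 0) 0) 0 := by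
  refine Triple.single (fun c ⟨x, hx, _⟩ => hx.fits) ?_
  rintro c ⟨x, ⟨σ, hc, hσ⟩, hinv⟩ ω
  have hH := Holds.localRound hc (fun i (_ : Ω) m s => ({ (m s).1 with
    flag := decide (∃ j, (Λ.addr (Λ.home j)).1 = i ∧
      ((m (Λ.addr (Λ.home j)).2).1.elf false).1 ≠ 0) },
        ((none, none) : Option (Msg n) × Option (Msg n)))) ω
  have hT : ∀ i, Told (advance (flagRound Λ : CycleRound n S M W N Ω) ω c) i ↔
      ∃ j, (Λ.addr (Λ.home j)).1 = i ∧ (F (j, false)).1 ≠ 0 := by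
    intro i
    have h1 := (hH i).1 0
    have h2 := (hH i).2
    have h3 : ∀ j, (Λ.addr (Λ.home j)).1 = i →
        (σ i (Λ.addr (Λ.home j)).2).elf false = F (j, false) := by
      rintro j rfl
      rw [hσ, hinv]
    have hl : (flagRound Λ : CycleRound n S M W N Ω) = localRound (fun i (_ : Ω) m s =>
      ({ (m s).1 with
      flag := decide (∃ j, (Λ.addr (Λ.home j)).1 = i ∧
        ((m (Λ.addr (Λ.home j)).2).1.elf false).1 ≠ 0) },
          ((none, none) : Option (Msg n) × Option (Msg n)))) := by
      unfold flagRound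
      congr! 
    rw [Told, hl, h2, h1]
    simp only [Set.not_nonempty_empty, or_false, decide_eq_true_eq]
    refine exists_congr fun j => and_congr_right fun hj => ?_
    rw [h3 j hj]
  refine ⟨?_, ?_, fun i hi => ⟨i, (hT i).1 hi⟩, fun j hj => (hT j).2 hj⟩
  all_goals
    intro i
    simp [advance, flagRound, localRound]

/-! #### The algorithm for cycles -/

/-- The algorithm that distinguishes one cycle from two cycles. -/
noncomputable def cycleRounds (A : Algorithm n S M W T (Fin n → Fin W)) (τ J d : ℕ) :
    List (CycleRound n S M W N ((Fin A.coins → Bool) × (Fin K → Fin L))) :=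
  loadRounds Λ.addr Λ.half ++ ([markRound Λ] ++ (exchangeRounds Λ ++
    ((List.replicate τ (doublingRounds Λ)).flatten ++ ([contractRound Λ] ++
      ((List.replicate J (powerRounds Λ A)).flatten ++ ([flagRound Λ] ++ collectRounds d))))))

/-- The constant is `9 + 9` for loading and exchange, plus one round each for marking, contraction,
flags and the last step of collection. -/
lemma length_cycleRounds (A : Algorithm n S M W T (Fin n → Fin W)) (τ J d : ℕ) :
    (cycleRounds Λ A τ J d).length = 22 + 9 * τ + J * (T + 2) + d := by
  simp [cycleRounds, loadRounds, exchangeRounds, doublingRounds, powerRounds, collectRounds,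
    vertexGather, vertexCall, length_callRounds, List.length_flatten]
  ring

lemma triple_cycleRounds (hL : 0 < L) (A : Algorithm n S M W T (Fin n → Fin W)) {D : ℕ}
    (hD : 2 * (k + 1) ≤ D) {e : ℝ} (he : 0 ≤ e)
    (hA : ∀ G : SimpleGraph (Fin n), G.edgeSet.ncard ≤ n → ∀ P : Placement G S M,
      1 - e ≤ A.prob {ω | A.WithinSpace P ω ∧
        CorrectComponents G D (fun v => A.result P ω (P.vertexAt v) v)})
    {τ J d : ℕ} {G : SimpleGraph (Fin n)} (P : Placement G S M)
    (hdeg : ∀ v, ∃ p q, p ≠ q ∧ ∀ x, G.Adj v x ↔ x = p ∨ x = q)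
    (hwin : ∀ nbr, IsNbr G nbr → ∀ d,
      Set.InjOn (fun i => ((turn nbr)^[i] d).1) (Set.Icc 1 (2 ^ τ)))
    (i₀ : Fin M) (hi₀ : ∀ v, (up S)^[d] (Λ.addr v).1 = i₀) (ans : Bool)
    (hans : ∀ nbr mark rep, IsNbr G nbr → IsGoodMark Λ nbr τ mark rep →
      ((∃ j, ((absorb 0 (contract nbr mark rep (fun v => (Λ.grp v).getD 0) (2 ^ τ)))^[k ^ J]
        (j, false)).1 ≠ 0) ↔ ans = false)) :
    Triple (cycleRounds Λ A τ J d)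
      (HoldsState fun i => initState {e | e ∈ G.edgeSet ∧ P.edgeAt e = i})
      (fun c => (!((c i₀).1 0).1.1.flag) = ans)
      ((n * 2 : ℕ) * Real.exp (-(((2 : ℝ) ^ τ - L) / L)) + J * e) := by
  have : Nonempty (Fin L) := ⟨⟨0, hL⟩⟩
  have hnbr := isNbr_listTwo hdeg
  have hp := hnbr.isPorts
  set nbr := fun v => listTwo (G.neighborSet v)
  have t1 := triple_loadRounds (N := N) (W := W) (Ω := (Fin A.coins → Bool) × (Fin K → Fin L))
    Λ.addr_inj Λ.half_le hdeg P
  have t2 := triple_markRound (W := W) (Ω₁ := Fin A.coins → Bool) Λ hL (hwin nbr hnbr)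
  have hJ : 0 ≤ J * e := by positivity
  -- The marks are known only after a random round, so the later stages are analysed for every fixed
  -- good choice.
  have rest := fun mark rep (hm : IsGoodMark Λ nbr τ mark rep) => by
    have t3 := triple_exchangeRounds (W := W) (Ω := (Fin A.coins → Bool) × (Fin K → Fin L))
      Λ hp mark
    have t4 := triple_doubling_iterate (W := W) (Ω := (Fin A.coins → Bool) × (Fin K → Fin L))
      Λ hp mark τ
    have t5 := triple_contractRound (W := W) (Ω := (Fin A.coins → Bool) × (Fin K → Fin L)) Λ hm
    have t6 := triple_power_iterate (Ω₂ := Fin K → Fin L) Λ A hD he hA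
      (absorb 0 (contract nbr mark rep (fun v => (Λ.grp v).getD 0) (2 ^ τ))) J
    have t7 := triple_flagRound (W := W) (Ω := (Fin A.coins → Bool) × (Fin K → Fin L)) Λ
      (absorb 0 (contract nbr mark rep (fun v => (Λ.grp v).getD 0) (2 ^ τ)))^[k ^ J]
    have t8 := triple_collectRounds (n := n) (W := W) (N := N) (S := S)
      (Ω := (Fin A.coins → Bool) × (Fin K → Fin L)) (fun i => ∃ j,
        (Λ.addr (Λ.home j)).1 = i ∧ (((absorb 0 (contract nbr mark rep
          (fun v => (Λ.grp v).getD 0) (2 ^ τ)))^[k ^ J]) (j, false)).1 ≠ 0) d i₀ (by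
            rintro _ ⟨j, rfl, -⟩
            exact hi₀ _)
    have t := t3.append (t4.append (t5.append (t6.append (t7.append t8 le_rfl le_rfl) hJ
      (by norm_num)) le_rfl (by linarith)) le_rfl (by linarith)) le_rfl (by linarith)
    exact t.weaken (e' := J * e) (Pre' := Sat Λ.addr fun x => ∀ v, (x v).nbr = nbr v ∧
      (x v).mark = mark v) (Post' := fun c => (!((c i₀).1 0).1.1.flag) = ans) (fun _ h => h) (by
        intro c hc
        have h1 := hans nbr mark rep hnbr hm
        have h2 : ((c i₀).1 0).1.1.flag = true ↔ ans = false := by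
          rw [hc, ← h1]
          exact ⟨fun ⟨_, j, _, h⟩ => ⟨j, h⟩, fun ⟨j, h⟩ => ⟨_, j, rfl, h⟩⟩
        cases ans <;> simpa using h2) (by linarith)
  have t := t1.append (t2.append (Post := fun c => (!((c i₀).1 0).1.1.flag) = ans)
    (fun c ⟨mark, rep, hm, hc⟩ => rest mark rep hm c hc) (by positivity) hJ)
      le_rfl (by positivity)
  exact t.weaken (fun _ h => h) (fun _ h => h) (by linarith)

end Answer

end MPC

namespace MPC

/-! ### Cutting the vertices into blocks -/

lemma ncard_le_of_maps {α : Type*} [Finite α] {A : Set α} (f : α → ℕ) (F : Finset ℕ)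
    (hf : ∀ a ∈ A, f a ∈ F) (hinj : Set.InjOn f A) : A.ncard ≤ F.card := by
  rw [← Set.ncard_coe_finset]
  exact Set.ncard_le_ncard_of_injOn f hf hinj (Finset.finite_toSet F)

/-- Vertex `v` goes to machine `v / (K * L)` and block `v / L`; an incomplete last block becomes the
tail. The first `4 * ((k + 1) * B)` vertices of each block name its query nodes: two ports, `k + 1`
layers, `B` bits and two copies. -/
lemma exists_layout {n S M K L k B : ℕ} (hK : 0 < K) (hL : 0 < L) (hL2 : 2 ∣ L)
    (hM : n ≤ M * (K * L)) (hS : K * L + K * (4 * ((k + 1) * B)) ≤ S)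
    (hkB : 4 * ((k + 1) * B) ≤ L) (hB : 2 * n ≤ 2 ^ B) :
    ∃ Λ : Layout n S M K L (n / L) k B, ∀ v, ((Λ.addr v).1 : ℕ) = v / (K * L) := by
  have hKL : 0 < K * L := Nat.mul_pos hK hL
  have hKLS : K * L ≤ S := by omega
  have e : (Bool × Fin (k + 1) × Fin B × Bool) ≃ Fin (4 * ((k + 1) * B)) :=
    Fintype.equivFinOfCardEq (by simp; ring)
  obtain ⟨bits⟩ : Nonempty ((Fin (n / L) × Bool) ↪ (Fin B → Bool)) := by
    apply Function.Embedding.nonempty_of_card_le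
    simp only [Fintype.card_prod, Fintype.card_fin, Fintype.card_bool, Fintype.card_fun]
    have := Nat.div_le_self n L
    omega
  have hmul : ∀ j : Fin (n / L), j * L + L ≤ n := fun j => by
    have h1 : (j + 1) * L ≤ n / L * L := Nat.mul_le_mul_right _ j.2
    have h2 := Nat.div_mul_le_self n L
    nlinarith
  have hdivKL : ∀ v : ℕ, v / (K * L) = v / L / K := fun v => by
    rw [Nat.div_div_eq_div_mul, mul_comm]
  have hsplit : ∀ {u v : ℕ}, u / (K * L) = v / (K * L) → u / L % K = v / L % K → u % L = v % L →
      u = v := by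
    intro u v h1 h2 h3
    rw [hdivKL, hdivKL] at h1
    have h4 : u / L = v / L := by
      rw [← Nat.div_add_mod (u / L) K, ← Nat.div_add_mod (v / L) K, h1, h2]
    rw [← Nat.div_add_mod u L, ← Nat.div_add_mod v L, h4, h3]
  let addr : Fin n → Fin M × Fin S := fun v =>
    (⟨v / (K * L), Nat.div_lt_of_lt_mul (by rw [mul_comm]; exact v.2.trans_le hM)⟩,
      ⟨v % (K * L), (Nat.mod_lt _ hKL).trans_le hKLS⟩)
  let grp : Fin n → Option (Fin (n / L)) := fun v =>
    if h : v / L < n / L then some ⟨v / L, h⟩ else none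
  have grp_iff : ∀ v j, grp v = some j ↔ (v : ℕ) / L = j := by
    intro v j
    simp only [grp]
    split_ifs with h
    · simp [Fin.ext_iff]
    · simp only [false_iff]
      intro h'
      exact h (h' ▸ j.2)
  have haddr : ∀ (v : Fin n) i, (addr v).1 = i ↔ (v : ℕ) / (K * L) = i := fun v i => by
    simp [addr, Fin.ext_iff]
  have hmod : ∀ {u v : Fin n} {i}, (addr u).1 = i → (addr v).1 = i →
      (u : ℕ) % (K * L) = v % (K * L) → u = v := by
    intro u v i hu hv h
    rw [haddr] at hu hv
    rw [Fin.ext_iff, ← Nat.div_add_mod u (K * L), ← Nat.div_add_mod v (K * L), hu, hv, h]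
  let nm : QueryNode (Fin (n / L) × Bool) k B → Fin n := fun a =>
    ⟨a.1.1 * L + e (a.1.2, a.2), by
      have := hmul a.1.1
      have := (e (a.1.2, a.2)).2
      omega⟩
  have hnm_mod : ∀ a, (nm a : ℕ) % L = e (a.1.2, a.2) := fun a => by
    simp only [nm]
    rw [mul_comm, Nat.mul_add_mod, Nat.mod_eq_of_lt ((e (a.1.2, a.2)).2.trans_le hkB)]
  have hnm_div : ∀ a, (nm a : ℕ) / L = a.1.1 := fun a => by
    simp only [nm]
    rw [mul_comm, Nat.mul_add_div hL, Nat.div_eq_of_lt ((e (a.1.2, a.2)).2.trans_le hkB), add_zero]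
  have hcard : ∀ i, {v | (addr v).1 = i}.ncard ≤ K * L := fun i => by
    have := ncard_le_of_maps (A := {v | (addr v).1 = i}) (fun v => (v : ℕ) % (K * L))
      (Finset.range (K * L)) (fun v _ => Finset.mem_range.2 (Nat.mod_lt _ hKL))
      (fun u hu v hv h => hmod hu hv h)
    simpa using this
  refine ⟨{ addr := addr, half := fun v => decide ((v : ℕ) % (K * L) < K * L / 2),
            pos := fun v => (⟨v / L % K, Nat.mod_lt _ hK⟩, ⟨v % L, Nat.mod_lt _ hL⟩),
            grp := grp, home := fun j => ⟨j * L, by have := hmul j; omega⟩, nm := nm,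
            bits := bits, bits_inj := bits.injective, addr_inj := ?_, half_le := ?_, pos_inj := ?_,
            grp_home := ?_, machine_eq := ?_, pos_eq := ?_, exists_pos := ?_, tail_le := ?_,
            nm_inj := ?_, grp_nm := ?_, cap := ?_ }, fun v => rfl⟩
  · intro u v h
    exact hmod rfl (congrArg Prod.fst h.symm) (congrArg (fun p => (p.2 : ℕ)) h)
  · intro i h
    -- As `L` is even, the halves of a full machine have exactly `K * L / 2` vertices, and twice
    -- that is at most `S`.
    obtain ⟨c, hc⟩ : 2 ∣ K * L := hL2.mul_left K
    have hc' : K * L / 2 = c := by omega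
    have := ncard_le_of_maps
      (A := {v | (addr v).1 = i ∧ decide ((v : ℕ) % (K * L) < K * L / 2) = h})
      (fun v => (v : ℕ) % (K * L)) (if h then Finset.range c else Finset.Ico c (K * L)) (by
        rintro v ⟨-, rfl⟩
        have := Nat.mod_lt v hKL
        rw [hc']
        by_cases h1 : (v : ℕ) % (K * L) < c
        · simp [h1]
        · simp [h1, this, not_lt.1 h1]) (fun u hu v hv h => hmod hu.1 hv.1 h)
    have h2 : (if h then Finset.range c else Finset.Ico c (K * L)).card = c := by
      split_ifs <;> simp; omega
    omega
  · intro u v h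
    simp only [Prod.mk.injEq, Fin.ext_iff] at h
    exact Fin.ext (hsplit h.1.1 h.1.2 h.2)
  · intro j
    rw [grp_iff]
    exact Nat.mul_div_cancel _ hL
  · intro u v j hu hv
    rw [grp_iff] at hu hv
    rw [haddr]
    simp only [addr, hdivKL, hu, hv]
  · intro u v j hu hv
    rw [grp_iff] at hu hv
    simp only [hu, hv]
  · intro j r
    refine ⟨⟨j * L + r, by have := hmul j; have := r.2; omega⟩, ?_, ?_⟩
    · rw [grp_iff]
      change (j * L + r : ℕ) / L = j
      rw [mul_comm, Nat.mul_add_div hL, Nat.div_eq_of_lt r.2, add_zero]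
    · apply Fin.ext
      change (j * L + r : ℕ) % L = r
      rw [mul_comm, Nat.mul_add_mod, Nat.mod_eq_of_lt r.2]
  · have := ncard_le_of_maps (A := {v | grp v = none}) (fun v => (v : ℕ) % L)
      (Finset.range L) (fun v _ => Finset.mem_range.2 (Nat.mod_lt _ hL)) (by
        have key : ∀ v : Fin n, grp v = none → (v : ℕ) / L = n / L := by
          intro v hv
          have h1 : ¬ (v : ℕ) / L < n / L := fun h => by simp [grp, h] at hv
          have := Nat.div_le_div_right (c := L) v.2.le
          omega
        intro u hu v hv (h : (u : ℕ) % L = v % L)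
        rw [Fin.ext_iff, ← Nat.div_add_mod u L, ← Nat.div_add_mod v L, key u hu, key v hv, h])
    simpa using this
  · intro a b h
    have h1 := hnm_div a
    have h2 := hnm_mod a
    rw [h, hnm_div] at h1
    rw [h, hnm_mod] at h2
    have h3 := e.injective (Fin.ext h2.symm)
    simp only [Prod.mk.injEq] at h3
    exact Prod.ext (Prod.ext (Fin.ext h1.symm) h3.1) h3.2
  · intro a
    rw [grp_iff, hnm_div]
  · intro i
    -- Nodes on a machine are numbered by the index of the block among `K` and the offset in the
    -- block.
    have := ncard_le_of_maps (A := {v | (addr v).1 = i ∧ v ∈ Set.range nm})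
      (fun v => (v / L % K) * (4 * ((k + 1) * B)) + (v : ℕ) % L)
      (Finset.range (K * (4 * ((k + 1) * B)))) (by
        rintro _ ⟨-, a, rfl⟩
        rw [Finset.mem_range, hnm_mod]
        have h1 := (e (a.1.2, a.2)).2
        have h2 : (nm a / L % K + 1) * (4 * ((k + 1) * B)) ≤ K * (4 * ((k + 1) * B)) :=
          Nat.mul_le_mul_right _ (Nat.mod_lt _ hK)
        rw [add_mul] at h2
        omega) (by
        rintro _ ⟨hu, a, rfl⟩ _ ⟨hv, b, rfl⟩ h
        simp only [hnm_mod] at h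
        rw [haddr] at hu hv
        have ha := (e (a.1.2, a.2)).2
        have hb := (e (b.1.2, b.2)).2
        have h1 := congrArg (· / (4 * ((k + 1) * B))) h
        have h2 := congrArg (· % (4 * ((k + 1) * B))) h
        have hpos : 0 < 4 * ((k + 1) * B) := by omega
        simp only [mul_comm _ (4 * ((k + 1) * B)), Nat.mul_add_div hpos, Nat.mul_add_mod,
          Nat.div_eq_of_lt ha, Nat.div_eq_of_lt hb, Nat.mod_eq_of_lt ha, Nat.mod_eq_of_lt hb,
          add_zero] at h1 h2
        exact Fin.ext (hsplit (hu.trans hv.symm) h1 (by rw [hnm_mod, hnm_mod, h2])))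
    rw [Finset.card_range] at this
    have := hcard i
    omega

end MPC

namespace MPC

/-! ### Where the contracted walk ends on one cycle and on two. -/

section Cycles

variable {n S M K L N k B τ : ℕ} [NeZero N] {Λ : Layout n S M K L N k B}
  {G : SimpleGraph (Fin n)} {nbr : Fin n → Bool → Fin n} {mark : Fin n → Bool} {rep : Fin N → Fin n}

lemma IsGoodMark.rep_getD (h : IsGoodMark Λ nbr τ mark rep) (v : Fin n) (hv : mark v = true) :
    rep ((Λ.grp v).getD 0) = v := by
  obtain ⟨j, h1, h2⟩ := h.rep_grp v hv
  simp [h1, h2]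

lemma IsGoodMark.absorb_eq_zero (h : IsGoodMark Λ nbr τ mark rep) (hnbr : IsNbr G nbr)
    [NeZero n] {ι : ZMod n → Fin n} (hι : IsCycleComponent G n ι) (hcov : ∀ v, v ∈ Set.range ι)
    {m : ℕ} (hm : n ≤ m) (e : Fin N × Bool) :
    ((absorb 0 (contract nbr mark rep (fun v => (Λ.grp v).getD 0) (2 ^ τ)))^[m] e).1 = 0 := by
  obtain ⟨i, hi, h1⟩ := hι.exists_iterate_turn_eq hnbr (d := (rep e.1, e.2)) (hcov _) (hcov (rep 0))
  exact absorb_contract_reaches h.rep_getD h.hits (fun j => by simp [h.grp_rep]) h.mark_rep 0 i e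
    h1 (hi.trans hm)

lemma IsGoodMark.exists_absorb_ne_zero (h : IsGoodMark Λ nbr τ mark rep) {C : Set (Fin n)}
    (hC : ∀ d : Fin n × Bool, d.1 ∈ C → (turn nbr d).1 ∈ C) (hne : C.Nonempty) (h0 : rep 0 ∉ C)
    (m : ℕ) : ∃ j, ((absorb 0 (contract nbr mark rep (fun v => (Λ.grp v).getD 0) (2 ^ τ)))^[m]
      (j, false)).1 ≠ 0 := by
  -- The first mark met from any vertex of `C` stays in `C`; its group starts in `C` and cannot
  -- reach `rep 0`.
  obtain ⟨v, hv⟩ := hne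
  obtain ⟨d, hd⟩ := Option.ne_none_iff_exists'.1 (h.hits (v, false))
  obtain ⟨i, -, h1, h2, -⟩ := firstMark_eq_some hd
  have hdC : d.1 ∈ C := by
    rw [h1]
    clear h1
    induction i with
    | zero => exact hv
    | succ i ih => rw [Function.iterate_succ_apply']; exact hC _ ih
  obtain ⟨j, -, hj⟩ := h.rep_grp d.1 h2
  refine ⟨j, fun h3 => h0 ?_⟩
  rw [← h3]
  exact absorb_contract_mem h.rep_getD h.hits hC 0 (j, false) (hj ▸ hdC) m

lemma IsCycleComponent.exists_adj_iff {m : ℕ} {ι : ZMod m → Fin n} (hι : IsCycleComponent G m ι)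
    (hm : 3 ≤ m) {v : Fin n} (hv : v ∈ Set.range ι) :
    ∃ p q, p ≠ q ∧ ∀ x, G.Adj v x ↔ x = p ∨ x = q := by
  obtain ⟨z, rfl⟩ := hv
  exact ⟨_, _, hι.ne hm z, hι.adj z⟩

end Cycles

/-! ### Encoding by words -/

/-- The exponent `31` is `19` for the state of a vertex and `6 + 6` for the buffer; the factor `n ^
w` is the word of the called algorithm. -/
lemma nonempty_embedding_vstate {n N : ℕ} (hn : 3 ≤ n) (hN : N ≤ n) (w : ℕ) :
    Nonempty (((VState n N × (Option (Msg n) × Option (Msg n))) × Fin (n ^ w)) ↪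
      Fin (n ^ (w + 31))) := by
  let X := Option (Fin n × Fin n) × (Bool → Fin n) × Bool × (Bool → Fin n × Bool) ×
    (Bool → Option (Fin n × Bool)) × (Bool → Fin N × Bool) × Bool
  let f : (VState n N × (Option (Msg n) × Option (Msg n))) × Fin (n ^ w) →
      (X × (Option (Msg n) × Option (Msg n))) × Fin (n ^ w) := fun q =>
    (((q.1.1.edge, q.1.1.nbr, q.1.1.mark, q.1.1.ptr, q.1.1.hit, q.1.1.elf, q.1.1.flag), q.1.2),
      q.2)
  have hf : Function.Injective f := by
    rintro ⟨⟨⟨_, _, _, _, _, _, _⟩, _⟩, _⟩ ⟨⟨⟨_, _, _, _, _, _, _⟩, _⟩, _⟩ h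
    simp only [f, Prod.mk.injEq] at h
    obtain ⟨⟨⟨rfl, rfl, rfl, rfl, rfl, rfl, rfl⟩, rfl⟩, rfl⟩ := h
    rfl
  obtain ⟨g⟩ : Nonempty ((X × (Option (Msg n) × Option (Msg n))) × Fin (n ^ w) ↪
      Fin (n ^ (w + 31))) := by
    apply Function.Embedding.nonempty_of_card_le
    simp only [X, Fintype.card_prod, Fintype.card_option, Fintype.card_fin, Fintype.card_bool,
      Fintype.card_fun]
    have h1 : n * n + 1 ≤ n ^ 3 := by nlinarith [sq_nonneg n]
    have h2 : 2 ≤ n := by omega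
    have h3 : n * 2 ≤ n ^ 2 := by nlinarith
    have h4 : n * 2 + 1 ≤ n ^ 2 := by nlinarith
    have h5 : N * 2 ≤ n ^ 2 := by nlinarith
    have h6 : 2 * (n * 2 * (n * 2 + 1)) ≤ n ^ 5 := by
      calc 2 * (n * 2 * (n * 2 + 1)) ≤ n * (n ^ 2 * n ^ 2) := by gcongr
        _ = n ^ 5 := by ring
    have h7 : 2 * (n * 2 * (n * 2 + 1)) + 1 ≤ n ^ 6 := by
      have : 1 ≤ n ^ 5 := Nat.one_le_pow _ _ (by omega)
      calc _ ≤ n ^ 5 * 2 := by omega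
        _ ≤ n ^ 5 * n := by gcongr
        _ = n ^ 6 := by ring
    calc _ ≤ ((n ^ 3 * (n ^ 2 * (n * ((n ^ 2) ^ 2 * ((n ^ 2) ^ 2 * ((n ^ 2) ^ 2 * n)))))) *
          (n ^ 6 * n ^ 6)) * n ^ w := by gcongr
      _ = n ^ (w + 31) := by ring
  exact ⟨⟨_, g.injective.comp hf⟩⟩

lemma nonempty_embedding_msg {n : ℕ} (hn : 3 ≤ n) (w : ℕ) :
    Nonempty ((Fin n × Msg n) ⊕ Fin (n ^ w) ↪ Fin (n ^ (w + 31))) := by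
  apply Function.Embedding.nonempty_of_card_le
  simp only [Fintype.card_prod, Fintype.card_option, Fintype.card_fin, Fintype.card_bool,
    Fintype.card_sum]
  have h2 : 2 ≤ n := by omega
  have h3 : n * 2 ≤ n ^ 2 := by nlinarith
  have h4 : n * 2 + 1 ≤ n ^ 2 := by nlinarith
  calc _ ≤ n * (n * (n ^ 2 * n ^ 2)) + n ^ w := by gcongr
    _ = n ^ 6 + n ^ w := by ring
    _ ≤ n ^ (w + 6) + n ^ (w + 6) := by gcongr <;> omega
    _ = 2 * n ^ (w + 6) := by ring
    _ ≤ n * n ^ (w + 6) := by gcongr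
    _ = n ^ (w + 7) := by ring
    _ ≤ n ^ (w + 31) := by gcongr <;> omega

/-! ### The reduction for a fixed number of vertices -/

theorem solvesOneVsTwoCycles_of_solvesComponents {n S M w D T K ℓ k B τ J d : ℕ}
    (hcomp : SolvesComponents n n S M w D T) (hn : 6 ≤ n) (hK : 0 < K) (hℓ : 0 < ℓ)
    (hM : n ≤ M * (K * 2 ^ ℓ)) (hS : K * 2 ^ ℓ + K * (4 * ((k + 1) * B)) ≤ S)
    (hkB : 4 * ((k + 1) * B) ≤ 2 ^ ℓ) (hB : 2 * n ≤ 2 ^ B) (hℓn : 2 ^ ℓ ≤ n)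
    (hD : 2 * (k + 1) ≤ D) (hτ : 2 ^ τ ≤ n / 2) (hJ : n ≤ k ^ J) (hd : n ≤ S ^ d)
    (herr : (n * 2 : ℕ) * Real.exp (-(((2 : ℝ) ^ τ - 2 ^ ℓ) / 2 ^ ℓ)) + J * (1 / (n : ℝ) ^ 3) ≤
      1 / n) :
    SolvesOneVsTwoCycles n S M (w + 31) (22 + 9 * τ + J * (T + 2) + d) := by
  obtain ⟨A, hA⟩ := hcomp
  have hL : 0 < 2 ^ ℓ := by positivity
  have hN : 0 < n / 2 ^ ℓ := Nat.div_pos hℓn hL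
  have hM0 : 0 < M := Nat.pos_of_ne_zero (by rintro rfl; omega)
  have hS0 : 0 < S := by
    have := Nat.mul_pos hK hL
    omega
  have : NeZero n := ⟨by omega⟩
  have : NeZero (n / 2 ^ ℓ) := ⟨hN.ne'⟩
  have : NeZero S := ⟨hS0.ne'⟩
  obtain ⟨Λ, hΛ⟩ := exists_layout hK hL (dvd_pow_self 2 hℓ.ne') hM hS hkB hB
  obtain ⟨encQ⟩ := nonempty_embedding_vstate (n := n) (N := n / 2 ^ ℓ) (by omega)
    (Nat.div_le_self _ _) w
  obtain ⟨encR⟩ := nonempty_embedding_msg (n := n) (by omega) w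
  let w₀ : Fin (n ^ w) := ⟨0, by positivity⟩
  -- Since the block size is a power of two, `ℓ` fair coins give an exactly uniform member of a
  -- block.
  let coins : (Fin (A.coins + ℓ * K) → Bool) ≃ (Fin A.coins → Bool) × (Fin K → Fin (2 ^ ℓ)) :=
    Fintype.equivOfCardEq (by simp [pow_add, pow_mul])
  have : Nonempty ((VState n (n / 2 ^ ℓ) × (Option (Msg n) × Option (Msg n))) × Fin (n ^ w)) :=
    ⟨((default, (none, none)), w₀)⟩
  let i₀ : Fin M := ⟨0, hM0⟩
  obtain ⟨A', hA'⟩ := exists_algorithm encQ encQ.injective encR encR.injective coins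
    (fun _ _ Es s => ((initState Es s, (none, none)), w₀)) (cycleRounds Λ A τ J d)
    (length_cycleRounds Λ A τ J d) (fun _ m => !(m 0).1.1.flag)
  have hi₀ : ∀ v, (up S)^[d] (Λ.addr v).1 = i₀ := fun v => by
    apply Fin.ext
    rw [val_iterate_up, hΛ]
    exact Nat.div_eq_of_lt ((Nat.div_le_self _ _).trans_lt (v.2.trans_le hd))
  have key : ∀ (G : SimpleGraph (Fin n)) (P : Placement G S M) (ans : Bool),
      (∀ v, ∃ p q, p ≠ q ∧ ∀ x, G.Adj v x ↔ x = p ∨ x = q) →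
      (∀ nbr, IsNbr G nbr → ∀ d, Set.InjOn (fun i => ((turn nbr)^[i] d).1) (Set.Icc 1 (2 ^ τ))) →
      (∀ nbr mark rep, IsNbr G nbr → IsGoodMark Λ nbr τ mark rep →
      ((∃ j, ((absorb 0 (contract nbr mark rep (fun v => (Λ.grp v).getD 0) (2 ^ τ)))^[k ^ J]
        (j, false)).1 ≠ 0) ↔ ans = false)) →
      1 - 1 / (n : ℝ) ≤ A'.prob {ω | A'.WithinSpace P ω ∧ A'.result P ω i₀ = ans} := by
    intro G P ans h1 h2 h3
    rw [hA' G P i₀ (· = ans)]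
    have t := triple_cycleRounds Λ hL A hD (e := 1 / (n : ℝ) ^ 3) (by positivity) hA P h1 h2 i₀
      hi₀ ans h3
    refine le_trans ?_ (t _ ?_)
    · push_cast at herr ⊢
      linarith
    · intro i
      exact ⟨fun s => rfl, rfl⟩
  refine ⟨A', i₀, fun G P => ⟨fun hG => ?_, fun hG => ?_⟩⟩
  · obtain ⟨ι, hι, hcov⟩ := hG.exists_cycle (by omega)
    refine key G P true (fun v => hι.exists_adj_iff (by omega) (hcov v)) (fun nbr hnbr d => ?_) ?_
    -- Windows have at most `n / 2` vertices, so they do not wrap around either kind of cycle.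
    · exact (hι.injOn_iterate_turn hnbr (hcov _)).mono
        (Set.Icc_subset_Icc_right (hτ.trans (Nat.div_le_self _ _)))
    · intro nbr mark rep hnbr hm
      simp [hm.absorb_eq_zero hnbr hι hcov hJ]
  · obtain ⟨ι₁, ι₂, h1, h2, hcov, hdis⟩ := hG.exists_cycles hn
    refine key G P false (fun v => ?_) (fun nbr hnbr d => ?_) ?_
    · rcases hcov v with hv | hv
      · exact h1.exists_adj_iff (by omega) hv
      · exact h2.exists_adj_iff (by omega) hv
    · rcases hcov d.1 with hv | hv
      · exact (h1.injOn_iterate_turn hnbr hv).mono (Set.Icc_subset_Icc_right hτ)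
      · exact (h2.injOn_iterate_turn hnbr hv).mono (Set.Icc_subset_Icc_right (by omega))
    · intro nbr mark rep hnbr hm
      simp only [iff_true]
      by_cases h0 : rep 0 ∈ Set.range ι₁
      · exact hm.exists_absorb_ne_zero (fun d hd => h2.turn_mem hnbr hd) (Set.range_nonempty ι₂)
          (Set.disjoint_left.1 hdis h0) _
      · exact hm.exists_absorb_ne_zero (fun d hd => h1.turn_mem hnbr hd) (Set.range_nonempty ι₁)
          h0 _

end MPC

namespace MPC

/-! ### Choice of the parameters -/

/-- The number of rounds of the algorithm for cycles that calls algorithms with `T` rounds for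
components of diameter at most `D`. -/
def cycleTime (n D T d : ℕ) : ℕ :=
  22 + 9 * (2 * (4 * (Nat.log 2 (Nat.log 2 n) + 1))) + Nat.clog (D / 4) n * (T + 2) + d

/-- With `lam` about `log n`, the block size `2 ^ ℓ` lies between `(lam + 1) ^ 4` and `16 * lam ^
4`, which beats the number of query nodes of a block, of order `lam ^ 3`. Windows are the square of
the block size. Each machine takes about `S / 2` vertices, enough because `S * M ≥ 2 * n`, and the
rest of its space is left for the edges of the query graph. The bound `8 ≤ D` makes `k = D / 4` at
least `2`. -/
lemma solvesOneVsTwoCycles_cycleTime {n S M w D T d : ℕ} (hcomp : SolvesComponents n n S M w D T)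
    (h31 : 31 ≤ Nat.log 2 n) (hD8 : 8 ≤ D) (hD : (D : ℝ) ≤ Real.logb 2 n ^ (3 / 2 : ℝ))
    (hS : 64 * Nat.log 2 n ^ 4 ≤ S) (hn : 512 * Nat.log 2 n ^ 8 ≤ n) (hd : n ≤ S ^ d)
    (hM : n + n ≤ S * M) : SolvesOneVsTwoCycles n S M (w + 31) (cycleTime n D T d) := by
  set lam := Nat.log 2 n with hlam
  set ℓ := 4 * (Nat.log 2 lam + 1) with hℓ
  have hn0 : n ≠ 0 := by rintro rfl; simp [hlam] at h31
  have hlow : (lam + 1) ^ 4 ≤ 2 ^ ℓ := by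
    rw [hℓ, mul_comm, pow_mul]
    exact Nat.pow_le_pow_left (Nat.lt_pow_succ_log_self (by norm_num) lam) 4
  have hup : 2 ^ ℓ ≤ 16 * lam ^ 4 := by
    have h1 : 2 ^ Nat.log 2 lam ≤ lam := Nat.pow_log_le_self 2 (by omega)
    calc 2 ^ ℓ = (2 ^ Nat.log 2 lam * 2) ^ 4 := by rw [hℓ, mul_comm, pow_mul, pow_succ 2]
      _ ≤ (lam * 2) ^ 4 := by gcongr
      _ = 16 * lam ^ 4 := by ring
  have hnlt : n < 2 ^ (lam + 1) := Nat.lt_pow_succ_log_self (by norm_num) n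
  -- The exponent `3 / 2` is rounded up to `2`; this already fits the block size.
  have hD2 : D ≤ (lam + 1) ^ 2 := by
    have h1 : Real.logb 2 n ≤ (lam + 1 : ℕ) := by
      rw [Real.logb_le_iff_le_rpow (by norm_num) (by positivity), Real.rpow_natCast]
      exact_mod_cast hnlt.le
    have h0 : 0 ≤ Real.logb 2 n := Real.logb_nonneg (by norm_num) (by
      exact_mod_cast Nat.one_le_iff_ne_zero.2 hn0)
    have h2 : (D : ℝ) ≤ ((lam + 1 : ℕ) : ℝ) ^ (2 : ℝ) :=
      hD.trans ((Real.rpow_le_rpow h0 h1 (by norm_num)).trans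
        (Real.rpow_le_rpow_of_exponent_le (by push_cast; linarith) (by norm_num)))
    rw [Real.rpow_two] at h2
    exact_mod_cast h2
  -- Four times the number of query nodes: they occupy at most a quarter of a block, so that `K * 2
  -- ^ ℓ`, slightly above `S / 2` by rounding, plus a quarter of itself is still at most `S`.
  have hkB : 16 * ((D / 4 + 1) * (lam + 2)) ≤ 2 ^ ℓ := by
    have h1 : D / 4 + 1 ≤ (lam + 1) ^ 2 := by omega
    calc 16 * ((D / 4 + 1) * (lam + 2)) ≤ 16 * ((lam + 1) ^ 2 * (2 * (lam + 1))) := by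
          gcongr; omega
      _ = 32 * (lam + 1) ^ 3 := by ring
      _ ≤ (lam + 1) * (lam + 1) ^ 3 := by gcongr; omega
      _ = (lam + 1) ^ 4 := by ring
      _ ≤ 2 ^ ℓ := hlow
  have hL : 0 < 2 ^ ℓ := by positivity
  have hdiv := Nat.div_add_mod S (2 * 2 ^ ℓ)
  have hmod := Nat.mod_lt S (show 0 < 2 * 2 ^ ℓ by positivity)
  have hKlow : S ≤ 2 * ((S / (2 * 2 ^ ℓ) + 1) * 2 ^ ℓ) := by
    calc S ≤ 2 * 2 ^ ℓ * (S / (2 * 2 ^ ℓ)) + 2 * 2 ^ ℓ := by omega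
      _ = _ := by ring
  have hKup : 2 * ((S / (2 * 2 ^ ℓ) + 1) * 2 ^ ℓ) ≤ S + 2 * 2 ^ ℓ := by
    calc _ = 2 * 2 ^ ℓ * (S / (2 * 2 ^ ℓ)) + 2 * 2 ^ ℓ := by ring
      _ ≤ _ := by omega
  set K := S / (2 * 2 ^ ℓ) + 1 with hK
  have hn2 : 2 ^ (2 * ℓ) ≤ n / 2 := by
    rw [Nat.le_div_iff_mul_le (by norm_num), mul_comm 2 ℓ, pow_mul]
    calc (2 ^ ℓ) ^ 2 * 2 ≤ (16 * lam ^ 4) ^ 2 * 2 := by gcongr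
      _ = 512 * lam ^ 8 := by ring
      _ ≤ n := hn
  have hℓn : 2 ^ ℓ ≤ 2 ^ (2 * ℓ) := Nat.pow_le_pow_right (by norm_num) (by omega)
  have h6 : 6 ≤ n := by
    have : 1 ≤ lam ^ 8 := Nat.one_le_pow _ _ (by omega)
    omega
  refine solvesOneVsTwoCycles_of_solvesComponents (K := K) (ℓ := ℓ) (k := D / 4) (B := lam + 2)
    (J := Nat.clog (D / 4) n) (τ := 2 * ℓ) hcomp h6 (Nat.succ_pos _) (by omega) ?_ ?_ (by omega) ?_
    (by omega) (by omega) hn2 (Nat.le_pow_clog (by omega) n) hd ?_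
  · have h1 : S * M ≤ 2 * (K * 2 ^ ℓ) * M := Nat.mul_le_mul_right _ hKlow
    have h2 : 2 * (K * 2 ^ ℓ) * M = 2 * (M * (K * 2 ^ ℓ)) := by ring
    omega
  · have h1 : K * (16 * ((D / 4 + 1) * (lam + 2))) ≤ K * 2 ^ ℓ := Nat.mul_le_mul_left _ hkB
    have h2 : K * (16 * ((D / 4 + 1) * (lam + 2))) =
      4 * (K * (4 * ((D / 4 + 1) * (lam + 2)))) := by ring
    omega
  · calc 2 * n ≤ 2 * 2 ^ (lam + 1) := by omega
      _ = 2 ^ (lam + 2) := by ring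
  · have hnpos : (0 : ℝ) < n := by positivity
    have hexp : Real.exp (-(((2 : ℝ) ^ (2 * ℓ) - 2 ^ ℓ) / 2 ^ ℓ)) ≤ 1 / (4 * (n : ℝ) ^ 2) := by
      -- A window of `L ^ 2` vertices less the tail of `L`, divided by `L`, is `L - 1`, which
      -- exceeds `2 * log n` by far.
      have h1 : ((2 : ℝ) ^ (2 * ℓ) - 2 ^ ℓ) / 2 ^ ℓ = ((2 ^ ℓ - 1 : ℕ) : ℝ) := by
        rw [Nat.cast_sub hL, mul_comm 2 ℓ, pow_mul]
        push_cast
        field_simp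
      have h2 : 2 * (lam + 1) + 2 ≤ 2 ^ ℓ - 1 := by
        have : 32 * 32 ^ 2 * (lam + 1) ≤ (lam + 1) ^ 4 := by
          calc 32 * 32 ^ 2 * (lam + 1) ≤ (lam + 1) * (lam + 1) ^ 2 * (lam + 1) := by
                gcongr <;> omega
            _ = _ := by ring
        omega
      have h3 : 4 * (n : ℝ) ^ 2 ≤ Real.exp ((2 ^ ℓ - 1 : ℕ) : ℝ) := by
        calc 4 * (n : ℝ) ^ 2 ≤ 4 * ((2 : ℝ) ^ (lam + 1)) ^ 2 := by
              gcongr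
              exact_mod_cast hnlt.le
          _ = (2 : ℝ) ^ (2 * (lam + 1) + 2) := by ring
          _ ≤ (2 : ℝ) ^ (2 ^ ℓ - 1) := pow_le_pow_right₀ (by norm_num) h2
          _ ≤ Real.exp 1 ^ (2 ^ ℓ - 1) := by
              gcongr
              linarith [Real.add_one_le_exp 1]
          _ = _ := by rw [← Real.exp_nat_mul, mul_one]
      rw [h1, Real.exp_neg, one_div]
      gcongr
    have hJ : (Nat.clog (D / 4) n : ℝ) ≤ (n : ℝ) := by
      exact_mod_cast (Nat.clog_anti_left (by norm_num) (show 2 ≤ D / 4 by omega)).trans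
        ((Nat.clog_le_iff_le_pow (by norm_num)).2 Nat.lt_two_pow_self.le)
    have hn2' : (2 : ℝ) ≤ n := by exact_mod_cast (by omega : 2 ≤ n)
    -- Missing a window costs at most `1 / (2 * n)`, and the at most `n` calls cost at most `1 / n ^
    -- 2`.
    calc _ ≤ (n * 2 : ℕ) * (1 / (4 * (n : ℝ) ^ 2)) + n * (1 / (n : ℝ) ^ 3) := by gcongr
      _ = 1 / n * (1 / 2 + 1 / n) := by push_cast; field_simp; ring
      _ ≤ 1 / n * (1 / 2 + 1 / 2) := by gcongr
      _ = 1 / n := by ring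

/-! ### Asymptotics -/

lemma isBigO_natLog : (fun n : ℕ => (Nat.log 2 n : ℝ)) =O[atTop] fun n : ℕ => Real.log n := by
  refine IsBigO.of_bound (1 / Real.log 2) (Eventually.of_forall fun n => ?_)
  have h2 : 0 < Real.log 2 := Real.log_pos (by norm_num)
  rw [Real.norm_of_nonneg (by positivity), Real.norm_of_nonneg (Real.log_natCast_nonneg n)]
  have := Real.natLog_le_logb n 2
  rw [Real.logb] at this
  rw [one_div_mul_eq_div]
  exact_mod_cast this

lemma tendsto_natLog : Tendsto (fun n : ℕ => Nat.log 2 n) atTop atTop := by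
  refine tendsto_atTop_atTop.2 fun b => ⟨2 ^ b, fun n hn => ?_⟩
  exact Nat.le_log_of_pow_le (by norm_num) hn

lemma tendsto_log_natCast : Tendsto (fun n : ℕ => Real.log n) atTop atTop :=
  Real.tendsto_log_atTop.comp tendsto_natCast_atTop_atTop

lemma isLittleO_natLog_natLog :
    (fun n : ℕ => (Nat.log 2 (Nat.log 2 n) : ℝ)) =o[atTop] fun n : ℕ => Real.log n := by
  have h1 := isBigO_natLog.comp_tendsto tendsto_natLog
  have h2 : (fun m : ℕ => Real.log m) =o[atTop] fun m : ℕ => (m : ℝ) :=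
    Real.isLittleO_log_id_atTop.comp_tendsto tendsto_natCast_atTop_atTop
  exact (h1.trans_isLittleO (h2.comp_tendsto tendsto_natLog)).trans_isBigO isBigO_natLog

lemma eventually_natLog_pow_le {ε : ℝ} (hε : 0 < ε) (c : ℝ) (q : ℕ) :
    ∀ᶠ n : ℕ in atTop, c * (Nat.log 2 n : ℝ) ^ q ≤ (n : ℝ) ^ ε := by
  have h1 : (fun n : ℕ => (Nat.log 2 n : ℝ) ^ q) =o[atTop] fun n : ℕ => (n : ℝ) ^ ε := by
    refine (isBigO_natLog.pow q).trans_isLittleO ?_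
    have := (isLittleO_log_rpow_rpow_atTop (q : ℝ) hε).comp_tendsto tendsto_natCast_atTop_atTop
    simpa [Function.comp_def] using this
  filter_upwards [(h1.const_mul_left c).bound one_pos] with n hn
  rw [one_mul, Real.norm_of_nonneg (by positivity : (0 : ℝ) ≤ (n : ℝ) ^ ε)] at hn
  exact (le_abs_self _).trans hn

/-- The number of calls times `log D` is at most `3 * log n`, so the calls take `O(T * log n / log
D)` rounds; all else is `O(log log n)`. A general filter `l` covers both all large `n` and an
infinite subset. -/
lemma isLittleO_cycleTime {l : Filter ℕ} (hl : l ≤ atTop) {D T : ℕ → ℕ} (d : ℕ)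
    (hD : ∀ᶠ n in l, D n ≤ n) (hT : ∀ n, 1 ≤ T n)
    (h : (fun n => (T n : ℝ)) =o[l] fun n => Real.log (D n)) :
    (fun n => (cycleTime n (D n) (T n) d : ℝ)) =o[l] fun n => Real.log n := by
  have hconst : ∀ c : ℝ, (fun _ : ℕ => c) =o[l] fun n : ℕ => Real.log n := fun c =>
    (isLittleO_const_left.2 (Or.inr (tendsto_norm_atTop_atTop.comp tendsto_log_natCast))).mono hl
  have hlog := isLittleO_natLog_natLog.mono hl
  have hmain : (fun n => (Nat.clog (D n / 4) n * (T n + 2) : ℝ)) =o[l] fun n => Real.log n := by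
    refine IsLittleO.of_bound fun c hc => ?_
    -- Since `T ≥ 1`, the relation `T = o(log D)` makes `D` exceed any constant. From `64` on, `D ≤
    -- (D / 4) ^ 2` despite the rounding.
    have hbig : ∀ᶠ n in l, (64 : ℝ) ≤ D n := by
      filter_upwards [h.bound (c := 1 / Real.log 64) (by
        have := Real.log_pos (show (1 : ℝ) < 64 by norm_num)
        positivity)] with n hn
      rw [Real.norm_of_nonneg (by positivity), Real.norm_of_nonneg (Real.log_natCast_nonneg _),
        one_div_mul_eq_div, le_div_iff₀ (Real.log_pos (by norm_num))] at hn
      have h1 : (1 : ℝ) ≤ T n := by exact_mod_cast hT n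
      have h2 : Real.log 64 ≤ Real.log (D n) := by
        have := Real.log_pos (show (1 : ℝ) < 64 by norm_num)
        nlinarith
      have h3 : (D n : ℝ) ≠ 0 := by
        intro h3
        rw [h3, Real.log_zero] at h2
        linarith [Real.log_pos (show (1 : ℝ) < 64 by norm_num)]
      exact (Real.log_le_log_iff (by norm_num) (by positivity)).1 h2
    filter_upwards [hbig, hD, h.bound (c := c / 9) (by positivity)] with n h64 hDn hTn
    rw [Real.norm_of_nonneg (by positivity), Real.norm_of_nonneg (Real.log_natCast_nonneg _)] at hTn
    rw [Real.norm_of_nonneg (by positivity), Real.norm_of_nonneg (Real.log_natCast_nonneg _)]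
    have hDn' : (D n : ℝ) ≤ n := by exact_mod_cast hDn
    have hT1 : (1 : ℝ) ≤ T n := by exact_mod_cast hT n
    have hDpos : 0 < Real.log (D n) := Real.log_pos (by linarith)
    have hle : Real.log (D n) ≤ Real.log n := Real.log_le_log (by linarith) hDn'
    have hk : (D n : ℝ) ≤ ((D n / 4 : ℕ) : ℝ) ^ 2 := by
      have h1 : 64 ≤ D n := by exact_mod_cast h64
      have h2 : D n ≤ 8 * (D n / 4) := by omega
      have h3 : 8 ≤ D n / 4 := by omega
      have : D n ≤ (D n / 4) ^ 2 := by nlinarith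
      exact_mod_cast this
    have hlogk : Real.log (D n) ≤ 2 * Real.log (D n / 4 : ℕ) := by
      have := Real.log_le_log (by linarith) hk
      rwa [Real.log_pow] at this
    have hclog : (Nat.clog (D n / 4) n : ℝ) ≤ Real.log n / Real.log (D n / 4 : ℕ) + 1 := by
      rw [← Real.natCeil_logb_natCast]
      exact (Nat.ceil_lt_add_one (div_nonneg (Real.log_natCast_nonneg _)
        (Real.log_natCast_nonneg _))).le
    have hclog2 : (Nat.clog (D n / 4) n : ℝ) * Real.log (D n) ≤ 3 * Real.log n := by
      have h0 : 0 < Real.log (D n / 4 : ℕ) := by linarith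
      calc _ ≤ (Real.log n / Real.log (D n / 4 : ℕ) + 1) * Real.log (D n) := by gcongr
        _ = Real.log n / Real.log (D n / 4 : ℕ) * Real.log (D n) + Real.log (D n) := by ring
        _ ≤ Real.log n / Real.log (D n / 4 : ℕ) * (2 * Real.log (D n / 4 : ℕ)) + Real.log n := by
            gcongr
        _ = 3 * Real.log n := by field_simp; ring
    -- Here `T + 2 ≤ 3 * T`; with the bound `3 * log n` this explains the choice of `c / 9`.
    calc (Nat.clog (D n / 4) n : ℝ) * (T n + 2) ≤ Nat.clog (D n / 4) n * (3 * T n) := by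
          gcongr; linarith
      _ ≤ Nat.clog (D n / 4) n * (3 * (c / 9 * Real.log (D n))) := by gcongr
      _ = c / 3 * (Nat.clog (D n / 4) n * Real.log (D n)) := by ring
      _ ≤ c / 3 * (3 * Real.log n) := by gcongr
      _ = c * Real.log n := by ring
  -- `94 = 22 + 72`, where `72 = 9 * 2 * 4` is also the factor of `log log n`.
  have := (((hconst 94).add (hlog.const_mul_left 72)).add hmain).add (hconst d)
  refine this.congr_left fun n => ?_
  simp only [cycleTime]
  push_cast
  ring

/-! ### The reduction for all large numbers of vertices. -/

section Main

variable {S : ℕ → ℕ} {M : ℕ → ℕ → ℕ} {w : ℕ} {D T : ℕ → ℕ}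

lemma eventually_le_self
    (hD : ∀ᶠ n : ℕ in atTop, (D n : ℝ) ≤ Real.logb 2 n ^ (3 / 2 : ℝ)) :
    ∀ᶠ n : ℕ in atTop, D n ≤ n := by
  have h1 := ((isLittleO_log_rpow_rpow_atTop (3 / 2 : ℝ) one_pos).comp_tendsto
    tendsto_natCast_atTop_atTop).const_mul_left ((Real.log 2)⁻¹ ^ (3 / 2 : ℝ))
  filter_upwards [hD, h1.bound one_pos] with n hn h2
  have h3 : Real.logb 2 n ^ (3 / 2 : ℝ) = (Real.log 2)⁻¹ ^ (3 / 2 : ℝ) *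
      Real.log n ^ (3 / 2 : ℝ) := by
    rw [← Real.mul_rpow (inv_nonneg.2 (Real.log_nonneg (by norm_num)))
      (Real.log_natCast_nonneg n), Real.logb, div_eq_inv_mul]
  simp only [Function.comp_apply, Real.rpow_one, one_mul, Real.norm_natCast] at h2
  rw [← h3] at h2
  exact_mod_cast hn.trans ((le_abs_self _).trans h2)

/-- The depth `⌈1 / ε⌉₊` of the collecting tree is independent of `n`. The condition on `D` stays
inside, since in the second claim it is known only along a subsequence. -/
lemma eventually_solvesOneVsTwoCycles
    (hSpoly : ∃ ε : ℝ, 0 < ε ∧ ∀ᶠ n : ℕ in atTop, (n : ℝ) ^ ε ≤ S n)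
    (hSG : ∀ᶠ n : ℕ in atTop, ∀ m, n + m ≤ S n * M n m)
    (hD : ∀ᶠ n : ℕ in atTop, (D n : ℝ) ≤ Real.logb 2 n ^ (3 / 2 : ℝ))
    (hALG : ∀ᶠ n : ℕ in atTop, ∀ m, SolvesComponents n m (S n) (M n m) w (D n) (T n)) :
    ∃ d, ∀ᶠ n : ℕ in atTop, 8 ≤ D n →
      SolvesOneVsTwoCycles n (S n) (M n n) (w + 31) (cycleTime n (D n) (T n) d) := by
  obtain ⟨ε, hε, hS⟩ := hSpoly
  refine ⟨⌈1 / ε⌉₊, ?_⟩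
  filter_upwards [hS, hSG, hD, hALG, eventually_natLog_pow_le hε 64 4,
    eventually_natLog_pow_le one_pos 512 8, tendsto_natLog.eventually_ge_atTop 31,
    eventually_ge_atTop 1] with n h1 h2 h3 h4 h5 h6 h7 h8 h9
  rw [Real.rpow_one] at h6
  refine solvesOneVsTwoCycles_cycleTime (h4 n) h7 h9 h3 ?_ (by exact_mod_cast h6) ?_ (h2 n)
  · exact_mod_cast h5.trans h1
  · have hn1 : (1 : ℝ) ≤ n := by exact_mod_cast h8
    have hS1 : (1 : ℝ) ≤ S n := (Real.one_le_rpow hn1 hε.le).trans h1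
    have : (n : ℝ) ≤ (S n : ℝ) ^ ⌈1 / ε⌉₊ := by
      calc (n : ℝ) = ((n : ℝ) ^ ε) ^ (1 / ε) := by
            rw [← Real.rpow_mul (by positivity), mul_one_div_cancel hε.ne', Real.rpow_one]
        _ ≤ (S n : ℝ) ^ (1 / ε) := by gcongr
        _ ≤ (S n : ℝ) ^ (⌈1 / ε⌉₊ : ℝ) :=
            Real.rpow_le_rpow_of_exponent_le hS1 (Nat.le_ceil _)
        _ = _ := Real.rpow_natCast _ _
    exact_mod_cast this

lemma le_of_three_le_log {m : ℕ} (h : 3 ≤ Real.log m) : 8 ≤ m := by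
  by_contra! h8
  have h0 : m ≠ 0 := by
    rintro rfl
    norm_num at h
  have h2 : Real.log m ≤ Real.log (2 ^ 3) := Real.log_le_log (by positivity) (by
    exact_mod_cast h8.le)
  rw [Real.log_pow] at h2
  push_cast at h2
  linarith [Real.log_two_lt_d9]

lemma eventually_le_of_isLittleO {l : Filter ℕ} (hT : ∀ n, 1 ≤ T n)
    (h : (fun n => (T n : ℝ)) =o[l] fun n => Real.log (D n)) : ∀ᶠ n in l, 8 ≤ D n := by
  filter_upwards [h.bound (c := 1 / 3) (by norm_num)] with n hn
  rw [Real.norm_of_nonneg (by positivity), Real.norm_of_nonneg (Real.log_natCast_nonneg _)] at hn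
  exact le_of_three_le_log (by
    have h1 : (1 : ℝ) ≤ T n := by exact_mod_cast hT n
    linarith)

end Main

end MPC

theorem mainTheorem2 (δ : ℝ) (hδ0 : 0 < δ) (hδ1 : δ < 1)
    (S : ℕ → ℕ) (M : ℕ → ℕ → ℕ) (w : ℕ) (D T : ℕ → ℕ)
    (hS : (fun n => (S n : ℝ)) =O[atTop] fun n => (n : ℝ) ^ δ)
    (hSpoly : ∃ ε : ℝ, 0 < ε ∧ ∀ᶠ n : ℕ in atTop, (n : ℝ) ^ ε ≤ S n)
    (hSG : ∀ᶠ n : ℕ in atTop, ∀ m, n + m ≤ S n * M n m)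
    (hD : ∀ᶠ n : ℕ in atTop, (D n : ℝ) ≤ Real.logb 2 n ^ (3 / 2 : ℝ))
    (hT : ∀ n, 1 ≤ T n)
    (hALG : ∀ᶠ n : ℕ in atTop, ∀ m, MPC.SolvesComponents n m (S n) (M n m) w (D n) (T n)) :
    ((fun n => (T n : ℝ)) =o[atTop] (fun n => Real.log (D n)) →
      ∃ (w' : ℕ) (T' : ℕ → ℕ),
        (fun n => (T' n : ℝ)) =o[atTop] (fun n => Real.log n) ∧
        ∀ᶠ n : ℕ in atTop, MPC.SolvesOneVsTwoCycles n (S n) (M n n) w' (T' n)) ∧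
    ((fun n => Real.log (D n)) =O[atTop] (fun n => (T n : ℝ)) ∨
      ∃ (I : Set ℕ) (w' : ℕ) (T' : ℕ → ℕ), I.Infinite ∧
        (fun n => (T' n : ℝ)) =o[atTop ⊓ 𝓟 I] (fun n => Real.log n) ∧
        ∀ n ∈ I, MPC.SolvesOneVsTwoCycles n (S n) (M n n) w' (T' n)) := by
  obtain ⟨d, hd⟩ := MPC.eventually_solvesOneVsTwoCycles hSpoly hSG hD hALG
  have hDn := MPC.eventually_le_self hD
  refine ⟨fun h => ⟨w + 31, fun n => MPC.cycleTime n (D n) (T n) d,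
    MPC.isLittleO_cycleTime le_rfl d hDn hT h, ?_⟩, ?_⟩
  · filter_upwards [hd, MPC.eventually_le_of_isLittleO hT h] with n h1 h2
    exact h1 h2
  · refine or_iff_not_imp_left.2 fun hO => ?_
    -- Every constant `j + 3` fails infinitely often as a bound for `log D` by `T`. The summand `3`
    -- forces `log D > 3`, hence `8 ≤ D`, already for `j = 0`.
    have hfreq : ∀ j : ℕ, ∃ᶠ n in atTop, (j + 3 : ℝ) * T n < Real.log (D n) ∧ (8 ≤ D n →
        MPC.SolvesOneVsTwoCycles n (S n) (M n n) (w + 31) (MPC.cycleTime n (D n) (T n) d)) := by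
      intro j
      refine Frequently.and_eventually (fun hev => hO ?_) hd
      refine IsBigO.of_bound (j + 3) (hev.mono fun n hn => ?_)
      rw [Real.norm_of_nonneg (Real.log_natCast_nonneg _), Real.norm_natCast]
      exact not_lt.1 hn
    obtain ⟨φ, hφ, hφ'⟩ := extraction_forall_of_frequently hfreq
    have hlo : (fun n => (T n : ℝ)) =o[atTop ⊓ 𝓟 (Set.range φ)] fun n => Real.log (D n) := by
      refine IsLittleO.of_bound fun c hc => ?_
      rw [eventually_inf_principal]
      -- As `φ` is strictly increasing, the members of its range beyond `φ j₀` have index at least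
      -- `j₀`, where the ratio of `T` to `log D` is below `c`.
      obtain ⟨j₀, hj₀⟩ := exists_nat_ge (1 / c)
      filter_upwards [eventually_ge_atTop (φ j₀)]
      rintro _ hn ⟨j, rfl⟩
      have hj : (j₀ : ℝ) ≤ j := by exact_mod_cast hφ.le_iff_le.1 hn
      have h1 := (hφ' j).1
      rw [Real.norm_of_nonneg (Real.log_natCast_nonneg _), Real.norm_natCast]
      have h2 : (1 : ℝ) ≤ c * (j + 3) := by
        rw [div_le_iff₀ hc] at hj₀
        nlinarith
      have h3 : (0 : ℝ) ≤ T (φ j) := by positivity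
      nlinarith
    refine ⟨Set.range φ, w + 31, fun n => MPC.cycleTime n (D n) (T n) d,
      Set.infinite_range_of_injective hφ.injective,
      MPC.isLittleO_cycleTime inf_le_left d (hDn.filter_mono inf_le_left) hT hlo, ?_⟩
    rintro _ ⟨j, rfl⟩
    refine (hφ' j).2 (MPC.le_of_three_le_log ?_)
    have h1 : (1 : ℝ) ≤ T (φ j) := by exact_mod_cast hT (φ j)
    have h2 : (0 : ℝ) ≤ j := by positivity
    have h3 := (hφ' j).1
    nlinarith
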